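/- Let $F$ be a non-archimedean local field of characteristic different from $2$, with normalised absolute value $|\cdot|_F$ and residue field of cardinality $q$. Let $E/F$ be a quadratic extension, $|x|_E=|N_{E/F}(x)|_F$, and fix $\lambda\in E\setminus F$ with $\lambda^2\in F$. Let $D$ be a central division algebra over $F$ of odd index $d$ and let $D_E=D\otimes_F E$, a division algebra with ring of integers $O_{D_E}$. For $m\ge 1$ put $G=GL(m,D_E)$, $H=GL(m,D)\subset G$, $K=GL(m,O_{D_E})$, and let $P_\emptyset\subset G$ be the group of upper triangular matrices, with modulus character $\delta_{P_\emptyset}$. All inductions are unnormalised and smooth: $ind_P^G(\chi)$ consists of the smooth $f:G\to\mathbb C$ with $f(pg)=\chi(p)f(g)$. For $s\in\mathbb C$ let $\phi_s\in ind_{P_\emptyset}^G(\delta_{P_\emptyset}^s)$ be the function with $\phi_s(pk)=\delta_{P_\emptyset}(p)^s$ for $p\in P_\emptyset$, $k\in K$; it is written $\phi_{2,s}$ when $m=2$. For $m$ even let $u_0\in GL(m,E)$ be the matrix acting on the span of $(e_i,e_{m+1-i})$, $i\le m/2$, by $\begin{pmatrix}1&-\lambda\\1&\lambda\end{pmatrix}$.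 For $\Psi\in ind_{P_\emptyset}^G(\delta_{P_\emptyset}^s)$ put $$I_m(\Psi)=\int_{u_0^{-1}P_\emptyset u_0\cap H\backslash H}\Psi(u_0h)\,dh ,$$ where $dh$ is any fixed nonzero right $H$-invariant Radon measure. Wherever this integral converges absolutely it is invariant under right translation of $\Psi$ by $H$. Let $m=2r$ with $r\ge1$, and let $P\supset P_\emptyset$ be the standard parabolic subgroup of $G$ of type $(1,\dots,1,2,1,\dots,1)$, the $2$ being the $r$-th of the $2r-1$ parts. Put $$\kappa=\Big(\frac{|2\lambda|_E}{\max(1,|\lambda|_E)^2}\Big)^{d^2(r^2-1)}.$$ Then the double coset $Pu_0H$ is open in $G$, and there is $f\in ind_P^G(\mathbf 1)$, supported in $Pu_0H$, such that for $\mathrm{Re}(s)$ large enough both integrals below converge absolutely and $$I_m(f\phi_s)=\kappa^{s}\,I_2(\phi_{2,s}).$$ Moreover $I_m(f\phi_s)$ and $I_2(\phi_{2,s})$ extend to rational functions of $q^{-s}$ that are regular at $s=0$, and their values $I_m(f)$ and $I_2(\phi_2)$ at $s=0$ satisfy $$I_m(f)=I_2(\phi_2)\neq 0 .$$ In particular $I_m$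 does not vanish on $ind_P^G(\mathbf 1)$. -/

import Mathlib

open MeasureTheory
open scoped TensorProduct

noncomputable section

namespace LocalPeriod

/-- `GL(m, A)` for a possibly noncommutative ring `A`. For a topological ring `A` it carries the
topology of the unit group of the matrix ring. -/
abbrev GLn (m : ℕ) (A : Type*) [Ring A] : Type _ := (Matrix (Fin m) (Fin m) A)ˣ

section LocalField

variable (F : Type*) [NontriviallyNormedField F] [IsUltrametricDist F]

open scoped NormedField Valued in
/-- The cardinality `q` of the residue field of `F`. -/
def residueCard : ℕ := Nat.card (IsLocalRing.ResidueField 𝒪[F])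

open scoped NormedField Valued in
/-- The norm of `F` is the normalised absolute value `|.|_F`: uniformisers have absolute value
`1 / q`. -/
def NormIsNormalised : Prop :=
  ∀ ϖ : 𝒪[F], Irreducible ϖ → ‖(ϖ : F)‖ = (residueCard F : ℝ)⁻¹

end LocalField

section Groups

variable (F : Type*) [NontriviallyNormedField F] (A : Type*) [Ring A] [Algebra F A]

variable {A} in
/-- The module `|N_{A/F}(x)|_F` of (left or right multiplication by) `x`. If `A` is a central
division algebra of index `d` over a finite extension `E` of `F`, this is
`|N_{rd,E}(x)|_E ^ d = ν_E(x) ^ d`. -/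
def modAbs (x : A) : ℝ := ‖Algebra.norm F x‖

/-- The parabolic subgroup of `GL(m, A)` of block upper triangular matrices; the index `i` lies in
the block numbered `b i`. -/
def parabolic {m : ℕ} (b : Fin m → ℕ) : Subgroup (GLn m A) where
  carrier := {g | (g : Matrix (Fin m) (Fin m) A).BlockTriangular b ∧
    ((g⁻¹ : GLn m A) : Matrix (Fin m) (Fin m) A).BlockTriangular b}
  mul_mem' := by
    rintro x y ⟨hx, hx'⟩ ⟨hy, hy'⟩
    refine ⟨?_, ?_⟩
    · rw [Units.val_mul]; exact hx.mul hy
    · rw [mul_inv_rev, Units.val_mul]; exact hy'.mul hx'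
  one_mem' := by
    refine ⟨?_, ?_⟩
    · exact Matrix.blockTriangular_one
    · rw [inv_one]; exact Matrix.blockTriangular_one
  inv_mem' := by
    rintro x ⟨hx, hx'⟩
    exact ⟨hx', by rwa [inv_inv]⟩

/-- The minimal parabolic subgroup `P_∅` of upper triangular matrices. -/
def minParabolic (m : ℕ) : Subgroup (GLn m A) := parabolic A (fun i : Fin m => (i : ℕ))

/-- The standard parabolic subgroup of `GL(2r, A)` of type `(1, …, 1, 2, 1, …, 1)`, in which the
two middle indices form the block of size `2`. -/
def middleParabolic (r : ℕ) : Subgroup (GLn (2 * r) A) :=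
  parabolic A (fun i : Fin (2 * r) => if (i : ℕ) < r then (i : ℕ) else (i : ℕ) - 1)

variable {A} in
/-- The modulus character of `P_∅`, `δ(p) = ∏_{i < j} |p_ii| / |p_jj|` with `|.|` the module of
`A`. It is the absolute value of the determinant of `Ad p` on the Lie algebra of the unipotent
radical of `P_∅`. -/
def borelModulus {m : ℕ} (p : GLn m A) : ℝ :=
  ∏ i : Fin m, ∏ j ∈ Finset.Ioi i,
    modAbs F ((p : Matrix (Fin m) (Fin m) A) i i) / modAbs F ((p : Matrix (Fin m) (Fin m) A) j j)

/-- `K = GL(m, O_A)` where `O_A = {x | |N_{A/F}(x)|_F ≤ 1}` is the ring of integers of the division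
algebra `A`. -/
def integralGL (m : ℕ) : Set (GLn m A) :=
  {g | ∀ i j, modAbs F ((g : Matrix (Fin m) (Fin m) A) i j) ≤ 1 ∧
    modAbs F (((g⁻¹ : GLn m A) : Matrix (Fin m) (Fin m) A) i j) ≤ 1}

open Classical in
variable {A} in
/-- The function on `GL(m, A)` given by `p k ↦ δ(p)` for `p ∈ P_∅` and `k ∈ K`. By the Iwasawa
decomposition the first case always applies, and the value does not depend on the choice. -/
def iwasawaModulus {m : ℕ} (g : GLn m A) : ℝ :=
  if h : ∃ p ∈ minParabolic A m, ∃ k ∈ integralGL F A m, g = p * k then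
    borelModulus F h.choose else 0

variable {A} in
/-- The spherical function `φ_s`: the element of `ind (δ ^ s)` which equals `1` on `K`. -/
def phi {m : ℕ} (s : ℂ) (g : GLn m A) : ℂ := (iwasawaModulus F g : ℂ) ^ s

end Groups

/-- `f ∈ ind_P^G(χ)` (unnormalised smooth induction): `f` transforms by `χ` under left translation
by `P`, it is invariant under right translation by some open subgroup, and its support is compact
modulo `P`. -/
structure MemInd {G : Type*} [Group G] [TopologicalSpace G] (P : Subgroup G) (χ : G → ℂ)
    (f : G → ℂ) : Prop where
  equivariant : ∀ p ∈ P, ∀ g, f (p * g) = χ p * f g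
  smooth : ∃ U : Subgroup G, IsOpen (U : Set G) ∧ ∀ g, ∀ k ∈ U, f (g * k) = f g
  compactSupport : ∃ C : Set G, IsCompact C ∧ ∀ g, f g ≠ 0 → ∃ p ∈ P, ∃ c ∈ C, g = p * c

section Period

/-- The matrix `u_0` over `E`: on the plane spanned by `e_i` and `e_{m+1-i}`, for `i < m + 1 - i`,
it is `(1, -lam; 1, lam)`. -/
def u0Matrix {E : Type*} [Field E] (m : ℕ) (lam : E) : Matrix (Fin m) (Fin m) E :=
  fun i j =>
    if j = i then (if i ≤ i.rev then 1 else lam)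
    else if j = i.rev then (if i < i.rev then -lam else 1)
    else 0

/-- The inverse of `u0Matrix`. -/
def u0MatrixInv {E : Type*} [Field E] (m : ℕ) (lam : E) : Matrix (Fin m) (Fin m) E :=
  fun i j =>
    if j = i then (if i = i.rev then 1 else if i < i.rev then 2⁻¹ else (2 * lam)⁻¹)
    else if j = i.rev then (if i < i.rev then 2⁻¹ else -(2 * lam)⁻¹)
    else 0

theorem u0Matrix_mul_inv {E : Type*} [Field E] (m : ℕ) (lam : E) (h : 2 * lam ≠ 0) :
    u0Matrix m lam * u0MatrixInv m lam = 1 := by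
  have h2 : (2 : E) ≠ 0 := left_ne_zero_of_mul h
  have hl : lam ≠ 0 := right_ne_zero_of_mul h
  ext i k
  rw [Matrix.mul_apply]
  rcases eq_or_ne i i.rev with hi | hi
  · rw [Finset.sum_eq_single i]
    · by_cases hk : k = i
      · subst hk
        simp [u0Matrix, u0MatrixInv, ← hi]
      · simp [u0Matrix, u0MatrixInv, hk, ← hi, Ne.symm hk]
    · intro j _ hj
      simp [u0Matrix, hj, ← hi]
    · simp
  · rw [← Finset.sum_subset (Finset.subset_univ {i, i.rev}), Finset.sum_pair hi]
    · rcases lt_or_gt_of_ne hi with hlt | hlt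
      · by_cases hk : k = i
        · subst hk
          simp [u0Matrix, u0MatrixInv, hi, hi.symm, hlt, hlt.le, hlt.not_gt]
          field_simp
          norm_num
        · by_cases hk' : k = i.rev
          · subst hk'
            simp [u0Matrix, u0MatrixInv, hi, hi.symm, hlt, hlt.le, hlt.not_gt]
            field_simp
            norm_num
          · simp [u0MatrixInv, hk, hk', Ne.symm hk]
      · by_cases hk : k = i
        · subst hk
          simp [u0Matrix, u0MatrixInv, hi, hi.symm, hlt, hlt.not_ge, hlt.not_gt]
          field_simp
          norm_num
        · by_cases hk' : k = i.rev
          · subst hk'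
            simp [u0Matrix, u0MatrixInv, hi, hi.symm, hlt, hlt.not_ge, hlt.not_gt]
            field_simp
            norm_num
          · simp [u0MatrixInv, hk, hk', Ne.symm hk]
    · intro j _ hj
      simp only [Finset.mem_insert, Finset.mem_singleton, not_or] at hj
      simp [u0Matrix, hj.1, hj.2]

/-- `u_0` as an element of `GL(m, E)`. -/
def u0E {E : Type*} [Field E] (m : ℕ) (lam : E) (h : 2 * lam ≠ 0) : GLn m E where
  val := u0Matrix m lam
  inv := u0MatrixInv m lam
  val_inv := u0Matrix_mul_inv m lam h
  inv_val := mul_eq_one_comm.mp (u0Matrix_mul_inv m lam h)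

theorem two_mul_ne_zero_of_notMem {F E : Type*} [Field F] [Field E] [Algebra F E] {lam : E}
    (h2 : (2 : F) ≠ 0) (hlam : lam ∉ Set.range (algebraMap F E)) : 2 * lam ≠ 0 := by
  refine mul_ne_zero ?_ ?_
  · intro h
    apply h2
    apply (algebraMap F E).injective
    rw [map_ofNat, map_zero, h]
  · rintro rfl
    exact hlam ⟨0, map_zero _⟩

variable (F E D : Type*) [Field F] [Field E] [Algebra F E] [DivisionRing D] [Algebra F D]

/-- `u_0` as an element of `G = GL(m, D ⊗ E)`. -/
def u0 (m : ℕ) (lam : E) (h : 2 * lam ≠ 0) : GLn m (D ⊗[F] E) :=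
  Units.map
    ((Algebra.TensorProduct.includeRight : E →ₐ[F] D ⊗[F] E).toRingHom.mapMatrix :
      Matrix (Fin m) (Fin m) E →+* Matrix (Fin m) (Fin m) (D ⊗[F] E)).toMonoidHom
    (u0E m lam h)

/-- The embedding of `H = GL(m, D)` into `G = GL(m, D ⊗ E)`. -/
def embH (m : ℕ) : GLn m D →* GLn m (D ⊗[F] E) :=
  Units.map
    ((Algebra.TensorProduct.includeLeft : D →ₐ[F] D ⊗[F] E).toRingHom.mapMatrix :
      Matrix (Fin m) (Fin m) D →+* Matrix (Fin m) (Fin m) (D ⊗[F] E)).toMonoidHom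

/-- The subgroup `u⁻¹ P_∅ u ∩ H` of `H`. -/
def stab (m : ℕ) (u : GLn m (D ⊗[F] E)) : Subgroup (GLn m D) :=
  ((minParabolic (D ⊗[F] E) m).comap (MulAut.conj u).toMonoidHom).comap (embH F E D m)

/-- The homogeneous space `(u⁻¹ P_∅ u ∩ H) \ H`, realised as `H ⧸ (u⁻¹ P_∅ u ∩ H)` through
`h ↦ h⁻¹`. Right invariant measures on the former are left invariant measures on the latter. -/
abbrev Orbit (m : ℕ) (u : GLn m (D ⊗[F] E)) : Type _ := GLn m D ⧸ stab F E D m u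

/-- The function `h ↦ Ψ(u h)` on `(u⁻¹ P_∅ u ∩ H) \ H`. -/
def orbitFun (m : ℕ) (u : GLn m (D ⊗[F] E)) (Ψ : GLn m (D ⊗[F] E) → ℂ) : Orbit F E D m u → ℂ :=
  fun x => Ψ (u * (embH F E D m (Quotient.out x))⁻¹)

/-- The integral `∫ Ψ(u h) dh` over `(u⁻¹ P_∅ u ∩ H) \ H`. -/
def period (m : ℕ) (u : GLn m (D ⊗[F] E)) [MeasurableSpace (Orbit F E D m u)]
    (μ : Measure (Orbit F E D m u)) (Ψ : GLn m (D ⊗[F] E) → ℂ) : ℂ :=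
  ∫ x, orbitFun F E D m u Ψ x ∂μ

/-- The double coset `P u H`. -/
def doubleCoset (m : ℕ) (P : Subgroup (GLn m (D ⊗[F] E))) (u : GLn m (D ⊗[F] E)) :
    Set (GLn m (D ⊗[F] E)) :=
  {g | ∃ p ∈ P, ∃ h : GLn m D, g = p * u * embH F E D m h}

end Period

/-- On some right half plane `J` is a rational function of `q ^ (-s)`, and the meromorphic
continuation so obtained is regular at `s = 0` with value `z` there. -/
def HasValueAtZero (q : ℕ) (J : ℂ → ℂ) (z : ℂ) : Prop :=
  ∃ N Q : Polynomial ℂ, Q.eval 1 ≠ 0 ∧ z = N.eval 1 / Q.eval 1 ∧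
    ∃ σ : ℝ, ∀ s : ℂ, σ < s.re →
      Q.eval ((q : ℂ) ^ (-s)) * J s = N.eval ((q : ℂ) ^ (-s))

end LocalPeriod

end

open MeasureTheory
open scoped TensorProduct

noncomputable section

set_option linter.unusedSectionVars false

namespace LocalPeriod

open Topology Filter

/-! The proof rests on one symmetry. The conjugation `τ` of `E` over `F` sends `lam` to `-lam`, so
it exchanges the two rows of `u₀` in each plane spanned by `e_i` and `e_{m+1-i}`; that is, `τ(u₀) =
w u₀` with `w` the reversal of the indices (`u0Matrix_conj`). Hence every `q = u₀ h u₀⁻¹` with `h ∈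
H` satisfies `τ(q i j) = q i.rev j.rev`. If `q` is block upper triangular for a partition stable
under reversal, it is also block lower triangular. For `P_∅` this makes `q` diagonal, and for `P` it
makes `q` diagonal up to the middle 2×2 block. In both cases `h` preserves all planes
(`conj_embH_mem_parabolic_iff`). So `u₀⁻¹ P_∅ u₀ ∩ H` is a product of the stabilisers for `m = 2`,
and passing to `P` replaces the factor at the middle plane by all of `GL(2, D)`. The linear form of
the symmetry, `exists_lie_decomposition`, says that the Lie algebras of `P` and of `u₀ H u₀⁻¹` span
that of `G`; the open mapping form of the inverse function theorem (`doubleCoset_mem_nhds`) then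
makes `P u₀ J` open for every open subgroup `J` of `H`.

The function `f` is a multiple of the indicator of `P u₀ GL(2r, O_D)`. In the orbit its support is a
union of `GL(2r, O_D)`-orbits through the copy of `GL(2, D)` in the middle plane, and these
correspond to the `GL(2, O_D)`-orbits for `m = 2`. Two facts compare the integrals orbit by orbit.
Volumes are proportional (`measure_orbit_singlePlane`): they are expressed by indices inside the
stabilisers, and only the middle factor contributes. The values of the spherical function differ by
the constant `κ ^ s` (`iwasawaModulus_singlePlane`): each other plane `i` contributes the modulus of
`u₀` for `m = 2` to the power `2r - 1 - 2i`, and the exponents `3, 5, …, 2r - 1` add up to `r² - 1`.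
The constant in `f` removes the ratio of volumes (`integral_comparison`, `exists_test_function`).

There remains `m = 2`. The matrices `(1, b; 0, c)` give coordinates `(b, c)` on the orbit, and `φ`
is `|c|² |2 lam|^{dim D} / max(1, |b + c lam|)²`, where each `|·|` is `modAbs` of the algebra
concerned and `dim D` is over `F`. Choosing `b₀` so that `b₀ + lam` has least absolute value gives
`|b + c lam| = max(|b - b₀ c|², ρ |c|²)` (`exists_nearest`), so `φ` is constant on explicit cells
whose volumes follow from invariance. The integral becomes a sum of geometric series in `X = q^{-s}`
(`exists_period_two_series`, `hasSum_cells`). Its apparent pole at `X = 1` cancels, and the value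
left there is nonzero because a derivative is negative (`exists_value_of_cells`). Finally `κ` is a
power of `q`, so `κ ^ s` is a power of `X` and equals 1 at `s = 0`. -/

instance instIsModuleTopologyMatrix {R V m n : Type*} [TopologicalSpace R] [CommRing R]
    [IsTopologicalRing R]
    [AddCommGroup V] [Module R V] [TopologicalSpace V] [IsModuleTopology R V] [Finite m]
    [Finite n] : IsModuleTopology R (Matrix m n V) :=
  inferInstanceAs (IsModuleTopology R (m → n → V))

/-! ### The ultrametric absolute value on a division algebra over `F`. -/

section FiniteAlgebra

variable {F : Type*} [NontriviallyNormedField F]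
variable {B : Type*} [Ring B] [Algebra F B]

theorem modAbs_mul (x y : B) : modAbs F (x * y) = modAbs F x * modAbs F y := by
  simp [modAbs]

theorem modAbs_one : modAbs F (1 : B) = 1 := by
  simp [modAbs]

theorem modAbs_nonneg (x : B) : 0 ≤ modAbs F x := norm_nonneg _

theorem modAbs_pow (x : B) (n : ℕ) : modAbs F (x ^ n) = modAbs F x ^ n := by
  simp [modAbs]

theorem modAbs_algebraMap [Nontrivial B] (a : F) :
    modAbs F (algebraMap F B a) = ‖a‖ ^ Module.finrank F B := by
  simp [modAbs, Algebra.norm_algebraMap]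

theorem modAbs_smul [Nontrivial B] (a : F) (x : B) :
    modAbs F (a • x) = ‖a‖ ^ Module.finrank F B * modAbs F x := by
  rw [Algebra.smul_def, modAbs_mul, modAbs_algebraMap]

theorem modAbs_neg [Nontrivial B] (x : B) : modAbs F (-x) = modAbs F x := by
  have := modAbs_smul (-1 : F) x
  simpa using this

theorem modAbs_zero [Nontrivial B] [FiniteDimensional F B] : modAbs F (0 : B) = 0 := by
  have := modAbs_smul (0 : F) (0 : B)
  rw [zero_smul, norm_zero, zero_pow (Module.finrank_pos (R := F) (M := B)).ne', zero_mul] at this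
  exact this

theorem modAbs_units_pos (x : Bˣ) : 0 < modAbs F (x : B) := by
  refine lt_of_le_of_ne (modAbs_nonneg _) fun h => ?_
  have := modAbs_mul (F := F) (x : B) ((x⁻¹ : Bˣ) : B)
  rw [Units.mul_inv, modAbs_one, ← h, zero_mul] at this
  exact one_ne_zero this

theorem modAbs_units_inv (x : Bˣ) : modAbs F ((x⁻¹ : Bˣ) : B) = (modAbs F (x : B))⁻¹ := by
  refine eq_inv_of_mul_eq_one_left ?_
  rw [← modAbs_mul, Units.inv_mul, modAbs_one]

theorem modAbs_algEquiv {B' : Type*} [Ring B'] [Algebra F B'] (e : B ≃ₐ[F] B') (x : B) :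
    modAbs F (e x) = modAbs F x := by
  rw [modAbs, modAbs, Algebra.norm_eq_of_algEquiv]

variable [FiniteDimensional F B] [IsDomain B]

theorem modAbs_pos {x : B} (hx : x ≠ 0) : 0 < modAbs F x := by
  obtain ⟨u, rfl⟩ := FiniteDimensional.isUnit F hx
  exact modAbs_units_pos u

variable [TopologicalSpace B] [IsModuleTopology F B]

theorem continuous_linear_of_moduleTopology {V W : Type*} [AddCommGroup V] [Module F V]
    [TopologicalSpace V] [IsModuleTopology F V] [AddCommGroup W] [Module F W]
    [TopologicalSpace W] [IsModuleTopology F W] (f : V →ₗ[F] W) : Continuous f := by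
  have := IsModuleTopology.toContinuousAdd F W
  exact IsModuleTopology.continuous_of_linearMap f

/-- Coordinates of a finite-dimensional space with respect to some basis, as a homeomorphism. -/
def coordHomeo (F : Type*) [NontriviallyNormedField F] (V : Type*) [AddCommGroup V] [Module F V]
    [FiniteDimensional F V] [TopologicalSpace V] [IsModuleTopology F V] :
    V ≃L[F] (Fin (Module.finrank F V) → F) where
  toLinearEquiv := (Module.finBasis F V).equivFun
  continuous_toFun := continuous_linear_of_moduleTopology
    ((Module.finBasis F V).equivFun : V →ₗ[F] (Fin (Module.finrank F V) → F))
  continuous_invFun := continuous_linear_of_moduleTopology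
    ((Module.finBasis F V).equivFun.symm : (Fin (Module.finrank F V) → F) →ₗ[F] V)

theorem continuous_modAbs : Continuous (modAbs F : B → ℝ) := by
  have h : Continuous (fun x : B => Algebra.leftMulMatrix (Module.finBasis F B) x) :=
    continuous_linear_of_moduleTopology (Algebra.leftMulMatrix (Module.finBasis F B)).toLinearMap
  have h2 : (modAbs F : B → ℝ) =
      fun x => ‖(Algebra.leftMulMatrix (Module.finBasis F B) x).det‖ := by
    ext x
    rw [modAbs, Algebra.norm_eq_matrix_det (Module.finBasis F B)]
  rw [h2]
  exact h.matrix_det.norm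

/-- For the sup norm the norm of a vector is the norm of a scalar, so a nonzero vector can be
rescaled to norm exactly 1. -/
theorem exists_norm_eq_coord {n : ℕ} [NeZero n] (v : Fin n → F) : ∃ a : F, ‖v‖ = ‖a‖ := by
  obtain ⟨i, hi⟩ := Finite.exists_max (fun i => ‖v i‖)
  refine ⟨v i, le_antisymm ((pi_norm_le_iff_of_nonneg (norm_nonneg _)).2 hi) (norm_le_pi_norm v i)⟩

variable [LocallyCompactSpace F]

/-- Both sides are homogeneous of the same degree under scalars, so it suffices to compare them on
the unit sphere of the coordinate space. The sphere is compact, and `modAbs` is continuous and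
positive on it. -/
theorem exists_modAbs_bounds : ∃ c C : ℝ, 0 < c ∧ 0 < C ∧ ∀ x : B,
    c * ‖coordHomeo F B x‖ ^ Module.finrank F B ≤ modAbs F x ∧
    modAbs F x ≤ C * ‖coordHomeo F B x‖ ^ Module.finrank F B := by
  have : ProperSpace F := .of_nontriviallyNormedField_of_weaklyLocallyCompactSpace F
  set n := Module.finrank F B with hn
  have hn0 : n ≠ 0 := (Module.finrank_pos (R := F) (M := B)).ne'
  have : NeZero n := ⟨hn0⟩
  let e := coordHomeo F B
  have hcont : Continuous fun v => modAbs F (e.symm v) := continuous_modAbs.comp e.symm.continuous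
  have hS : IsCompact (Metric.sphere (0 : Fin n → F) 1) := isCompact_sphere _ _
  have hne : (Metric.sphere (0 : Fin n → F) 1).Nonempty := by
    refine ⟨fun _ => 1, ?_⟩
    simp
  obtain ⟨v₁, hv₁, h₁⟩ := hS.exists_isMinOn hne hcont.continuousOn
  obtain ⟨v₂, hv₂, h₂⟩ := hS.exists_isMaxOn hne hcont.continuousOn
  have hpos : ∀ v ∈ Metric.sphere (0 : Fin n → F) 1, 0 < modAbs F (e.symm v) := by
    intro v hv
    refine modAbs_pos fun h => ?_
    rw [map_eq_zero_iff _ e.symm.injective] at h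
    simp [h] at hv
  refine ⟨_, _, hpos v₁ hv₁, hpos v₂ hv₂, fun x => ?_⟩
  rcases eq_or_ne x 0 with rfl | hx
  · simp [modAbs_zero, ← hn, hn0]
  obtain ⟨a, ha⟩ := exists_norm_eq_coord (e x)
  have hex : ‖e x‖ ≠ 0 := by
    rw [norm_ne_zero_iff, Ne, map_eq_zero_iff _ e.injective]; exact hx
  have ha0 : a ≠ 0 := by
    rintro rfl
    rw [norm_zero] at ha
    exact hex ha
  have hmem : e (a⁻¹ • x) ∈ Metric.sphere (0 : Fin n → F) 1 := by
    rw [mem_sphere_zero_iff_norm, map_smul, norm_smul, norm_inv, ← ha, inv_mul_cancel₀ hex]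
  have hx' : modAbs F x = ‖e x‖ ^ n * modAbs F (e.symm (e (a⁻¹ • x))) := by
    rw [ContinuousLinearEquiv.symm_apply_apply, ha, ← modAbs_smul, smul_inv_smul₀ ha0]
  have h0 : 0 ≤ ‖e x‖ ^ n := by positivity
  change _ * ‖e x‖ ^ n ≤ _ ∧ _ ≤ _ * ‖e x‖ ^ n
  rw [hx', mul_comm _ (‖e x‖ ^ n), mul_comm _ (‖e x‖ ^ n)]
  exact ⟨mul_le_mul_of_nonneg_left (h₁ hmem) h0, mul_le_mul_of_nonneg_left (h₂ hmem) h0⟩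

theorem isCompact_modAbs_le (t : ℝ) : IsCompact {x : B | modAbs F x ≤ t} := by
  have : ProperSpace F := .of_nontriviallyNormedField_of_weaklyLocallyCompactSpace F
  obtain ⟨c, C, hc, hC, h⟩ := exists_modAbs_bounds (F := F) (B := B)
  set n := Module.finrank F B with hn
  have hn0 : n ≠ 0 := (Module.finrank_pos (R := F) (M := B)).ne'
  let e := coordHomeo F B
  -- The lower bound 1 on the radius allows `‖e x‖ ≤ ‖e x‖ ^ n`, which avoids taking an `n`-th root
  -- of `t / c`.
  have hK : IsCompact (e.symm '' Metric.closedBall (0 : Fin n → F) (max 1 (t / c))) :=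
    (isCompact_closedBall _ _).image e.symm.continuous
  refine hK.of_isClosed_subset (isClosed_le continuous_modAbs continuous_const) ?_
  intro x hx
  refine ⟨e x, ?_, e.symm_apply_apply x⟩
  rw [mem_closedBall_zero_iff]
  by_contra! hlt
  have h1 : 1 ≤ ‖e x‖ := (le_max_left _ _).trans hlt.le
  have h2 : t / c < ‖e x‖ := (le_max_right _ _).trans_lt hlt
  have h3 : ‖e x‖ ≤ ‖e x‖ ^ n := le_self_pow₀ h1 hn0
  have h4 := (h x).1
  have h5 : t < c * ‖e x‖ ^ n := by
    rw [div_lt_iff₀' hc] at h2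
    exact h2.trans_le (mul_le_mul_of_nonneg_left h3 hc.le)
  exact absurd (h4.trans hx) (not_le.2 h5)

variable [IsUltrametricDist F]

/-- The powers of `x` stay in a compact set. Binomial coefficients have norm at most 1, so the
coordinates of `(1 + x) ^ k` obey the same bound for all `k`. A multiplicative function bounded on
all powers of `1 + x` is at most 1 there. -/
theorem modAbs_one_add_le {x : B} (hx : modAbs F x ≤ 1) : modAbs F (1 + x) ≤ 1 := by
  obtain ⟨c, C, hc, hC, h⟩ := exists_modAbs_bounds (F := F) (B := B)
  set n := Module.finrank F B with hn
  have hn0 : n ≠ 0 := (Module.finrank_pos (R := F) (M := B)).ne'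
  have hbdd : ∃ R : ℝ, ∀ k : ℕ, ‖coordHomeo F B (x ^ k)‖ ≤ R := by
    obtain ⟨R, hR⟩ := ((isCompact_modAbs_le (F := F) (B := B) 1).image
      (coordHomeo F B).continuous).isBounded.exists_norm_le
    exact ⟨R, fun k => hR _ ⟨x ^ k, by
      simpa [modAbs_pow] using pow_le_one₀ (modAbs_nonneg x) hx, rfl⟩⟩
  obtain ⟨R, hR⟩ := hbdd
  have hR0 : 0 ≤ R := (norm_nonneg _).trans (hR 0)
  have hpow : ∀ k : ℕ, ‖coordHomeo F B ((1 + x) ^ k)‖ ≤ R := by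
    intro k
    rw [add_comm, (Commute.one_right x).add_pow, map_sum]
    refine IsUltrametricDist.norm_sum_le_of_forall_le_of_nonneg hR0 fun i _ => ?_
    have : x ^ i * 1 ^ (k - i) * (k.choose i : B) = ((k.choose i : F)) • x ^ i := by
      rw [one_pow, mul_one, Algebra.smul_def, map_natCast, Nat.cast_comm]
    rw [this, map_smul, norm_smul]
    exact (mul_le_of_le_one_left (norm_nonneg _)
      (IsUltrametricDist.norm_natCast_le_one F _)).trans (hR i)
  by_contra! hlt
  obtain ⟨k, hk⟩ := pow_unbounded_of_one_lt (C * R ^ n) hlt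
  have h1 := (h ((1 + x) ^ k)).2
  rw [modAbs_pow] at h1
  have h2 : C * ‖coordHomeo F B ((1 + x) ^ k)‖ ^ n ≤ C * R ^ n := by
    gcongr
    exact hpow k
  linarith

theorem modAbs_add_le (x y : B) : modAbs F (x + y) ≤ max (modAbs F x) (modAbs F y) := by
  wlog hxy : modAbs F x ≤ modAbs F y generalizing x y
  · rw [add_comm, max_comm]
    exact this y x (le_of_not_ge hxy)
  rw [max_eq_right hxy]
  rcases eq_or_ne y 0 with rfl | hy
  · rw [modAbs_zero] at hxy
    rw [add_zero, modAbs_zero]; exact hxy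
  obtain ⟨u, rfl⟩ := FiniteDimensional.isUnit F hy
  have hu := modAbs_units_pos (F := F) u
  have h1 : x + u = (1 + x * (u⁻¹ : Bˣ)) * u := by
    rw [add_mul, one_mul, mul_assoc, Units.inv_mul, mul_one, add_comm]
  rw [h1, modAbs_mul]
  refine mul_le_of_le_one_left hu.le (modAbs_one_add_le ?_)
  rw [modAbs_mul, modAbs_units_inv]
  exact mul_inv_le_one_of_le₀ hxy hu.le

theorem modAbs_sub_le (x y : B) : modAbs F (x - y) ≤ max (modAbs F x) (modAbs F y) := by
  rw [sub_eq_add_neg, ← modAbs_neg (F := F) y]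
  exact modAbs_add_le _ _

theorem modAbs_add_eq_of_lt {x y : B} (h : modAbs F x < modAbs F y) :
    modAbs F (x + y) = modAbs F y := by
  refine le_antisymm ((modAbs_add_le x y).trans (max_le h.le le_rfl)) ?_
  by_contra! hlt
  have h1 := modAbs_sub_le (F := F) (x + y) x
  rw [add_sub_cancel_left] at h1
  exact absurd h1 (not_le.2 (max_lt hlt h))

theorem modAbs_sum_le {ι : Type*} (s : Finset ι) (f : ι → B) {t : ℝ} (ht : 0 ≤ t)
    (h : ∀ i ∈ s, modAbs F (f i) ≤ t) : modAbs F (∑ i ∈ s, f i) ≤ t := by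
  classical
  induction s using Finset.induction_on with
  | empty => simpa [modAbs_zero] using ht
  | insert a s ha ih =>
    rw [Finset.sum_insert ha]
    refine (modAbs_add_le _ _).trans (max_le (h a (Finset.mem_insert_self _ _)) (ih fun i hi =>
      h i (Finset.mem_insert_of_mem hi)))

theorem isOpen_modAbs_le {t : ℝ} (ht : 0 < t) : IsOpen {x : B | modAbs F x ≤ t} := by
  have := IsModuleTopology.toContinuousAdd F B
  have := IsModuleTopology.topologicalAddGroup F B
  rw [isOpen_iff_mem_nhds]
  intro x hx
  have h1 : {y : B | modAbs F (y - x) < t} ∈ 𝓝 x := by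
    refine (isOpen_lt (continuous_modAbs.comp (continuous_id.sub continuous_const))
      continuous_const).mem_nhds ?_
    simpa [modAbs_zero] using ht
  filter_upwards [h1] with y hy
  have := modAbs_add_le (F := F) (y - x) x
  rw [sub_add_cancel] at this
  exact this.trans (max_le (le_of_lt hy) hx)

end FiniteAlgebra
end LocalPeriod

namespace LocalPeriod

open Topology Filter

/-! ### Uniformisers, residue field and value group of `F`. -/

section LocalFieldFacts

variable {F : Type*} [NontriviallyNormedField F] [IsUltrametricDist F] [LocallyCompactSpace F]

open scoped NormedField Valued

theorem compactSpace_integer : CompactSpace 𝒪[F] := by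
  have : ProperSpace F := .of_nontriviallyNormedField_of_weaklyLocallyCompactSpace F
  rw [← isCompact_univ_iff, Subtype.isCompact_iff, Set.image_univ, Subtype.range_coe_subtype]
  have : {x : F | x ∈ 𝒪[F]} = Metric.closedBall 0 1 := by
    ext x
    simp [Valued.integer.mem_iff]
  rw [this]
  exact isCompact_closedBall _ _

theorem isNontrivial_valuation : (Valued.v : Valuation F NNReal).IsNontrivial := by
  rw [Valuation.isNontrivial_iff_exists_lt_one]
  obtain ⟨x, hx, hx'⟩ := NormedField.exists_norm_lt_one F
  refine ⟨x, norm_pos_iff.1 hx, ?_⟩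
  rw [NormedField.v_eq_valuation, ← NNReal.coe_lt_coe]
  simpa using hx'

theorem isDiscreteValuationRing_integer : IsDiscreteValuationRing 𝒪[F] := by
  have := compactSpace_integer (F := F)
  have := isNontrivial_valuation (F := F)
  exact Valued.integer.isDiscreteValuationRing_of_compactSpace

theorem finite_residueField : Finite (IsLocalRing.ResidueField 𝒪[F]) := by
  have := compactSpace_integer (F := F)
  have := isNontrivial_valuation (F := F)
  have h := isDiscreteValuationRing_integer (F := F)
  have hc : IsCompact (Set.univ : Set 𝒪[F]) := isCompact_univ
  obtain ⟨ϖ, hϖ⟩ := IsDiscreteValuationRing.exists_irreducible 𝒪[F]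
  have hopen : IsOpen ((𝓂[F] : Ideal 𝒪[F]).toAddSubgroup : Set 𝒪[F]) := by
    have h1 : ((𝓂[F] : Ideal 𝒪[F]).toAddSubgroup : Set 𝒪[F]) = Metric.closedBall 0 ‖ϖ‖ :=
      hϖ.maximalIdeal_eq_closedBall
    rw [h1]
    exact IsUltrametricDist.isOpen_closedBall _ (Valued.integer.norm_irreducible_pos hϖ).ne'
  exact AddSubgroup.quotient_finite_of_isOpen _ hopen

theorem two_le_residueCard : 2 ≤ residueCard F := by
  have := finite_residueField (F := F)
  have := (Finite.one_lt_card_iff_nontrivial (α := IsLocalRing.ResidueField 𝒪[F])).2 inferInstance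
  exact this

theorem index_maximalIdeal : (𝓂[F] : Ideal 𝒪[F]).toAddSubgroup.index = residueCard F := rfl

/-- A uniformiser, its absolute value, and the value group. -/
theorem exists_uniformiser (hF : NormIsNormalised F) :
    ∃ ϖ : 𝒪[F], Irreducible ϖ ∧ ‖(ϖ : F)‖ = (residueCard F : ℝ)⁻¹ ∧ (ϖ : F) ≠ 0 := by
  have h := isDiscreteValuationRing_integer (F := F)
  obtain ⟨ϖ, hϖ⟩ := IsDiscreteValuationRing.exists_irreducible 𝒪[F]
  exact ⟨ϖ, hϖ, hF ϖ hϖ, fun h0 => hϖ.ne_zero (Subtype.ext h0)⟩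

theorem exists_norm_eq_zpow (hF : NormIsNormalised F) {x : F} (hx : x ≠ 0) :
    ∃ n : ℤ, ‖x‖ = (residueCard F : ℝ) ^ n := by
  have h := isDiscreteValuationRing_integer (F := F)
  obtain ⟨ϖ, hϖ, hn, -⟩ := exists_uniformiser hF
  have key : ∀ y : F, y ≠ 0 → ‖y‖ ≤ 1 → ∃ n : ℤ, ‖y‖ = (residueCard F : ℝ) ^ n := by
    intro y hy hy1
    obtain ⟨n, u, hu⟩ := IsDiscreteValuationRing.eq_unit_mul_pow_irreducible
      (x := (⟨y, Valued.integer.mem_iff.2 hy1⟩ : 𝒪[F])) (fun h => hy (congrArg Subtype.val h)) hϖ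
    refine ⟨-n, ?_⟩
    have h1 : y = ((u : 𝒪[F]) : F) * (ϖ : F) ^ n := congrArg Subtype.val hu
    rw [h1, norm_mul, norm_pow, Valued.integer.norm_coe_unit, hn, one_mul, zpow_neg, zpow_natCast,
      inv_pow]
  rcases le_total ‖x‖ 1 with h1 | h1
  · exact key x hx h1
  · obtain ⟨n, hn⟩ := key x⁻¹ (inv_ne_zero hx) (by rw [norm_inv]; exact inv_le_one_of_one_le₀ h1)
    refine ⟨-n, ?_⟩
    rw [zpow_neg, ← hn, norm_inv, inv_inv]

end LocalFieldFacts

/-! ### Indices of balls in a division algebra. -/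

section Index

theorem relIndex_ne_zero_of_isOpen_of_isCompact {G : Type*} [AddGroup G] [TopologicalSpace G]
    [IsTopologicalAddGroup G] (U K : AddSubgroup G) (hU : IsOpen (U : Set G))
    (hK : IsCompact (K : Set G)) : U.relIndex K ≠ 0 := by
  have : CompactSpace K := isCompact_iff_compactSpace.1 hK
  have h1 : IsOpen ((U.addSubgroupOf K : AddSubgroup K) : Set K) :=
    hU.preimage continuous_subtype_val
  have := AddSubgroup.quotient_finite_of_isOpen _ h1
  exact AddSubgroup.index_ne_zero_of_finite

variable (F : Type*) [NontriviallyNormedField F] [IsUltrametricDist F] [LocallyCompactSpace F]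
variable (B : Type*) [Ring B] [Algebra F B] [FiniteDimensional F B] [IsDomain B]
  [TopologicalSpace B] [IsModuleTopology F B]

/-- The ball of radius `t` for the absolute value `modAbs`. -/
def modBall (t : ℝ) : AddSubgroup B where
  -- The `max` keeps 0 in the set when `t < 0`.
  carrier := {x | modAbs F x ≤ max t 0}
  zero_mem' := by
    change modAbs F (0 : B) ≤ _
    rw [modAbs_zero]; exact le_max_right _ _
  add_mem' := fun {x y} hx hy => (modAbs_add_le x y).trans (max_le hx hy)
  neg_mem' := fun {x} hx => by
    change modAbs F (-x) ≤ _
    rw [modAbs_neg]; exact hx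

variable {B} in
theorem mem_modBall {t : ℝ} (ht : 0 ≤ t) {x : B} : x ∈ modBall F B t ↔ modAbs F x ≤ t := by
  change modAbs F x ≤ max t 0 ↔ _
  rw [max_eq_left ht]

theorem isOpen_modBall {t : ℝ} (ht : 0 < t) : IsOpen (modBall F B t : Set B) := by
  have := isOpen_modAbs_le (F := F) (B := B) ht
  convert this using 1
  ext x
  exact mem_modBall F ht.le

theorem isCompact_modBall (t : ℝ) : IsCompact (modBall F B t : Set B) :=
  isCompact_modAbs_le (F := F) (B := B) (max t 0)

theorem modBall_mono {s t : ℝ} (h : s ≤ t) : modBall F B s ≤ modBall F B t :=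
  fun _ hx => le_trans hx (max_le_max h le_rfl)

theorem modBall_map_mulRight {t : ℝ} (ht : 0 ≤ t) (u : Bˣ) :
    (modBall F B t).map (AddMonoidHom.mulRight (u : B)) = modBall F B (t * modAbs F (u : B)) := by
  have hu := modAbs_units_pos (F := F) u
  ext x
  rw [AddSubgroup.mem_map, mem_modBall F (by positivity)]
  constructor
  · rintro ⟨y, hy, rfl⟩
    rw [mem_modBall F ht] at hy
    change modAbs F (y * u) ≤ _
    rw [modAbs_mul]
    gcongr
  · intro hx
    refine ⟨x * (u⁻¹ : Bˣ), ?_, ?_⟩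
    · rw [mem_modBall F ht, modAbs_mul, modAbs_units_inv]
      exact (mul_inv_le_iff₀ hu).2 hx
    · change x * (u⁻¹ : Bˣ) * u = x
      rw [mul_assoc, Units.inv_mul, mul_one]

theorem relIndex_modBall_mul {s t : ℝ} (hs : 0 ≤ s) (ht : 0 ≤ t) (u : Bˣ) :
    (modBall F B (s * modAbs F (u : B))).relIndex (modBall F B (t * modAbs F (u : B))) =
      (modBall F B s).relIndex (modBall F B t) := by
  rw [← modBall_map_mulRight F B hs, ← modBall_map_mulRight F B ht]
  refine AddSubgroup.relIndex_map_map_of_injective _ _ ?_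
  intro x y hxy
  exact u.isUnit.mul_left_injective hxy

/-- Multiplication by an invertible scalar multiplies the covolume of every compact open subgroup by
the same factor. -/
theorem relIndex_eq_of_scaling {V : Type*} [AddCommGroup V] [TopologicalSpace V]
    [IsTopologicalAddGroup V] (f : V ≃+ V) (A C : AddSubgroup V)
    (hA : IsOpen (A : Set V)) (hC : IsOpen (C : Set V)) (hAc : IsCompact (A : Set V))
    (hCc : IsCompact (C : Set V)) (hAf : A ≤ A.map f.toAddMonoidHom)
    (hCf : C ≤ C.map f.toAddMonoidHom) :
    A.relIndex (A.map f.toAddMonoidHom) = C.relIndex (C.map f.toAddMonoidHom) := by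
  -- Nested case `C ≤ A`: the index of `C` in `f A` is computed through `A` and through `f C`. Since
  -- `f` is injective, `(f A : f C) = (A : C)`, a finite nonzero number that can be cancelled. The
  -- general case goes through `A ⊓ C`.
  have key : ∀ A C : AddSubgroup V, IsOpen (A : Set V) → IsOpen (C : Set V) →
      IsCompact (A : Set V) → A ≤ A.map f.toAddMonoidHom → C ≤ A →
      C ≤ C.map f.toAddMonoidHom →
      A.relIndex (A.map f.toAddMonoidHom) = C.relIndex (C.map f.toAddMonoidHom) := by
    intro A C hA hC hAc hAf hCA hCf
    have h1 := AddSubgroup.relIndex_mul_relIndex C A _ hCA hAf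
    have h2 := AddSubgroup.relIndex_mul_relIndex C (C.map f.toAddMonoidHom) _ hCf
      (AddSubgroup.map_mono (f := f.toAddMonoidHom) hCA)
    have h3 := AddSubgroup.relIndex_map_map_of_injective (f := f.toAddMonoidHom) C A f.injective
    rw [h3] at h2
    have h4 := relIndex_ne_zero_of_isOpen_of_isCompact C A hC hAc
    refine Nat.eq_of_mul_eq_mul_left (Nat.pos_of_ne_zero h4) ?_
    rw [h1, ← h2, mul_comm]
  have hI : A ⊓ C ≤ (A ⊓ C).map f.toAddMonoidHom := by
    intro x hx
    obtain ⟨y, hy, hyx⟩ := hAf hx.1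
    obtain ⟨z, hz, hzx⟩ := hCf hx.2
    have : y = z := f.injective (hyx.trans hzx.symm)
    exact ⟨y, ⟨hy, this ▸ hz⟩, hyx⟩
  have hIo : IsOpen ((A ⊓ C : AddSubgroup V) : Set V) := hA.inter hC
  rw [key A (A ⊓ C) hA hIo hAc hAf inf_le_left hI, key C (A ⊓ C) hC hIo hCc hCf inf_le_right hI]

-- Multiplication by `ϖ⁻¹` maps the unit ball onto the larger ball. By `relIndex_eq_of_scaling` the
-- unit ball may be replaced by the lattice of vectors with integral coordinates, for which the
-- index is that of the maximal ideal to the power `dim B`.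
open scoped NormedField Valued in
theorem relIndex_modBall_residueCard (hF : NormIsNormalised F) :
    (modBall F B 1).relIndex (modBall F B ((residueCard F : ℝ) ^ Module.finrank F B)) =
      residueCard F ^ Module.finrank F B := by
  have := IsModuleTopology.topologicalAddGroup F B
  have hc := IsModuleTopology.toContinuousSMul F B
  have : ProperSpace F := .of_nontriviallyNormedField_of_weaklyLocallyCompactSpace F
  obtain ⟨ϖ, hϖ, hn, h0⟩ := exists_uniformiser hF
  have hq : (0 : ℝ) < residueCard F := by
    have := two_le_residueCard (F := F)
    positivity
  set n := Module.finrank F B with hndef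
  have hn1 : ‖(ϖ : F)‖ ≤ 1 := Valued.integer.mem_iff.1 ϖ.2
  let e := coordHomeo F B
  let f : B ≃+ B := (LinearEquiv.smulOfNeZero F B (ϖ : F)⁻¹ (inv_ne_zero h0)).toAddEquiv
  have hfapp : ∀ x, f x = (ϖ : F)⁻¹ • x := fun _ => rfl
  have hfsymm : ∀ x, f.symm x = (ϖ : F) • x := fun x => by
    rw [AddEquiv.symm_apply_eq, hfapp, inv_smul_smul₀ h0]
  have hfmem : ∀ (A : AddSubgroup B) x, x ∈ A.map f.toAddMonoidHom ↔ (ϖ : F) • x ∈ A := by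
    intro A x
    rw [← hfsymm]
    constructor
    · rintro ⟨y, hy, rfl⟩
      change f.symm (f y) ∈ A
      rwa [f.symm_apply_apply]
    · intro h
      exact ⟨_, h, f.apply_symm_apply x⟩
  let Λ : AddSubgroup B := (⊤ : AddSubgroup (Fin n → 𝒪[F])).map
    (AddMonoidHom.mk' (fun v => e.symm (fun i => (v i : F))) fun v w => by
      rw [← map_add]; rfl)
  have hΛmem : ∀ x, x ∈ Λ ↔ ‖e x‖ ≤ 1 := by
    intro x
    rw [pi_norm_le_iff_of_nonneg zero_le_one]
    constructor
    · rintro ⟨v, -, rfl⟩ i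
      change ‖e (e.symm fun i => (v i : F)) i‖ ≤ 1
      rw [e.apply_symm_apply]
      exact Valued.integer.mem_iff.1 (v i).2
    · intro h
      refine ⟨fun i => ⟨e x i, Valued.integer.mem_iff.2 (h i)⟩, trivial, ?_⟩
      exact e.symm_apply_apply x
  have hΛset : (Λ : Set B) = e ⁻¹' Metric.closedBall 0 1 := by
    ext x
    rw [SetLike.mem_coe, hΛmem, Set.mem_preimage, mem_closedBall_zero_iff]
  have hΛo : IsOpen (Λ : Set B) := by
    rw [hΛset]
    exact (IsUltrametricDist.isOpen_closedBall _ one_ne_zero).preimage e.continuous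
  have hΛc : IsCompact (Λ : Set B) := by
    rw [hΛset]
    exact e.toHomeomorph.isCompact_preimage.2 (isCompact_closedBall _ _)
  have hle : ∀ A : AddSubgroup B, (∀ x ∈ A, (ϖ : F) • x ∈ A) → A ≤ A.map f.toAddMonoidHom :=
    fun A h x hx => (hfmem A x).2 (h x hx)
  have hΛf : Λ ≤ Λ.map f.toAddMonoidHom := hle Λ fun x hx => by
    rw [hΛmem] at hx ⊢
    rw [map_smul, norm_smul]
    exact mul_le_one₀ hn1 (norm_nonneg _) hx
  have hOf : modBall F B 1 ≤ (modBall F B 1).map f.toAddMonoidHom := hle _ fun x hx => by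
    rw [mem_modBall F zero_le_one] at hx ⊢
    rw [modAbs_smul]
    exact mul_le_one₀ (pow_le_one₀ (norm_nonneg _) hn1) (modAbs_nonneg _) hx
  have hO : (modBall F B 1).map f.toAddMonoidHom = modBall F B ((residueCard F : ℝ) ^ n) := by
    ext x
    rw [hfmem, mem_modBall F zero_le_one, mem_modBall F (by positivity), modAbs_smul, hn, inv_pow,
      inv_mul_le_iff₀ (by positivity), mul_one]
  rw [← hO, relIndex_eq_of_scaling f _ Λ (isOpen_modBall F B one_pos) hΛo
    (isCompact_modBall F B 1) hΛc hOf hΛf]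
  let g : (Fin n → 𝒪[F]) →+ B :=
    AddMonoidHom.mk' (fun v => (ϖ : F)⁻¹ • e.symm (fun i => (v i : F))) fun v w => by
      rw [← smul_add, ← map_add]; rfl
  have hg : Function.Injective g := by
    intro v w hvw
    have h1 := e.symm.injective (smul_right_injective B (inv_ne_zero h0) hvw)
    funext i
    exact Subtype.ext (congrFun h1 i)
  have hΛ1 : Λ.map f.toAddMonoidHom = (⊤ : AddSubgroup (Fin n → 𝒪[F])).map g := by
    rw [AddSubgroup.map_map]
    rfl
  have hΛ2 : Λ = (AddSubgroup.pi Set.univ fun _ => (𝓂[F] : Ideal 𝒪[F]).toAddSubgroup).map g := by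
    have hmax : (𝓂[F] : Ideal 𝒪[F]) = Ideal.span {ϖ} := by
      have := isDiscreteValuationRing_integer (F := F)
      exact hϖ.maximalIdeal_eq
    ext x
    constructor
    · rintro ⟨v, -, rfl⟩
      refine ⟨fun i => ϖ * v i, ?_, ?_⟩
      · intro i _
        change _ ∈ 𝓂[F]
        rw [hmax]
        exact Ideal.mul_mem_right _ _ (Ideal.mem_span_singleton_self ϖ)
      · change (ϖ : F)⁻¹ • e.symm (fun i => ((ϖ * v i : 𝒪[F]) : F)) = e.symm fun i => (v i : F)
        rw [← map_smul]
        congr 1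
        funext i
        simp [h0]
    · rintro ⟨v, hv, rfl⟩
      have : ∀ i, ∃ w : 𝒪[F], v i = ϖ * w := fun i => by
        have h1 : v i ∈ 𝓂[F] := hv i trivial
        rw [hmax, Ideal.mem_span_singleton] at h1
        exact h1
      choose w hw using this
      refine ⟨w, trivial, ?_⟩
      change e.symm (fun i => (w i : F)) = (ϖ : F)⁻¹ • e.symm (fun i => (v i : F))
      rw [← map_smul]
      congr 1
      funext i
      simp [h0, hw]
  rw [hΛ1]
  conv_lhs => rw [hΛ2]
  rw [AddSubgroup.relIndex_map_map_of_injective _ _ hg, AddSubgroup.relIndex_top_right,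
    AddSubgroup.index_pi]
  simp [index_maximalIdeal]

theorem exists_modAbs_eq_zpow (hF : NormIsNormalised F) {x : B} (hx : x ≠ 0) :
    ∃ n : ℤ, modAbs F x = (residueCard F : ℝ) ^ n :=
  exists_norm_eq_zpow hF fun h => (modAbs_pos (F := F) hx).ne' (by rw [modAbs, h, norm_zero])

/-- The value group of `modAbs` is generated by some `q ^ e > 1`. -/
theorem exists_modAbs_generator (hF : NormIsNormalised F) :
    ∃ e : ℕ, 0 < e ∧ (∃ u : Bˣ, modAbs F (u : B) = ((residueCard F : ℝ) ^ e)) ∧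
      ∀ x : B, x ≠ 0 → ∃ n : ℤ, modAbs F x = ((residueCard F : ℝ) ^ e) ^ n := by
  have hq : (1 : ℝ) < residueCard F := by
    exact_mod_cast two_le_residueCard (F := F)
  have hq0 : (0 : ℝ) < residueCard F := by linarith
  -- The exponents of values form a subgroup of `ℤ`, hence a cyclic one; it is nonzero because it
  -- contains the exponent of `ϖ`.
  let S : AddSubgroup ℤ :=
    { carrier := {n | ∃ u : Bˣ, modAbs F (u : B) = (residueCard F : ℝ) ^ n}
      zero_mem' := ⟨1, by rw [Units.val_one, modAbs_one, zpow_zero]⟩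
      add_mem' := by
        rintro a b ⟨u, hu⟩ ⟨v, hv⟩
        exact ⟨u * v, by rw [Units.val_mul, modAbs_mul, hu, hv, zpow_add₀ hq0.ne']⟩
      neg_mem' := by
        rintro a ⟨u, hu⟩
        exact ⟨u⁻¹, by rw [modAbs_units_inv, hu, zpow_neg]⟩ }
  obtain ⟨a, ha⟩ := Int.subgroup_cyclic S
  have haS : a ∈ S := by rw [ha]; exact AddSubgroup.subset_closure rfl
  have hmem : ∀ n, n ∈ S ↔ ∃ k : ℤ, k * a = n := by
    intro n
    rw [ha, AddSubgroup.mem_closure_singleton]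
    simp
  have ha0 : a ≠ 0 := by
    rintro rfl
    obtain ⟨ϖ, hϖ, hn, h0⟩ := exists_uniformiser hF
    have h1 : algebraMap F B (ϖ : F) ≠ 0 := by
      rw [Ne, map_eq_zero_iff _ (algebraMap F B).injective]; exact h0
    obtain ⟨v, hv⟩ := FiniteDimensional.isUnit F h1
    have h2 : -(Module.finrank F B : ℤ) ∈ S := ⟨v, by
      rw [hv, modAbs_algebraMap, hn, zpow_neg, zpow_natCast, inv_pow]⟩
    obtain ⟨k, hk⟩ := (hmem _).1 h2
    have := Module.finrank_pos (R := F) (M := B)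
    omega
  refine ⟨a.natAbs, Int.natAbs_pos.2 ha0, ?_, ?_⟩
  · have : (a.natAbs : ℤ) ∈ S := by
      rcases Int.natAbs_eq a with h | h
      · rwa [← h]
      · rw [show (a.natAbs : ℤ) = -a by omega]
        exact S.neg_mem haS
    obtain ⟨u, hu⟩ := this
    exact ⟨u, by rw [hu, zpow_natCast]⟩
  · intro x hx
    obtain ⟨n, hn⟩ := exists_modAbs_eq_zpow F B hF hx
    obtain ⟨v, rfl⟩ := FiniteDimensional.isUnit F hx
    obtain ⟨k, hk⟩ := (hmem n).1 ⟨v, hn⟩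
    have habs : (a.natAbs : ℤ) ∣ n := by
      rw [Int.natAbs_dvd]
      exact ⟨k, by rw [← hk, mul_comm]⟩
    obtain ⟨k', hk'⟩ := habs
    refine ⟨k', ?_⟩
    rw [hn, hk', zpow_mul, zpow_natCast]

/-- Multiplication by powers of a generator shows that the index `N` does not depend on `k`. Some
power `Q ^ j` of `Q = q ^ e` equals `q ^ dim B`, so `N ^ j = (q ^ e) ^ j` by
`relIndex_modBall_residueCard`, and `N = q ^ e`. The residue field of `B` need not be determined. -/
theorem relIndex_modBall_generator (hF : NormIsNormalised F) {e : ℕ}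
    (he : ∃ u : Bˣ, modAbs F (u : B) = ((residueCard F : ℝ) ^ e))
    (hgen : ∀ x : B, x ≠ 0 → ∃ n : ℤ, modAbs F x = ((residueCard F : ℝ) ^ e) ^ n) (k : ℤ) :
    (modBall F B (((residueCard F : ℝ) ^ e) ^ k)).relIndex
      (modBall F B (((residueCard F : ℝ) ^ e) ^ (k + 1))) = residueCard F ^ e := by
  have hq : (1 : ℝ) < residueCard F := by
    exact_mod_cast two_le_residueCard (F := F)
  have hq0 : (0 : ℝ) < residueCard F := by linarith
  obtain ⟨u, hu⟩ := he
  set Q : ℝ := (residueCard F : ℝ) ^ e with hQ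
  have hQ0 : 0 < Q := by positivity
  have hQ1 : 1 ≤ Q := one_le_pow₀ hq.le
  have hpow : ∀ k : ℤ, modAbs F ((u ^ k : Bˣ) : B) = Q ^ k := by
    intro k
    obtain ⟨n, rfl | rfl⟩ := k.eq_nat_or_neg
    · rw [zpow_natCast, zpow_natCast, Units.val_pow_eq_pow_val, modAbs_pow, hu]
    · rw [zpow_neg, zpow_neg, modAbs_units_inv, zpow_natCast, zpow_natCast,
        Units.val_pow_eq_pow_val, modAbs_pow, hu]
  have hshift : ∀ k : ℤ, (modBall F B (Q ^ k)).relIndex (modBall F B (Q ^ (k + 1))) =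
      (modBall F B 1).relIndex (modBall F B Q) := by
    intro k
    have := relIndex_modBall_mul F B zero_le_one hQ0.le (u ^ k)
    rw [hpow, one_mul] at this
    rw [← this, zpow_add₀ hQ0.ne', zpow_one, mul_comm Q]
  rw [hshift]
  set N := (modBall F B 1).relIndex (modBall F B Q) with hN
  have hiter : ∀ n : ℕ, (modBall F B 1).relIndex (modBall F B (Q ^ n)) = N ^ n := by
    intro n
    induction n with
    | zero => rw [pow_zero, pow_zero, AddSubgroup.relIndex_self]
    | succ n ih =>
      rw [← AddSubgroup.relIndex_mul_relIndex _ (modBall F B (Q ^ n)) _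
        (modBall_mono F B (one_le_pow₀ hQ1))
        (modBall_mono F B (pow_le_pow_right₀ hQ1 n.le_succ)), ih, pow_succ]
      congr 1
      have := hshift n
      rw [zpow_natCast] at this
      rw [← this]
      norm_cast
  have h1 := relIndex_modBall_residueCard F B hF
  set n := Module.finrank F B with hn
  have hn0 : n ≠ 0 := (Module.finrank_pos (R := F) (M := B)).ne'
  obtain ⟨ϖ, hϖ, hnϖ, h0⟩ := exists_uniformiser hF
  have h2 : algebraMap F B (ϖ : F) ≠ 0 := by
    rw [Ne, map_eq_zero_iff _ (algebraMap F B).injective]; exact h0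
  obtain ⟨k', hk'⟩ := hgen _ h2
  rw [modAbs_algebraMap, hnϖ, ← hn, inv_pow] at hk'
  have h3 : (residueCard F : ℝ) ^ n = Q ^ (-k') := by
    rw [zpow_neg, ← hk', inv_inv]
  have h4 : 1 < (residueCard F : ℝ) ^ n := one_lt_pow₀ hq hn0
  have hk0 : 0 < -k' := by
    by_contra hneg
    rw [h3] at h4
    exact absurd (zpow_le_one_of_nonpos₀ hQ1 (not_lt.1 hneg)) (not_le.2 h4)
  obtain ⟨j, hj⟩ := Int.eq_ofNat_of_zero_le hk0.le
  rw [hj, zpow_natCast] at h3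
  rw [h3, hiter] at h1
  have hj0 : j ≠ 0 := by omega
  have h5 : residueCard F ^ n = (residueCard F ^ e) ^ j := by
    have : ((residueCard F ^ n : ℕ) : ℝ) = (((residueCard F ^ e) ^ j : ℕ) : ℝ) := by
      push_cast; exact h3
    exact_mod_cast this
  rw [h5] at h1
  exact Nat.pow_left_injective hj0 h1

end Index

end LocalPeriod

namespace LocalPeriod

open Topology Filter

/-! ### Norm, conjugation and invertibility in `D ⊗ E`. -/

section TensorNorm

/-- Left multiplication by `a ⊗ b` is the Kronecker product of the two left multiplications. -/
theorem norm_tmul {F A B : Type*} [Field F] [Ring A] [Algebra F A] [Ring B] [Algebra F B]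
    [FiniteDimensional F A] [FiniteDimensional F B] (a : A) (b : B) :
    Algebra.norm F (a ⊗ₜ[F] b) =
      Algebra.norm F a ^ Module.finrank F B * Algebra.norm F b ^ Module.finrank F A := by
  have h : LinearMap.mulLeft F (a ⊗ₜ[F] b) =
      TensorProduct.map (LinearMap.mulLeft F a) (LinearMap.mulLeft F b) := by
    ext x y
    simp
  have hn : ∀ {C : Type _} [Ring C] [Algebra F C] (x : C),
      Algebra.norm F x = LinearMap.det (LinearMap.mulLeft F x) := fun x => rfl
  let bA := Module.finBasis F A
  let bB := Module.finBasis F B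
  rw [hn, h, ← LinearMap.det_toMatrix (bA.tensorProduct bB), TensorProduct.toMatrix_map,
    Matrix.det_kronecker, LinearMap.det_toMatrix, LinearMap.det_toMatrix]
  simp [Algebra.norm_apply]
  rfl

end TensorNorm

section Quadratic

variable {F E D : Type*} [Field F] [Field E] [Algebra F E] [DivisionRing D] [Algebra F D]

theorem exists_add_mul_of_finrank_two (hE : Module.finrank F E = 2) {lam : E}
    (hlam : lam ∉ Set.range (algebraMap F E)) (x : E) :
    ∃ a b : F, x = algebraMap F E a + algebraMap F E b * lam := by
  have hli : LinearIndependent F ![(1 : E), lam] := by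
    rw [LinearIndependent.pair_iff]
    intro s t h
    have ht : t = 0 := by
      by_contra ht
      refine hlam ⟨-(t⁻¹ * s), ?_⟩
      rw [Algebra.smul_def, Algebra.smul_def, mul_one] at h
      have ht' : algebraMap F E t ≠ 0 := by
        rwa [Ne, map_eq_zero_iff _ (algebraMap F E).injective]
      rw [map_neg, map_mul, map_inv₀]
      field_simp
      linear_combination -h
    subst ht
    simpa using h
  have hb := hli.span_eq_top_of_card_eq_finrank (by simp [hE])
  have hx : x ∈ Submodule.span F (Set.range ![(1 : E), lam]) := by rw [hb]; trivial
  rw [Matrix.range_cons, Matrix.range_cons, Matrix.range_empty, Set.union_empty,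
    Set.singleton_union, Submodule.mem_span_pair] at hx
  obtain ⟨a, b, h⟩ := hx
  exact ⟨a, b, by rw [← h, Algebra.smul_def, Algebra.smul_def, mul_one]⟩

theorem add_mul_injective {lam : E} (hlam : lam ∉ Set.range (algebraMap F E)) {a b a' b' : F}
    (h : algebraMap F E a + algebraMap F E b * lam = algebraMap F E a' + algebraMap F E b' * lam) :
    a = a' ∧ b = b' := by
  have hb : b = b' := by
    by_contra hb
    have hb0 : algebraMap F E (b - b') ≠ 0 := by
      rw [Ne, map_eq_zero_iff _ (algebraMap F E).injective, sub_eq_zero]; exact hb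
    refine hlam ⟨(b - b')⁻¹ * (a' - a), ?_⟩
    rw [map_mul, map_inv₀, inv_mul_eq_iff_eq_mul₀ hb0, map_sub, map_sub]
    linear_combination -h
  subst hb
  exact ⟨(algebraMap F E).injective (by linear_combination h), rfl⟩

/-- The nontrivial automorphism of the quadratic extension. -/
theorem exists_conj (hE : Module.finrank F E = 2) {lam : E}
    (hlam : lam ∉ Set.range (algebraMap F E)) (hlam2 : lam ^ 2 ∈ Set.range (algebraMap F E)) :
    ∃ τ : E ≃ₐ[F] E, τ lam = -lam := by
  choose re im h using exists_add_mul_of_finrank_two hE hlam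
  obtain ⟨c, hc⟩ := hlam2
  have hu : ∀ a b : F, re (algebraMap F E a + algebraMap F E b * lam) = a ∧
      im (algebraMap F E a + algebraMap F E b * lam) = b := fun a b =>
    add_mul_injective hlam (h _).symm
  let f : E → E := fun x => algebraMap F E (re x) - algebraMap F E (im x) * lam
  have hf : ∀ a b : F, f (algebraMap F E a + algebraMap F E b * lam) =
      algebraMap F E a - algebraMap F E b * lam := fun a b => by
    simp only [f, (hu a b).1, (hu a b).2]
  have hadd : ∀ x y, f (x + y) = f x + f y := by
    intro x y
    rw [h x, h y, hf, hf, show algebraMap F E (re x) + algebraMap F E (im x) * lam +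
      (algebraMap F E (re y) + algebraMap F E (im y) * lam) =
      algebraMap F E (re x + re y) + algebraMap F E (im x + im y) * lam by
        simp only [map_add]; ring, hf]
    simp only [map_add]; ring
  have hmul : ∀ x y, f (x * y) = f x * f y := by
    intro x y
    have : (algebraMap F E (re x) + algebraMap F E (im x) * lam) *
      (algebraMap F E (re y) + algebraMap F E (im y) * lam) =
      algebraMap F E (re x * re y + im x * im y * c) +
        algebraMap F E (re x * im y + im x * re y) * lam := by
      simp only [map_add, map_mul, hc]; ring
    rw [h x, h y, this, hf, hf, hf]
    simp only [map_add, map_mul, hc]; ring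
  have halg : ∀ a : F, f (algebraMap F E a) = algebraMap F E a := fun a => by
    have := hf a 0
    simpa using this
  have hlamf : f lam = -lam := by
    have := hf 0 1
    simpa using this
  let φ : E →ₐ[F] E :=
    { toFun := f
      map_one' := by simpa using halg 1
      map_mul' := hmul
      map_zero' := by simpa using halg 0
      map_add' := hadd
      commutes' := halg }
  have hφ : φ.comp φ = AlgHom.id F E := by
    ext x
    change f (f x) = x
    conv_lhs => rw [h x]
    rw [hf, show algebraMap F E (re x) - algebraMap F E (im x) * lam =
      algebraMap F E (re x) + algebraMap F E (-im x) * lam by rw [map_neg]; ring, hf, map_neg]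
    conv_rhs => rw [h x]
    ring
  exact ⟨AlgEquiv.ofAlgHom φ φ hφ hφ, hlamf⟩

variable (F D) in
/-- `(x, y) ↦ x + y λ` -/
def pairMap (lam : E) : (D × D) →ₗ[F] D ⊗[F] E :=
  LinearMap.coprod ((TensorProduct.mk F D E).flip 1) ((TensorProduct.mk F D E).flip lam)

theorem pairMap_apply (lam : E) (x y : D) :
    pairMap F D lam (x, y) = x ⊗ₜ[F] (1 : E) + y ⊗ₜ[F] lam := by
  simp [pairMap]

theorem pairMap_surjective (hE : Module.finrank F E = 2) {lam : E}
    (hlam : lam ∉ Set.range (algebraMap F E)) : Function.Surjective (pairMap F D lam) := by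
  intro z
  induction z using TensorProduct.induction_on with
  | zero => exact ⟨0, map_zero _⟩
  | add x y hx hy =>
    obtain ⟨a, rfl⟩ := hx
    obtain ⟨b, rfl⟩ := hy
    exact ⟨a + b, map_add _ _ _⟩
  | tmul x e =>
    obtain ⟨a, b, rfl⟩ := exists_add_mul_of_finrank_two hE hlam e
    refine ⟨(a • x, b • x), ?_⟩
    rw [pairMap_apply, TensorProduct.tmul_add, TensorProduct.smul_tmul, TensorProduct.smul_tmul,
      Algebra.smul_def, Algebra.smul_def, mul_one]

variable [FiniteDimensional F D]

theorem pairMap_bijective (hE : Module.finrank F E = 2) {lam : E}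
    (hlam : lam ∉ Set.range (algebraMap F E)) : Function.Bijective (pairMap F D lam) := by
  have hfe : FiniteDimensional F E := FiniteDimensional.of_finrank_pos (by rw [hE]; norm_num)
  have hs := pairMap_surjective (D := D) hE hlam
  refine ⟨(LinearMap.injective_iff_surjective_of_finrank_eq_finrank ?_).2 hs, hs⟩
  rw [Module.finrank_prod, Module.finrank_tensorProduct, hE, mul_two]

/-- The left ideal generated by `x ≠ 0` is a vector space over `D` and over `E`, so its dimension
over `F` is divisible by `d ^ 2` and by 2. These are coprime as `d` is odd, hence the ideal is
everything and contains 1, which gives a left inverse of `x`. -/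
theorem noZeroDivisors_tensor (hE : Module.finrank F E = 2) {d : ℕ} (hd : Odd d)
    (hD : Module.finrank F D = d ^ 2) : NoZeroDivisors (D ⊗[F] E) := by
  have hfe : FiniteDimensional F E := FiniteDimensional.of_finrank_pos (by rw [hE]; norm_num)
  have key : ∀ x : D ⊗[F] E, x ≠ 0 → ∃ y, y * x = 1 := by
    intro x hx
    let V : Submodule (D ⊗[F] E) (D ⊗[F] E) := Submodule.span _ {x}
    let iE : Module E V :=
      Module.compHom V (Algebra.TensorProduct.includeRight : E →ₐ[F] D ⊗[F] E).toRingHom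
    have tE : IsScalarTower F E V := ⟨fun a b v => by
      change (Algebra.TensorProduct.includeRight : E →ₐ[F] D ⊗[F] E) (a • b) • v =
        a • ((Algebra.TensorProduct.includeRight : E →ₐ[F] D ⊗[F] E) b • v)
      rw [map_smul, smul_assoc]⟩
    have hfV : FiniteDimensional F V :=
      FiniteDimensional.finiteDimensional_submodule (V.restrictScalars F)
    have hDV := Module.finrank_mul_finrank F D V
    have hEV := Module.finrank_mul_finrank F E V
    have hVle : Module.finrank F V ≤ Module.finrank F (D ⊗[F] E) :=
      Submodule.finrank_le (V.restrictScalars F)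
    have hA : Module.finrank F (D ⊗[F] E) = d ^ 2 * 2 := by
      rw [Module.finrank_tensorProduct, hE, hD]
    have hxV : x ∈ V := Submodule.subset_span rfl
    have hVpos : 0 < Module.finrank F V := by
      have : Nontrivial V := ⟨⟨⟨x, hxV⟩, 0, fun h => hx (congrArg Subtype.val h)⟩⟩
      exact Module.finrank_pos
    have hdvd : d ^ 2 * 2 ∣ Module.finrank F V := by
      refine Nat.Coprime.mul_dvd_of_dvd_of_dvd ?_ ⟨_, by rw [← hDV, hD]⟩ ⟨_, by rw [← hEV, hE]⟩
      exact (hd.pow).coprime_two_right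
    have hVeq : Module.finrank F V = Module.finrank F (D ⊗[F] E) := by
      refine le_antisymm hVle ?_
      rw [hA]
      exact Nat.le_of_dvd hVpos hdvd
    have htop : V.restrictScalars F = ⊤ := Submodule.eq_top_of_finrank_eq hVeq
    have h1 : (1 : D ⊗[F] E) ∈ V.restrictScalars F := by rw [htop]; trivial
    exact Submodule.mem_span_singleton.1 h1
  refine ⟨fun {a b} hab => ?_⟩
  by_contra! h
  obtain ⟨y, hy⟩ := key a h.1
  apply h.2
  rw [← one_mul b, ← hy, mul_assoc, hab, mul_zero]

end Quadratic

end LocalPeriod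

namespace LocalPeriod

open Topology Filter

/-! ### Matrices preserving the planes spanned by `e_i` and `e_{m+1-i}`. -/

section Plane

/-- Indices of the plane `i`: `(0, i) ↦ i` and `(1, i) ↦ 2 r - 1 - i`. -/
def planeEquiv (r : ℕ) : Fin 2 × Fin r ≃ Fin (2 * r) where
  toFun p := if p.1 = 0 then ⟨p.2, by omega⟩ else ⟨2 * r - 1 - p.2, by omega⟩
  invFun k := if h : (k : ℕ) < r then (0, ⟨k, h⟩) else (1, ⟨2 * r - 1 - k, by omega⟩)
  left_inv := by
    rintro ⟨a, i⟩
    fin_cases a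
    · simp
    · have : ¬ (2 * r - 1 - (i : ℕ) < r) := by omega
      simp [this]
      ext
      simp
      omega
  right_inv := by
    intro k
    by_cases h : (k : ℕ) < r
    · simp [h]
    · simp [h]
      ext
      simp
      omega

theorem planeEquiv_zero_val {r : ℕ} (i : Fin r) : (planeEquiv r (0, i) : ℕ) = i := rfl

theorem planeEquiv_one_val {r : ℕ} (i : Fin r) :
    (planeEquiv r (1, i) : ℕ) = 2 * r - 1 - i := rfl

theorem planeEquiv_rev {r : ℕ} (a : Fin 2) (i : Fin r) :
    (planeEquiv r (a, i)).rev = planeEquiv r (a.rev, i) := by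
  ext
  rw [Fin.val_rev]
  fin_cases a
  · change 2 * r - (i + 1) = 2 * r - 1 - i
    omega
  · change 2 * r - (2 * r - 1 - i + 1) = (i : ℕ)
    omega

variable {R : Type*} [Ring R] {r : ℕ}

variable (R r) in
/-- Matrices preserving all the planes. -/
def plane : (Fin r → Matrix (Fin 2) (Fin 2) R) →+* Matrix (Fin (2 * r)) (Fin (2 * r)) R :=
  ((Matrix.reindexRingEquiv R (planeEquiv r)).toRingHom).comp
    (Matrix.blockDiagonalRingHom (Fin 2) (Fin r) R)

theorem plane_apply (M : Fin r → Matrix (Fin 2) (Fin 2) R) (a b : Fin 2) (i j : Fin r) :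
    plane R r M (planeEquiv r (a, i)) (planeEquiv r (b, j)) = if i = j then M i a b else 0 := by
  simp [plane, Matrix.blockDiagonal_apply]

theorem plane_injective : Function.Injective (plane R r) := by
  intro M N h
  funext i
  ext a b
  have := congrFun (congrFun h (planeEquiv r (a, i))) (planeEquiv r (b, i))
  simpa [plane_apply] using this

/-- The blocks of a matrix along the planes. -/
def blk (M : Matrix (Fin (2 * r)) (Fin (2 * r)) R) : Fin r → Matrix (Fin 2) (Fin 2) R :=
  fun i => Matrix.of fun a b => M (planeEquiv r (a, i)) (planeEquiv r (b, i))

/-- The matrix preserves all the planes. -/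
def IsPlane (M : Matrix (Fin (2 * r)) (Fin (2 * r)) R) : Prop :=
  ∀ i j, j ≠ i → j ≠ i.rev → M i j = 0

theorem matrix_ext_plane {M N : Matrix (Fin (2 * r)) (Fin (2 * r)) R}
    (h : ∀ a b i j, M (planeEquiv r (a, i)) (planeEquiv r (b, j)) =
      N (planeEquiv r (a, i)) (planeEquiv r (b, j))) : M = N := by
  ext x y
  obtain ⟨⟨a, i⟩, rfl⟩ := (planeEquiv r).surjective x
  obtain ⟨⟨b, j⟩, rfl⟩ := (planeEquiv r).surjective y
  exact h a b i j

theorem planeEquiv_ne {a b : Fin 2} {i j : Fin r} (h : i ≠ j) :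
    planeEquiv r (b, j) ≠ planeEquiv r (a, i) :=
  fun h' => h (congrArg Prod.snd ((planeEquiv r).injective h')).symm

theorem IsPlane.plane_blk {M : Matrix (Fin (2 * r)) (Fin (2 * r)) R} (hM : IsPlane M) :
    plane R r (blk M) = M := by
  apply matrix_ext_plane
  intro a b i j
  rw [plane_apply]
  split_ifs with h
  · subst h; rfl
  · refine (hM _ _ (planeEquiv_ne h) ?_).symm
    rw [planeEquiv_rev]
    exact planeEquiv_ne h

theorem isPlane_plane (M : Fin r → Matrix (Fin 2) (Fin 2) R) : IsPlane (plane R r M) := by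
  intro x y h1 h2
  obtain ⟨⟨a, i⟩, rfl⟩ := (planeEquiv r).surjective x
  obtain ⟨⟨b, j⟩, rfl⟩ := (planeEquiv r).surjective y
  rw [plane_apply, if_neg]
  rintro rfl
  rw [planeEquiv_rev] at h2
  have h3 : b ≠ a := fun h => h1 (by rw [h])
  have h4 : b ≠ a.rev := fun h => h2 (by rw [h])
  fin_cases a <;> fin_cases b <;> simp_all

theorem IsPlane.mul {M N : Matrix (Fin (2 * r)) (Fin (2 * r)) R} (hM : IsPlane M)
    (hN : IsPlane N) : IsPlane (M * N) := by
  rw [← hM.plane_blk, ← hN.plane_blk, ← map_mul]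
  exact isPlane_plane _

variable (R r) in
/-- The group of plane matrices. -/
def planeGL : (Fin r → GLn 2 R) →* GLn (2 * r) R :=
  (Units.map (plane R r).toMonoidHom).comp (MulEquiv.piUnits.symm.toMonoidHom)

theorem planeGL_val (t : Fin r → GLn 2 R) :
    (planeGL R r t : Matrix _ _ R) = plane R r fun i => (t i : Matrix _ _ R) := rfl

theorem planeGL_inv_val (t : Fin r → GLn 2 R) :
    ((planeGL R r t)⁻¹ : GLn (2 * r) R).val = plane R r fun i => ((t i)⁻¹ : GLn 2 R).val := rfl

theorem exists_planeGL {g : GLn (2 * r) R} (h : IsPlane g.val) (h' : IsPlane (g⁻¹).val) :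
    ∃ t, planeGL R r t = g := by
  refine ⟨fun i => ⟨blk g.val i, blk (g⁻¹).val i, ?_, ?_⟩, ?_⟩
  · have : (blk g.val) * (blk (g⁻¹).val) = 1 := plane_injective (by
      rw [map_mul, h.plane_blk, h'.plane_blk, map_one, Units.mul_inv])
    exact congrFun this i
  · have : (blk (g⁻¹).val) * (blk g.val) = 1 := plane_injective (by
      rw [map_mul, h.plane_blk, h'.plane_blk, map_one, Units.inv_mul])
    exact congrFun this i
  · apply Units.ext
    exact h.plane_blk

theorem mem_minParabolic_two {p : GLn 2 R} :
    p ∈ minParabolic R 2 ↔ p.val 1 0 = 0 ∧ (p⁻¹).val 1 0 = 0 := by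
  have key : ∀ M : Matrix (Fin 2) (Fin 2) R,
      M.BlockTriangular (fun i : Fin 2 => (i : ℕ)) ↔ M 1 0 = 0 := by
    intro M
    constructor
    · intro h
      exact h (by norm_num)
    · intro h i j hij
      fin_cases i <;> fin_cases j <;> simp_all
  change (_ ∧ _) ↔ _
  rw [key, key]

/-- Either both indices of a plane lie in the same block of `b`, which imposes nothing, or they are
separated, and then monotonicity of `b` leaves the entry `(1, 0)` as the only one that must vanish.
-/
theorem planeGL_mem_parabolic {b : Fin (2 * r) → ℕ} (hb : Monotone b) (p : Fin r → GLn 2 R) :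
    planeGL R r p ∈ parabolic R b ↔
      ∀ i, b (planeEquiv r (0, i)) < b (planeEquiv r (1, i)) → p i ∈ minParabolic R 2 := by
  have key : ∀ M : Fin r → Matrix (Fin 2) (Fin 2) R, (plane R r M).BlockTriangular b ↔
      ∀ i, b (planeEquiv r (0, i)) < b (planeEquiv r (1, i)) → M i 1 0 = 0 := by
    intro M
    constructor
    · intro h i hi
      have := h hi
      rwa [plane_apply, if_pos rfl] at this
    · intro h x y hxy
      obtain ⟨⟨a, i⟩, rfl⟩ := (planeEquiv r).surjective x
      obtain ⟨⟨c, j⟩, rfl⟩ := (planeEquiv r).surjective y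
      rw [plane_apply]
      split_ifs with hij
      · subst hij
        have h01 : b (planeEquiv r (0, i)) ≤ b (planeEquiv r (1, i)) := hb (by
          rw [Fin.le_def, planeEquiv_zero_val, planeEquiv_one_val]; omega)
        fin_cases a <;> fin_cases c
        · exact absurd hxy (lt_irrefl _)
        · exact absurd hxy (not_lt.2 h01)
        · exact h i hxy
        · exact absurd hxy (lt_irrefl _)
      · rfl
  change (_ ∧ _) ↔ _
  rw [planeGL_val, planeGL_inv_val, key, key]
  simp only [mem_minParabolic_two]
  exact ⟨fun h i hi => ⟨h.1 i hi, h.2 i hi⟩, fun h => ⟨fun i hi => (h i hi).1,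
    fun i hi => (h i hi).2⟩⟩

end Plane

/-! ### The symmetry of `u₀` under conjugation and the stabilisers. -/

section Groups

variable {F E D : Type*} [Field F] [Field E] [Algebra F E] [DivisionRing D] [Algebra F D]

theorem u0Matrix_eq_plane {lam : E} (r : ℕ) :
    u0Matrix (2 * r) lam = plane E r fun _ => u0Matrix 2 lam := by
  apply matrix_ext_plane
  intro a b i j
  rw [plane_apply]
  by_cases hij : i = j
  · subst hij
    have h01 : planeEquiv r (0, i) < planeEquiv r (1, i) := by
      rw [Fin.lt_def, planeEquiv_zero_val, planeEquiv_one_val]; omega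
    simp only [u0Matrix, planeEquiv_rev, if_true]
    fin_cases a <;> fin_cases b <;> simp [h01, h01.le, h01.not_ge, h01.not_gt, h01.ne, h01.ne']
  · simp only [u0Matrix, planeEquiv_rev, if_neg (planeEquiv_ne hij), if_neg hij]

theorem u0MatrixInv_eq_plane {lam : E} (r : ℕ) :
    u0MatrixInv (2 * r) lam = plane E r fun _ => u0MatrixInv 2 lam := by
  apply matrix_ext_plane
  intro a b i j
  rw [plane_apply]
  by_cases hij : i = j
  · subst hij
    have h01 : planeEquiv r (0, i) < planeEquiv r (1, i) := by
      rw [Fin.lt_def, planeEquiv_zero_val, planeEquiv_one_val]; omega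
    simp only [u0MatrixInv, planeEquiv_rev, if_true]
    fin_cases a <;> fin_cases b <;> simp [h01, h01.not_gt, h01.ne, h01.ne']
  · simp only [u0MatrixInv, planeEquiv_rev, if_neg (planeEquiv_ne hij), if_neg hij]

theorem map_plane {R S : Type*} [Ring R] [Ring S] (f : R →+* S) {r : ℕ}
    (M : Fin r → Matrix (Fin 2) (Fin 2) R) :
    f.mapMatrix (plane R r M) = plane S r fun i => f.mapMatrix (M i) := by
  apply matrix_ext_plane
  intro a b i j
  rw [plane_apply, RingHom.mapMatrix_apply, Matrix.map_apply, plane_apply]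
  split_ifs
  · rfl
  · exact map_zero f

theorem u0_eq_planeGL (lam : E) (h : 2 * lam ≠ 0) (r : ℕ) :
    u0 F E D (2 * r) lam h = planeGL (D ⊗[F] E) r fun _ => u0 F E D 2 lam h := by
  apply Units.ext
  rw [planeGL_val]
  change RingHom.mapMatrix _ (u0Matrix (2 * r) lam) = plane _ r fun _ =>
    RingHom.mapMatrix _ (u0Matrix 2 lam)
  rw [u0Matrix_eq_plane, map_plane]

theorem embH_planeGL {r : ℕ} (t : Fin r → GLn 2 D) :
    embH F E D (2 * r) (planeGL D r t) =
      planeGL (D ⊗[F] E) r fun i => embH F E D 2 (t i) := by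
  apply Units.ext
  rw [planeGL_val]
  change RingHom.mapMatrix _ (plane D r _) = _
  rw [map_plane]
  rfl

theorem includeLeft_inj {x y : D}
    (h : (Algebra.TensorProduct.includeLeft : D →ₐ[F] D ⊗[F] E) x =
      (Algebra.TensorProduct.includeLeft : D →ₐ[F] D ⊗[F] E) y) : x = y :=
  Algebra.TensorProduct.includeLeft_injective (S := F) (algebraMap F E).injective h

theorem embH_apply {m : ℕ} (h : GLn m D) (i j : Fin m) :
    (embH F E D m h).val i j = h.val i j ⊗ₜ[F] (1 : E) := rfl

theorem embH_inv_apply {m : ℕ} (h : GLn m D) (i j : Fin m) :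
    ((embH F E D m h)⁻¹).val i j = (h⁻¹).val i j ⊗ₜ[F] (1 : E) := rfl

variable (D) in
/-- The conjugation of `D ⊗ E` over `D`. -/
def conjTensor (τ : E ≃ₐ[F] E) : (D ⊗[F] E) ≃ₐ[F] (D ⊗[F] E) :=
  Algebra.TensorProduct.congr AlgEquiv.refl τ

theorem conjTensor_tmul (τ : E ≃ₐ[F] E) (x : D) (e : E) :
    conjTensor D τ (x ⊗ₜ[F] e) = x ⊗ₜ[F] τ e := rfl

/-- The rows of `u₀` in a plane are `(1, -lam)` and `(1, lam)`, and `τ` exchanges them. This is the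
source of every later statement on stabilisers and on openness. -/
theorem u0Matrix_conj {lam : E} {τ : E ≃ₐ[F] E} (hτ : τ lam = -lam) {r : ℕ}
    (i j : Fin (2 * r)) : τ (u0Matrix (2 * r) lam i j) = u0Matrix (2 * r) lam i.rev j := by
  obtain ⟨⟨a, i⟩, rfl⟩ := (planeEquiv r).surjective i
  obtain ⟨⟨b, j⟩, rfl⟩ := (planeEquiv r).surjective j
  rw [planeEquiv_rev, u0Matrix_eq_plane, plane_apply, plane_apply]
  split_ifs with h
  · fin_cases a <;> fin_cases b <;> simp [u0Matrix, hτ]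
  · exact map_zero τ

theorem u0MatrixInv_conj {lam : E} {τ : E ≃ₐ[F] E} (hτ : τ lam = -lam) {r : ℕ}
    (i j : Fin (2 * r)) : τ (u0MatrixInv (2 * r) lam i j) = u0MatrixInv (2 * r) lam i j.rev := by
  obtain ⟨⟨a, i⟩, rfl⟩ := (planeEquiv r).surjective i
  obtain ⟨⟨b, j⟩, rfl⟩ := (planeEquiv r).surjective j
  rw [planeEquiv_rev, u0MatrixInv_eq_plane, plane_apply, plane_apply]
  split_ifs with h
  · have h2 : τ 2 = 2 := map_ofNat τ 2
    fin_cases a <;> fin_cases b <;> simp [u0MatrixInv, hτ, h2]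
  · exact map_zero τ

variable {lam : E} {h0 : 2 * lam ≠ 0} {τ : E ≃ₐ[F] E}

theorem u0_conj (hτ : τ lam = -lam) {r : ℕ} :
    (conjTensor D τ).toRingHom.mapMatrix (u0 F E D (2 * r) lam h0).val =
      (u0 F E D (2 * r) lam h0).val.submatrix Fin.rev id := by
  ext i j
  change (1 : D) ⊗ₜ[F] τ (u0Matrix (2 * r) lam i j) = (1 : D) ⊗ₜ[F] u0Matrix (2 * r) lam i.rev j
  rw [u0Matrix_conj hτ]

theorem u0_inv_conj (hτ : τ lam = -lam) {r : ℕ} :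
    (conjTensor D τ).toRingHom.mapMatrix ((u0 F E D (2 * r) lam h0)⁻¹).val =
      ((u0 F E D (2 * r) lam h0)⁻¹).val.submatrix id Fin.rev := by
  ext i j
  change (1 : D) ⊗ₜ[F] τ (u0MatrixInv (2 * r) lam i j) =
    (1 : D) ⊗ₜ[F] u0MatrixInv (2 * r) lam i j.rev
  rw [u0MatrixInv_conj hτ]

/-- Matrices over `D` are fixed by the conjugation, while `u₀` and its inverse are changed by a
permutation of rows and of columns respectively. -/
theorem conj_u0_symm (hτ : τ lam = -lam) {r : ℕ} (M : Matrix (Fin (2 * r)) (Fin (2 * r)) D) :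
    (conjTensor D τ).toRingHom.mapMatrix ((u0 F E D (2 * r) lam h0).val *
      (Algebra.TensorProduct.includeLeft : D →ₐ[F] D ⊗[F] E).toRingHom.mapMatrix M *
      ((u0 F E D (2 * r) lam h0)⁻¹).val) =
    ((u0 F E D (2 * r) lam h0).val *
      (Algebra.TensorProduct.includeLeft : D →ₐ[F] D ⊗[F] E).toRingHom.mapMatrix M *
      ((u0 F E D (2 * r) lam h0)⁻¹).val).submatrix Fin.rev Fin.rev := by
  have h1 : (conjTensor D τ).toRingHom.mapMatrix
      ((Algebra.TensorProduct.includeLeft : D →ₐ[F] D ⊗[F] E).toRingHom.mapMatrix M) =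
      (Algebra.TensorProduct.includeLeft : D →ₐ[F] D ⊗[F] E).toRingHom.mapMatrix M := by
    ext i j
    change M i j ⊗ₜ[F] τ (1 : E) = M i j ⊗ₜ[F] (1 : E)
    rw [map_one]
  rw [map_mul, map_mul, u0_conj hτ, u0_inv_conj hτ, h1]
  rfl

theorem conj_apply_rev (hτ : τ lam = -lam) {r : ℕ} (h : GLn (2 * r) D) (i j : Fin (2 * r)) :
    conjTensor D τ ((MulAut.conj (u0 F E D (2 * r) lam h0) (embH F E D (2 * r) h)).val i j) =
      (MulAut.conj (u0 F E D (2 * r) lam h0) (embH F E D (2 * r) h)).val i.rev j.rev :=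
  congrFun (congrFun (conj_u0_symm (h0 := h0) hτ h.val) i) j

theorem mem_stab {m : ℕ} {u : GLn m (D ⊗[F] E)} {h : GLn m D} :
    h ∈ stab F E D m u ↔ MulAut.conj u (embH F E D m h) ∈ minParabolic (D ⊗[F] E) m := Iff.rfl

/-- The intersection of `u₀⁻¹ P u₀` with `H`, for a parabolic subgroup `P` whose Levi subgroup
preserves the planes. -/
theorem conj_embH_mem_parabolic_iff (hτ : τ lam = -lam) {r : ℕ} {b : Fin (2 * r) → ℕ}
    (hb : Monotone b) (hb1 : ∀ i j, b i < b j → b j.rev < b i.rev)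
    (hb2 : ∀ i j, b i = b j → j = i ∨ j = i.rev) (h : GLn (2 * r) D) :
    MulAut.conj (u0 F E D (2 * r) lam h0) (embH F E D (2 * r) h) ∈ parabolic (D ⊗[F] E) b ↔
      ∃ t : Fin r → GLn 2 D, planeGL D r t = h ∧
        ∀ i, b (planeEquiv r (0, i)) < b (planeEquiv r (1, i)) →
          t i ∈ stab F E D 2 (u0 F E D 2 lam h0) := by
  have key : ∀ t : Fin r → GLn 2 D, MulAut.conj (u0 F E D (2 * r) lam h0)
      (embH F E D (2 * r) (planeGL D r t)) = planeGL (D ⊗[F] E) r fun i =>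
        MulAut.conj (u0 F E D 2 lam h0) (embH F E D 2 (t i)) := by
    intro t
    rw [u0_eq_planeGL, embH_planeGL, MulAut.conj_apply, ← map_inv, ← map_mul, ← map_mul]
    rfl
  constructor
  · intro hh
    have hplane : ∀ g : GLn (2 * r) D, (MulAut.conj (u0 F E D (2 * r) lam h0)
        (embH F E D (2 * r) g)).val.BlockTriangular b → IsPlane g.val := by
      intro g hg
      set q := MulAut.conj (u0 F E D (2 * r) lam h0) (embH F E D (2 * r) g) with hq
      have hqp : IsPlane q.val := by
        intro i j h1 h2
        -- Above the block diagonal, the conjugate of the entry is the entry at the reversed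
        -- indices, which lies below it and vanishes. Within a block `hb2` leaves only indices of
        -- the same plane.
        rcases lt_trichotomy (b i) (b j) with h3 | h3 | h3
        · have h4 := conj_apply_rev (h0 := h0) hτ g i j
          rw [← hq, hg (hb1 i j h3), map_eq_zero_iff _ (conjTensor D τ).injective] at h4
          exact h4
        · rcases hb2 i j h3 with h4 | h4
          · exact absurd h4 h1
          · exact absurd h4 h2
        · exact hg h3
      have hu : IsPlane (u0 F E D (2 * r) lam h0).val := by
        rw [u0_eq_planeGL]; exact isPlane_plane _
      have hu' : IsPlane ((u0 F E D (2 * r) lam h0)⁻¹).val := by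
        rw [u0_eq_planeGL]; exact isPlane_plane _
      have he : (embH F E D (2 * r) g).val =
          ((u0 F E D (2 * r) lam h0)⁻¹).val * q.val * (u0 F E D (2 * r) lam h0).val := by
        rw [← Units.val_mul, ← Units.val_mul, hq, MulAut.conj_apply]
        congr 1
        group
      have hep : IsPlane (embH F E D (2 * r) g).val := by
        rw [he]
        exact (hu'.mul hqp).mul hu
      intro i j h1 h2
      have h3 := hep i j h1 h2
      rw [embH_apply] at h3
      exact includeLeft_inj (F := F) (E := E) (h3.trans (map_zero _).symm)
    have h1 := hplane h hh.1
    have h2 := hplane h⁻¹ (by rw [map_inv, map_inv]; exact hh.2)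
    obtain ⟨t, rfl⟩ := exists_planeGL h1 h2
    refine ⟨t, rfl, ?_⟩
    rw [key, planeGL_mem_parabolic hb] at hh
    exact hh
  · rintro ⟨t, rfl, ht⟩
    rw [key, planeGL_mem_parabolic hb]
    exact ht

theorem mem_stab_iff (hτ : τ lam = -lam) {r : ℕ} (h : GLn (2 * r) D) :
    h ∈ stab F E D (2 * r) (u0 F E D (2 * r) lam h0) ↔
      ∃ t : Fin r → GLn 2 D, planeGL D r t = h ∧
        ∀ i, t i ∈ stab F E D 2 (u0 F E D 2 lam h0) := by
  rw [mem_stab, minParabolic, conj_embH_mem_parabolic_iff hτ]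
  · refine exists_congr fun t => and_congr_right fun _ => forall_congr' fun i => ?_
    have : (planeEquiv r (0, i) : ℕ) < planeEquiv r (1, i) := by
      rw [planeEquiv_zero_val, planeEquiv_one_val]; omega
    simp only [this, true_imp_iff]
  · exact fun i j h => h
  · intro i j h
    simp only [Fin.val_rev]
    omega
  · intro i j h
    exact Or.inl (Fin.ext h.symm)

/-- The indices `r - 1` and `r` of the plane `i = r - 1` share the middle block, so its component is
unconstrained; the planes with `i + 1 < r` behave as for `P_∅`. -/
theorem conj_mem_middleParabolic_iff (hτ : τ lam = -lam) {r : ℕ} (h : GLn (2 * r) D) :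
    MulAut.conj (u0 F E D (2 * r) lam h0) (embH F E D (2 * r) h) ∈
        middleParabolic (D ⊗[F] E) r ↔
      ∃ t : Fin r → GLn 2 D, planeGL D r t = h ∧
        ∀ i : Fin r, (i : ℕ) + 1 < r → t i ∈ stab F E D 2 (u0 F E D 2 lam h0) := by
  rw [middleParabolic, conj_embH_mem_parabolic_iff hτ]
  · refine exists_congr fun t => and_congr_right fun _ => forall_congr' fun i => ?_
    have : ((if (planeEquiv r (0, i) : ℕ) < r then (planeEquiv r (0, i) : ℕ)
        else (planeEquiv r (0, i) : ℕ) - 1) <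
        (if (planeEquiv r (1, i) : ℕ) < r then (planeEquiv r (1, i) : ℕ)
        else (planeEquiv r (1, i) : ℕ) - 1)) ↔ (i : ℕ) + 1 < r := by
      rw [planeEquiv_zero_val, planeEquiv_one_val]
      have := i.2
      split_ifs <;> omega
    rw [this]
  · intro i j h
    have : (i : ℕ) ≤ j := h
    dsimp only
    split_ifs <;> omega
  · intro i j h
    simp only [Fin.val_rev]
    have := i.2
    have := j.2
    split_ifs at h ⊢ <;> omega
  · intro i j h
    simp only [Fin.ext_iff, Fin.val_rev]
    have := i.2
    have := j.2
    split_ifs at h <;> omega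

theorem minParabolic_le_middleParabolic (R : Type*) [Ring R] (r : ℕ) :
    minParabolic R (2 * r) ≤ middleParabolic R r := by
  have key : ∀ M : Matrix (Fin (2 * r)) (Fin (2 * r)) R,
      M.BlockTriangular (fun i : Fin (2 * r) => (i : ℕ)) →
      M.BlockTriangular (fun i : Fin (2 * r) => if (i : ℕ) < r then (i : ℕ) else (i : ℕ) - 1) := by
    intro M hM i j hij
    refine hM ?_
    dsimp only at hij ⊢
    split_ifs at hij <;> omega
  exact fun g hg => ⟨key _ hg.1, key _ hg.2⟩

end Groups

end LocalPeriod

namespace LocalPeriod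

open Topology Filter

/-! ### The modulus character and the Iwasawa decomposition. -/

section BorelModulus

variable {F : Type*} [NontriviallyNormedField F]
variable {B : Type*} [Ring B] [Algebra F B]

theorem minParabolic_apply_eq_zero {m : ℕ} {p : GLn m B} (hp : p ∈ minParabolic B m) {i j : Fin m}
    (h : j < i) : p.val i j = 0 := hp.1 h

theorem minParabolic_mul_diag {m : ℕ} {p p' : GLn m B} (hp : p ∈ minParabolic B m)
    (hp' : p' ∈ minParabolic B m) (i : Fin m) :
    (p * p').val i i = p.val i i * p'.val i i := by
  rw [Units.val_mul, Matrix.mul_apply]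
  refine Finset.sum_eq_single i (fun j _ hj => ?_) (fun h => absurd (Finset.mem_univ i) h)
  rcases lt_or_gt_of_ne hj with h | h
  · rw [minParabolic_apply_eq_zero hp h, zero_mul]
  · rw [minParabolic_apply_eq_zero hp' h, mul_zero]

theorem minParabolic_diag_mul_inv {m : ℕ} {p : GLn m B} (hp : p ∈ minParabolic B m) (i : Fin m) :
    modAbs F (p.val i i) * modAbs F ((p⁻¹).val i i) = 1 := by
  rw [← modAbs_mul, ← minParabolic_mul_diag hp ((minParabolic B m).inv_mem hp), mul_inv_cancel,
    Units.val_one, Matrix.one_apply_eq, modAbs_one]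

theorem minParabolic_diag_pos {m : ℕ} {p : GLn m B} (hp : p ∈ minParabolic B m) (i : Fin m) :
    0 < modAbs F (p.val i i) := by
  refine lt_of_le_of_ne (modAbs_nonneg _) fun h => ?_
  have := minParabolic_diag_mul_inv (F := F) hp i
  rw [← h, zero_mul] at this
  exact zero_ne_one this

theorem borelModulus_mul {m : ℕ} {p p' : GLn m B} (hp : p ∈ minParabolic B m)
    (hp' : p' ∈ minParabolic B m) :
    borelModulus F (p * p') = borelModulus F p * borelModulus F p' := by
  simp only [borelModulus, minParabolic_mul_diag hp hp', modAbs_mul, mul_div_mul_comm,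
    Finset.prod_mul_distrib]

theorem borelModulus_pos {m : ℕ} {p : GLn m B} (hp : p ∈ minParabolic B m) :
    0 < borelModulus F p :=
  Finset.prod_pos fun i _ => Finset.prod_pos fun j _ =>
    div_pos (minParabolic_diag_pos hp i) (minParabolic_diag_pos hp j)

theorem borelModulus_two (p : GLn 2 B) :
    borelModulus F p = modAbs F (p.val 0 0) / modAbs F (p.val 1 1) := by
  have h0 : Finset.Ioi (0 : Fin 2) = {1} := by decide
  have h1 : Finset.Ioi (1 : Fin 2) = ∅ := by decide
  rw [borelModulus, Fin.prod_univ_two, h0, h1, Finset.prod_singleton, Finset.prod_empty, mul_one]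

theorem borelModulus_eq_prod_pow {m : ℕ} (p : GLn m B) :
    borelModulus F p = ∏ i : Fin m, modAbs F (p.val i i) ^ (m - 1 - (i : ℕ)) /
      modAbs F (p.val i i) ^ (i : ℕ) := by
  rw [borelModulus]
  simp only [Finset.prod_div_distrib, Finset.prod_const, Fin.card_Ioi]
  congr 1
  rw [Finset.prod_comm' (t' := Finset.univ) (s' := fun j => Finset.Iio j) (by simp)]
  simp

/-- The diagonal entry with index `i` occurs in the modulus with exponent `m - 1 - 2 i`, and the
entry at the reversed index with the opposite exponent. The middle plane gets exponent 1. -/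
theorem borelModulus_planeGL {r : ℕ} (p : Fin r → GLn 2 B)
    (hp : ∀ i, p i ∈ minParabolic B 2) :
    borelModulus F (planeGL B r p) = ∏ i : Fin r, borelModulus F (p i) ^ (2 * r - 1 - 2 * (i : ℕ))
        := by
  rw [borelModulus_eq_prod_pow, ← (planeEquiv r).prod_comp, Fintype.prod_prod_type,
    Fin.prod_univ_two, ← Finset.prod_mul_distrib]
  refine Finset.prod_congr rfl fun i _ => ?_
  rw [planeGL_val, plane_apply, plane_apply, if_pos rfl, if_pos rfl, planeEquiv_zero_val,
    planeEquiv_one_val, borelModulus_two]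
  have ha := minParabolic_diag_pos (F := F) (hp i) 0
  have hb := minParabolic_diag_pos (F := F) (hp i) 1
  set a := modAbs F ((p i).val 0 0)
  set b := modAbs F ((p i).val 1 1)
  have h1 : 2 * r - 1 - (i : ℕ) = (2 * r - 1 - 2 * (i : ℕ)) + i := by omega
  have h2 : 2 * r - 1 - (2 * r - 1 - (i : ℕ)) = i := by omega
  rw [h2, h1, div_pow, pow_add, pow_add]
  field_simp

end BorelModulus

section Integral

variable (F : Type*) [NontriviallyNormedField F] [IsUltrametricDist F] [LocallyCompactSpace F]
variable (B : Type*) [Ring B] [Algebra F B] [FiniteDimensional F B] [IsDomain B]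
  [TopologicalSpace B] [IsModuleTopology F B]

/-- `GL(m, O_B)` as a subgroup. -/
def integralSubgroup (m : ℕ) : Subgroup (GLn m B) where
  carrier := integralGL F B m
  mul_mem' := by
    intro x y hx hy i j
    refine ⟨?_, ?_⟩
    · rw [Units.val_mul, Matrix.mul_apply]
      refine modAbs_sum_le _ _ zero_le_one fun k _ => ?_
      rw [modAbs_mul]
      exact mul_le_one₀ (hx i k).1 (modAbs_nonneg _) (hy k j).1
    · rw [mul_inv_rev, Units.val_mul, Matrix.mul_apply]
      refine modAbs_sum_le _ _ zero_le_one fun k _ => ?_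
      rw [modAbs_mul]
      exact mul_le_one₀ (hy i k).2 (modAbs_nonneg _) (hx k j).2
  one_mem' := by
    intro i j
    rw [inv_one, Units.val_one, Matrix.one_apply]
    split_ifs
    · rw [modAbs_one]; exact ⟨le_rfl, le_rfl⟩
    · rw [modAbs_zero]; exact ⟨zero_le_one, zero_le_one⟩
  inv_mem' := by
    intro x hx i j
    exact ⟨(hx i j).2, by rw [inv_inv]; exact (hx i j).1⟩

variable {F B}

theorem mem_integralSubgroup {m : ℕ} {g : GLn m B} :
    g ∈ integralSubgroup F B m ↔ ∀ i j, modAbs F (g.val i j) ≤ 1 ∧ modAbs F ((g⁻¹).val i j) ≤ 1 :=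
  Iff.rfl

theorem planeGL_mem_integral {r : ℕ} (k : Fin r → GLn 2 B) :
    planeGL B r k ∈ integralSubgroup F B (2 * r) ↔ ∀ i, k i ∈ integralSubgroup F B 2 := by
  simp only [mem_integralSubgroup, planeGL_val, planeGL_inv_val]
  constructor
  · intro h i a b
    have := h (planeEquiv r (a, i)) (planeEquiv r (b, i))
    simpa only [plane_apply, if_true] using this
  · intro h x y
    obtain ⟨⟨a, i⟩, rfl⟩ := (planeEquiv r).surjective x
    obtain ⟨⟨b, j⟩, rfl⟩ := (planeEquiv r).surjective y
    rw [plane_apply, plane_apply]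
    split_ifs with hij
    · exact h i a b
    · rw [modAbs_zero]; exact ⟨zero_le_one, zero_le_one⟩

theorem borelModulus_eq_one {m : ℕ} {p : GLn m B} (hp : p ∈ minParabolic B m)
    (hk : p ∈ integralSubgroup F B m) : borelModulus F p = 1 := by
  have h : ∀ i, modAbs F (p.val i i) = 1 := by
    intro i
    have h1 := minParabolic_diag_mul_inv (F := F) hp i
    have h2 := (hk i i).1
    have h3 := (hk i i).2
    have h4 := minParabolic_diag_pos (F := F) hp i
    nlinarith
  simp [borelModulus, h]

/-- The choice in `iwasawaModulus` is harmless: two decompositions differ by an element of `P_∅ ∩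
K`, where the modulus is 1. -/
theorem iwasawaModulus_mul {m : ℕ} {p k : GLn m B} (hp : p ∈ minParabolic B m)
    (hk : k ∈ integralSubgroup F B m) : iwasawaModulus F (p * k) = borelModulus F p := by
  have h : ∃ p' ∈ minParabolic B m, ∃ k' ∈ integralGL F B m, p * k = p' * k' := ⟨p, hp, k, hk, rfl⟩
  rw [iwasawaModulus, dif_pos h]
  obtain ⟨h1, k', h2, h3⟩ := h.choose_spec
  set p' := h.choose
  have h4 : p = p' * (k' * k⁻¹) := by
    rw [← mul_assoc, ← h3, mul_inv_cancel_right]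
  have h5 : k' * k⁻¹ ∈ minParabolic B m := by
    have : k' * k⁻¹ = p'⁻¹ * p := by rw [eq_inv_mul_iff_mul_eq, ← h4]
    rw [this]
    exact (minParabolic B m).mul_mem ((minParabolic B m).inv_mem h1) hp
  conv_rhs => rw [h4]
  rw [borelModulus_mul h1 h5, borelModulus_eq_one h5 ((integralSubgroup F B m).mul_mem h2
    ((integralSubgroup F B m).inv_mem hk)), mul_one]

/-- Outside `P_∅ K` both sides take the default value 0, so no Iwasawa decomposition of a general
element is needed. -/
theorem iwasawaModulus_left {m : ℕ} {p : GLn m B} (hp : p ∈ minParabolic B m) (g : GLn m B) :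
    iwasawaModulus F (p * g) = borelModulus F p * iwasawaModulus F g := by
  by_cases h : ∃ p' ∈ minParabolic B m, ∃ k' ∈ integralGL F B m, g = p' * k'
  · obtain ⟨p', hp', k', hk', rfl⟩ := h
    rw [← mul_assoc, iwasawaModulus_mul ((minParabolic B m).mul_mem hp hp') hk',
      iwasawaModulus_mul hp' hk', borelModulus_mul hp hp']
  · have h' : ¬ ∃ p' ∈ minParabolic B m, ∃ k' ∈ integralGL F B m, p * g = p' * k' := by
      rintro ⟨p', hp', k', hk', h2⟩
      exact h ⟨p⁻¹ * p', (minParabolic B m).mul_mem ((minParabolic B m).inv_mem hp) hp', k', hk',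
        by rw [mul_assoc, ← h2, inv_mul_cancel_left]⟩
    rw [iwasawaModulus, iwasawaModulus, dif_neg h, dif_neg h', mul_zero]

theorem iwasawaModulus_right {m : ℕ} {k : GLn m B} (hk : k ∈ integralSubgroup F B m)
    (g : GLn m B) : iwasawaModulus F (g * k) = iwasawaModulus F g := by
  by_cases h : ∃ p' ∈ minParabolic B m, ∃ k' ∈ integralGL F B m, g = p' * k'
  · obtain ⟨p', hp', k', hk', rfl⟩ := h
    rw [mul_assoc, iwasawaModulus_mul hp' ((integralSubgroup F B m).mul_mem hk' hk),
      iwasawaModulus_mul hp' hk']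
  · have h' : ¬ ∃ p' ∈ minParabolic B m, ∃ k' ∈ integralGL F B m, g * k = p' * k' := by
      rintro ⟨p', hp', k', hk', h2⟩
      exact h ⟨p', hp', k' * k⁻¹, (integralSubgroup F B m).mul_mem hk'
        ((integralSubgroup F B m).inv_mem hk), by rw [← mul_assoc, ← h2, mul_inv_cancel_right]⟩
    rw [iwasawaModulus, iwasawaModulus, dif_neg h, dif_neg h']

theorem mem_minParabolic_two_of_apply {p : GLn 2 B} (h : p.val 1 0 = 0) :
    p ∈ minParabolic B 2 := by
  refine mem_minParabolic_two.2 ⟨h, ?_⟩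
  have h1 : (p.val * (p⁻¹).val) 1 0 = 0 := by rw [Units.mul_inv]; rfl
  have h2 : (p.val * (p⁻¹).val) 1 1 = 1 := by rw [Units.mul_inv]; rfl
  rw [Matrix.mul_apply, Fin.sum_univ_two, h, zero_mul, zero_add] at h1 h2
  refine (mul_eq_zero.1 h1).resolve_left fun h3 => ?_
  rw [h3, zero_mul] at h2
  exact zero_ne_one h2

/-- The Iwasawa decomposition of `(1, w; 1, z)`. -/
theorem exists_iwasawa_two {g : GLn 2 B} {w z : B} (hg : g.val = !![1, w; 1, z]) :
    ∃ p ∈ minParabolic B 2, ∃ k ∈ integralSubgroup F B 2, g = p * k ∧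
      borelModulus F p = modAbs F (z - w) / max 1 (modAbs F z) ^ 2 := by
  have key : ∀ k : GLn 2 B, k ∈ integralSubgroup F B 2 → (g * k⁻¹).val 1 0 = 0 →
      modAbs F ((g * k⁻¹).val 0 0) / modAbs F ((g * k⁻¹).val 1 1) =
        modAbs F (z - w) / max 1 (modAbs F z) ^ 2 →
      ∃ p ∈ minParabolic B 2, ∃ k ∈ integralSubgroup F B 2, g = p * k ∧
      borelModulus F p = modAbs F (z - w) / max 1 (modAbs F z) ^ 2 := by
    intro k hk h1 h2
    refine ⟨g * k⁻¹, mem_minParabolic_two_of_apply h1, k, hk, by rw [inv_mul_cancel_right], ?_⟩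
    rw [borelModulus_two, h2]
  have h11 : modAbs F (1 : B) ≤ 1 := modAbs_one.le
  have h00 : modAbs F (0 : B) ≤ 1 := by rw [modAbs_zero]; exact zero_le_one
  -- The bottom row of `k` is the row `(1, z)` made primitive: `(1, z)` itself if `z` is integral,
  -- and `(z⁻¹, 1)` otherwise. Then `g k⁻¹` is upper triangular.
  rcases le_or_gt (modAbs F z) 1 with hz | hz
  · let k : GLn 2 B := ⟨!![0, 1; 1, z], !![-z, 1; 1, 0], by
      ext i j; fin_cases i <;> fin_cases j <;> simp, by
      ext i j; fin_cases i <;> fin_cases j <;> simp⟩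
    have hp : (g * k⁻¹).val = !![w - z, 1; 0, 1] := by
      rw [Units.val_mul, hg]
      change _ * !![-z, 1; 1, 0] = _
      ext i j; fin_cases i <;> fin_cases j <;> simp [neg_add_eq_sub]
    refine key k ?_ ?_ ?_
    · intro i j
      change modAbs F (!![0, 1; 1, z] i j) ≤ 1 ∧ modAbs F (!![-z, 1; 1, 0] i j) ≤ 1
      fin_cases i <;> fin_cases j <;> simp [modAbs_neg, h11, h00, hz]
    · rw [hp]; rfl
    · rw [hp, max_eq_left hz]
      simp [modAbs_one]
      rw [← modAbs_neg, neg_sub]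
  · have hz0 : z ≠ 0 := by
      rintro rfl
      rw [modAbs_zero] at hz
      exact absurd hz (not_lt.2 zero_le_one)
    obtain ⟨v, rfl⟩ := FiniteDimensional.isUnit F hz0
    let k : GLn 2 B := ⟨!![1, 0; (v⁻¹ : Bˣ), 1], !![1, 0; -(v⁻¹ : Bˣ), 1], by
      ext i j; fin_cases i <;> fin_cases j <;> simp, by
      ext i j; fin_cases i <;> fin_cases j <;> simp⟩
    have hp : (g * k⁻¹).val = !![1 - w * (v⁻¹ : Bˣ), w; 0, (v : B)] := by
      rw [Units.val_mul, hg]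
      change _ * !![1, 0; -((v⁻¹ : Bˣ) : B), 1] = _
      ext i j; fin_cases i <;> fin_cases j <;> simp [sub_eq_add_neg]
    have hv : modAbs F ((v⁻¹ : Bˣ) : B) ≤ 1 := by
      rw [modAbs_units_inv]
      exact inv_le_one_of_one_le₀ hz.le
    refine key k ?_ ?_ ?_
    · intro i j
      change modAbs F (!![1, 0; ((v⁻¹ : Bˣ) : B), 1] i j) ≤ 1 ∧
        modAbs F (!![1, 0; -((v⁻¹ : Bˣ) : B), 1] i j) ≤ 1
      fin_cases i <;> fin_cases j <;> simp [modAbs_neg, h11, h00, hv]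
    · rw [hp]; rfl
    · rw [hp, max_eq_right hz.le]
      have h1 : (1 : B) - w * (v⁻¹ : Bˣ) = (v - w) * (v⁻¹ : Bˣ) := by
        rw [sub_mul, Units.mul_inv]
      change modAbs F ((1 : B) - w * (v⁻¹ : Bˣ)) / modAbs F (v : B) = _
      rw [h1, modAbs_mul, modAbs_units_inv]
      have := modAbs_units_pos (F := F) v
      field_simp

end Integral

section StabModulus

variable {F E D : Type*} [NontriviallyNormedField F] [Field E] [Algebra F E] [DivisionRing D]
  [Algebra F D] {lam : E} {h0 : 2 * lam ≠ 0} {τ : E ≃ₐ[F] E}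

/-- The two diagonal entries are conjugate to each other, hence have the same absolute value. This
is what lets functions in the induced representation descend to the orbit for every `s`. -/
theorem borelModulus_stab_two (hτ : τ lam = -lam) {s : GLn 2 D}
    (hs : s ∈ stab F E D 2 (u0 F E D 2 lam h0)) :
    borelModulus F (MulAut.conj (u0 F E D 2 lam h0) (embH F E D 2 s)) = 1 := by
  rw [borelModulus_two]
  have h1 := conj_apply_rev (h0 := h0) hτ (r := 1) s 0 0
  have h2 : (MulAut.conj (u0 F E D 2 lam h0) (embH F E D 2 s)).val 1 1 =
    conjTensor D τ ((MulAut.conj (u0 F E D 2 lam h0) (embH F E D 2 s)).val 0 0) := h1.symm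
  rw [h2, modAbs_algEquiv]
  exact div_self (minParabolic_diag_pos (mem_stab.1 hs) 0).ne'

theorem borelModulus_stab (hτ : τ lam = -lam) {r : ℕ} {s : GLn (2 * r) D}
    (hs : s ∈ stab F E D (2 * r) (u0 F E D (2 * r) lam h0)) :
    borelModulus F (MulAut.conj (u0 F E D (2 * r) lam h0) (embH F E D (2 * r) s)) = 1 := by
  obtain ⟨t, rfl, ht⟩ := (mem_stab_iff hτ s).1 hs
  have key : MulAut.conj (u0 F E D (2 * r) lam h0)
      (embH F E D (2 * r) (planeGL D r t)) = planeGL (D ⊗[F] E) r fun i =>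
        MulAut.conj (u0 F E D 2 lam h0) (embH F E D 2 (t i)) := by
    rw [u0_eq_planeGL, embH_planeGL, MulAut.conj_apply, ← map_inv, ← map_mul, ← map_mul]
    rfl
  rw [key, borelModulus_planeGL _ fun i => mem_stab.1 (ht i)]
  exact Finset.prod_eq_one fun i _ => by rw [borelModulus_stab_two hτ (ht i), one_pow]

end StabModulus

end LocalPeriod

namespace LocalPeriod

open Topology Filter

/-! ### Unit groups and the inverse function theorem. -/

section UnitsTopology

variable {F : Type*} [NontriviallyNormedField F]
variable {C : Type*} [Ring C] [Algebra F C] [FiniteDimensional F C] [TopologicalSpace C]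
  [IsModuleTopology F C]

theorem isUnit_iff_det_leftMulMatrix_ne_zero (x : C) :
    IsUnit x ↔ (Algebra.leftMulMatrix (Module.finBasis F C) x).det ≠ 0 := by
  rw [← Algebra.norm_eq_matrix_det]
  constructor
  · intro h
    exact (h.map (Algebra.norm F)).ne_zero
  · intro h
    rw [Algebra.norm_apply] at h
    exact (Algebra.lmul_isUnit_iff (R := F)).1
      ⟨LinearMap.GeneralLinearGroup.ofLinearEquiv (LinearMap.equivOfDetNeZero _ h), by ext; rfl⟩

theorem continuous_leftMulMatrix :
    Continuous (fun x : C => Algebra.leftMulMatrix (Module.finBasis F C) x) :=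
  continuous_linear_of_moduleTopology (Algebra.leftMulMatrix (Module.finBasis F C)).toLinearMap

theorem units_inv_eq (u : Cˣ) : ((u⁻¹ : Cˣ) : C) = (coordHomeo F C).symm
    ((Algebra.leftMulMatrix (Module.finBasis F C) (u : C))⁻¹.mulVec (coordHomeo F C 1)) := by
  set b := Module.finBasis F C
  rw [ContinuousLinearEquiv.eq_symm_apply]
  have h1 : (Algebra.leftMulMatrix b (u : C))⁻¹ = Algebra.leftMulMatrix b ((u⁻¹ : Cˣ) : C) := by
    refine Matrix.inv_eq_left_inv ?_
    rw [← map_mul, Units.inv_mul, map_one]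
  rw [h1]
  have h2 := Algebra.leftMulMatrix_mulVec_repr b ((u⁻¹ : Cˣ) : C) 1
  rw [mul_one] at h2
  exact h2.symm

/-- An element is invertible exactly when the matrix of its left multiplication is, and its inverse
is read off from the inverse matrix applied to the coordinates of 1. Openness and continuity reduce
to the determinant and the adjugate. -/
theorem isOpenEmbedding_units_val (F : Type*) {C : Type*} [NontriviallyNormedField F] [Ring C]
    [Algebra F C] [FiniteDimensional F C] [TopologicalSpace C] [IsModuleTopology F C] :
    IsOpenEmbedding (Units.val : Cˣ → C) := by
  refine ⟨?_, ?_⟩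
  · refine Units.isEmbedding_val_mk' (f := fun x => (coordHomeo F C).symm
      ((Algebra.leftMulMatrix (Module.finBasis F C) x)⁻¹.mulVec (coordHomeo F C 1))) ?_
      fun u => (units_inv_eq u).symm
    refine (coordHomeo F C).symm.continuous.comp_continuousOn ?_
    have hA := (continuous_leftMulMatrix (F := F) (C := C)).continuousOn (s := {x | IsUnit x})
    have hinv : ContinuousOn (fun x : C => (Algebra.leftMulMatrix (Module.finBasis F C) x)⁻¹)
        {x | IsUnit x} := by
      simp only [Matrix.inv_def, Ring.inverse_eq_inv']
      refine ContinuousOn.smul (ContinuousOn.inv₀ (f := fun x : C =>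
        (Algebra.leftMulMatrix (Module.finBasis F C) x).det) ?_ ?_) ?_
      · exact (continuous_leftMulMatrix (F := F) (C := C)).matrix_det.continuousOn
      · intro x hx
        exact (isUnit_iff_det_leftMulMatrix_ne_zero x).1 hx
      · exact (continuous_leftMulMatrix (F := F) (C := C)).matrix_adjugate.continuousOn
    rw [continuousOn_iff_continuous_domRestrict] at hinv ⊢
    exact Continuous.matrix_mulVec hinv continuous_const
  · have : Set.range (Units.val : Cˣ → C) =
        {x | (Algebra.leftMulMatrix (Module.finBasis F C) x).det ≠ 0} := by
      ext x
      exact isUnit_iff_det_leftMulMatrix_ne_zero x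
    rw [this]
    exact isOpen_ne_fun (continuous_leftMulMatrix (F := F) (C := C)).matrix_det continuous_const

variable {C' : Type*} [Ring C'] [Algebra F C'] [FiniteDimensional F C'] [TopologicalSpace C']
  [IsModuleTopology F C'] [LocallyCompactSpace F]

theorem inv_mem_subalgebra (S : Subalgebra F C) {p : Cˣ} (hp : (p : C) ∈ S) :
    ((p⁻¹ : Cˣ) : C) ∈ S := by
  let f : S →ₗ[F] S := LinearMap.mulLeft F (⟨p, hp⟩ : S)
  have hf : Function.Injective f := by
    intro x y hxy
    have h1 : (p : C) * x = (p : C) * y := congrArg Subtype.val hxy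
    exact Subtype.ext (p.isUnit.mul_right_injective h1)
  obtain ⟨y, hy⟩ := (LinearMap.injective_iff_surjective.1 hf) 1
  have h1 : (p : C) * y = 1 := congrArg Subtype.val hy
  rw [Units.inv_eq_of_mul_eq_one_right h1]
  exact y.2

/-- The double coset of a point at which the two Lie algebras span is a neighbourhood of it. -/
theorem doubleCoset_mem_nhds (S : Subalgebra F C) (φ : C' →ₐ[F] C) (u : Cˣ)
    (hspan : ∀ z : C, ∃ x ∈ S, ∃ y : C', z = x * u + u * φ y) (J : Set C'ˣ) (hJ : J ∈ 𝓝 1) :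
    {g : Cˣ | ∃ p : Cˣ, (p : C) ∈ S ∧ ∃ j ∈ J, (g : C) = p * u * φ (j : C')} ∈ 𝓝 u := by
  have : ProperSpace F := .of_nontriviallyNormedField_of_weaklyLocallyCompactSpace F
  have := IsModuleTopology.isTopologicalRing F C
  have := IsModuleTopology.isTopologicalRing F C'
  let V := Fin (Module.finrank F S) → F
  let W := Fin (Module.finrank F C') → F
  let X := Fin (Module.finrank F C) → F
  let e₁ : V →ₗ[F] C := S.val.toLinearMap.comp (Module.finBasis F S).equivFun.symm.toLinearMap
  let e₂ : W ≃L[F] C' := (coordHomeo F C').symm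
  let e₃ : C ≃L[F] X := coordHomeo F C
  have he₁S : ∀ v, e₁ v ∈ S := fun v => ((Module.finBasis F S).equivFun.symm v).2
  have he₁s : ∀ x ∈ S, ∃ v, e₁ v = x := fun x hx =>
    ⟨(Module.finBasis F S).equivFun ⟨x, hx⟩,
      congrArg Subtype.val ((Module.finBasis F S).equivFun.symm_apply_apply ⟨x, hx⟩)⟩
  have he₁c : Continuous e₁ := continuous_linear_of_moduleTopology e₁
  have hφc : Continuous φ := continuous_linear_of_moduleTopology φ.toLinearMap
  let mulu : C →ₗ[F] C →ₗ[F] C := (LinearMap.mul F C).comp (LinearMap.mulRight F (u : C))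
  have hmulu : ∀ x y, mulu x y = x * u * y := fun _ _ => rfl
  let b₀ : X →ₗ[F] X →ₗ[F] X :=
    ((mulu.compl₁₂ e₃.symm.toLinearEquiv.toLinearMap
      e₃.symm.toLinearEquiv.toLinearMap)).compr₂ e₃.toLinearEquiv.toLinearMap
  have hb₀ : ∀ x y, b₀ x y = e₃ (e₃.symm x * u * e₃.symm y) := fun _ _ => rfl
  let b : X →L[F] X →L[F] X := LinearMap.toContinuousLinearMap
    ((LinearMap.toContinuousLinearMap (𝕜 := F) (E := X) (F' := X)).toLinearMap.comp b₀)
  have hb : ∀ x y, b x y = e₃ (e₃.symm x * u * e₃.symm y) := fun _ _ => rfl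
  let l₁ : V × W →L[F] X := LinearMap.toContinuousLinearMap
    (e₃.toLinearEquiv.toLinearMap.comp (e₁.comp (LinearMap.fst F V W)))
  let l₂ : V × W →L[F] X := LinearMap.toContinuousLinearMap
    (e₃.toLinearEquiv.toLinearMap.comp (φ.toLinearMap.comp
      (e₂.toLinearEquiv.toLinearMap.comp (LinearMap.snd F V W))))
  have hl₁ : ∀ v, l₁ v = e₃ (e₁ v.1) := fun _ => rfl
  have hl₂ : ∀ v, l₂ v = e₃ (φ (e₂ v.2)) := fun _ => rfl
  let f₁ : V × W → X := fun v => e₃ 1 + l₁ v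
  let f₂ : V × W → X := fun v => e₃ 1 + l₂ v
  have hf₁ : HasStrictFDerivAt f₁ l₁ 0 := (l₁.hasStrictFDerivAt).const_add _
  have hf₂ : HasStrictFDerivAt f₂ l₂ 0 := (l₂.hasStrictFDerivAt).const_add _
  -- In coordinates `Φ` is `(x, y) ↦ (1 + x) u (1 + φ y)`. Its derivative at 0 is `(x, y) ↦ x u + u
  -- φ(y)`, which `hspan` makes surjective.
  let Φ : V × W → X := fun v => b (f₁ v) (f₂ v)
  have hΦ := b.hasStrictFDerivAt_of_bilinear hf₁ hf₂
  have hΦapp : ∀ v, Φ v = e₃ ((1 + e₁ v.1) * u * (1 + φ (e₂ v.2))) := by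
    intro v
    change b (f₁ v) (f₂ v) = _
    rw [hb]
    simp only [f₁, f₂, hl₁, hl₂, map_add, ContinuousLinearEquiv.symm_apply_apply]
  have hΦ0 : Φ 0 = e₃ u := by
    rw [hΦapp]
    simp
  have hmap := hΦ.map_nhds_eq_of_surj (by
    rw [LinearMap.range_eq_top]
    intro z
    obtain ⟨x, hx, y, hz⟩ := hspan (e₃.symm z)
    obtain ⟨v, rfl⟩ := he₁s x hx
    refine ⟨(v, e₂.symm y), ?_⟩
    change b (f₁ 0) (l₂ (v, e₂.symm y)) + b (l₁ (v, e₂.symm y)) (f₂ 0) = z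
    rw [hb, hb, ← map_add, ← ContinuousLinearEquiv.eq_symm_apply, hz]
    simp only [f₁, f₂, hl₁, hl₂, map_add, ContinuousLinearEquiv.symm_apply_apply,
      ContinuousLinearEquiv.apply_symm_apply]
    simp [add_comm])
  change map Φ (𝓝 0) = 𝓝 (Φ 0) at hmap
  rw [hΦ0] at hmap
  -- On `N` the first factor is a unit and the second is the value of an element of `J`, so `Φ '' N`
  -- consists of elements of the required form.
  let N : Set (V × W) := {v | IsUnit (1 + e₁ v.1) ∧ ∃ j ∈ J, (j : C') = 1 + e₂ v.2}
  have hN : N ∈ 𝓝 (0 : V × W) := by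
    refine Filter.inter_mem ?_ ?_
    · have hc : Continuous fun v : V × W => 1 + e₁ v.1 :=
        continuous_const.add (he₁c.comp continuous_fst)
      have ho := (isOpenEmbedding_units_val F (C := C)).isOpen_range
      refine hc.continuousAt.preimage_mem_nhds (ho.mem_nhds ?_)
      simp
    · have hc : Continuous fun v : V × W => 1 + e₂ v.2 :=
        continuous_const.add (e₂.continuous.comp continuous_snd)
      have ho : Units.val '' J ∈ 𝓝 ((1 : C'ˣ) : C') :=
        (isOpenEmbedding_units_val F (C := C')).isOpenMap.image_mem_nhds hJ
      have h0 : (fun v : V × W => 1 + e₂ v.2) 0 = ((1 : C'ˣ) : C') := by simp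
      rw [← h0] at ho
      exact hc.continuousAt.preimage_mem_nhds ho
  have hΦN : Φ '' N ∈ 𝓝 (e₃ (u : C)) := by
    rw [← hmap]
    exact Filter.image_mem_map hN
  have hc : Continuous fun g : Cˣ => e₃ (g : C) := e₃.continuous.comp Units.continuous_val
  filter_upwards [hc.continuousAt.preimage_mem_nhds hΦN] with g hg
  obtain ⟨v, ⟨⟨p, hp⟩, j, hj, hj'⟩, hv⟩ := hg
  refine ⟨p, ?_, j, hj, ?_⟩
  · rw [hp]
    exact S.add_mem S.one_mem (he₁S _)
  · rw [hΦapp] at hv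
    rw [← e₃.injective hv, hp, hj', map_add, map_one]

end UnitsTopology

end LocalPeriod

namespace LocalPeriod

open Topology Filter

/-! ### Compact open subgroups and the openness of `P u₀ H`. -/

section IntegralTopology

variable {F : Type*} [NontriviallyNormedField F] [IsUltrametricDist F] [LocallyCompactSpace F]
variable {B : Type*} [Ring B] [Algebra F B] [FiniteDimensional F B] [IsDomain B]
  [TopologicalSpace B] [IsModuleTopology F B]

theorem isOpen_integralSubgroup (m : ℕ) : IsOpen (integralSubgroup F B m : Set (GLn m B)) := by
  have h : (integralSubgroup F B m : Set (GLn m B)) =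
      ⋂ i, ⋂ j, ((fun g : GLn m B => g.val i j) ⁻¹' {x | modAbs F x ≤ 1} ∩
        (fun g : GLn m B => (g⁻¹).val i j) ⁻¹' {x | modAbs F x ≤ 1}) := by
    ext g
    simp only [Set.mem_iInter]
    exact Iff.rfl
  rw [h]
  have ho := isOpen_modAbs_le (F := F) (B := B) one_pos
  refine isOpen_iInter_of_finite fun i => isOpen_iInter_of_finite fun j =>
    (ho.preimage ?_).inter (ho.preimage ?_)
  · exact (Units.continuous_val.matrix_elem i j)
  · exact (Units.continuous_coe_inv.matrix_elem i j)

theorem t2Space_of_moduleTopology (F : Type*) {V : Type*} [NontriviallyNormedField F]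
    [AddCommGroup V] [Module F V]
    [FiniteDimensional F V] [TopologicalSpace V] [IsModuleTopology F V] : T2Space V :=
  (coordHomeo F V).toHomeomorph.symm.t2Space

theorem isCompact_integralSubgroup (m : ℕ) :
    IsCompact (integralSubgroup F B m : Set (GLn m B)) := by
  have := IsModuleTopology.isTopologicalRing F B
  have : T2Space B := t2Space_of_moduleTopology F
  have hemb : IsClosedEmbedding (Units.embedProduct (Matrix (Fin m) (Fin m) B)) :=
    Units.isClosedEmbedding_embedProduct
  let S : Set (Matrix (Fin m) (Fin m) B) :=
    Set.pi Set.univ fun _ => Set.pi Set.univ fun _ => {x : B | modAbs F x ≤ 1}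
  have hS : IsCompact S :=
    isCompact_univ_pi fun _ => isCompact_univ_pi fun _ => isCompact_modAbs_le 1
  have hT : IsCompact (S ×ˢ (MulOpposite.opHomeomorph '' S)) :=
    hS.prod (hS.image MulOpposite.opHomeomorph.continuous)
  have := hemb.isCompact_preimage hT
  convert this using 1
  ext g
  rw [SetLike.mem_coe, mem_integralSubgroup, Set.mem_preimage, Set.mem_prod]
  constructor
  · intro h
    exact ⟨fun i _ j _ => (h i j).1, (g⁻¹).val, fun i _ j _ => (h i j).2, rfl⟩
  · rintro ⟨h1, x, h2, h3⟩ i j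
    have hx : x = (g⁻¹).val := MulOpposite.op_injective h3
    subst hx
    exact ⟨h1 i trivial j trivial, h2 i trivial j trivial⟩

variable (B) in
/-- The subalgebra of block triangular matrices. -/
def blockTriangularSubalgebra {m : ℕ} (b : Fin m → ℕ) :
    Subalgebra F (Matrix (Fin m) (Fin m) B) where
  carrier := {M | M.BlockTriangular b}
  mul_mem' := fun hx hy => Matrix.BlockTriangular.mul hx hy
  add_mem' := fun hx hy => Matrix.BlockTriangular.add hx hy
  algebraMap_mem' := fun a => by
    rw [Matrix.algebraMap_eq_diagonal]
    exact Matrix.blockTriangular_diagonal _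

end IntegralTopology

section Concrete

variable {F E D : Type*} [NontriviallyNormedField F] [IsUltrametricDist F] [LocallyCompactSpace F]
  [Field E] [Algebra F E] [FiniteDimensional F E]
  [DivisionRing D] [Algebra F D] [FiniteDimensional F D]
  [TopologicalSpace D] [IsModuleTopology F D]
  [TopologicalSpace (D ⊗[F] E)] [IsModuleTopology F (D ⊗[F] E)]

/-- The embedding of matrices over `D` into matrices over `D ⊗ E` as an algebra homomorphism. -/
def includeMatrix (F E D : Type*) [Field F] [Field E] [Algebra F E] [DivisionRing D]
    [Algebra F D] (m : ℕ) :
    Matrix (Fin m) (Fin m) D →ₐ[F] Matrix (Fin m) (Fin m) (D ⊗[F] E) :=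
  (Algebra.TensorProduct.includeLeft : D →ₐ[F] D ⊗[F] E).mapMatrix

theorem embH_val {m : ℕ} (h : GLn m D) : (embH F E D m h).val = includeMatrix F E D m h.val := rfl

theorem continuous_embH (m : ℕ) : Continuous (embH F E D m) := by
  have h1 : Continuous (includeMatrix F E D m) :=
    continuous_linear_of_moduleTopology (includeMatrix F E D m).toLinearMap
  exact Continuous.units_map
    ((Algebra.TensorProduct.includeLeft : D →ₐ[F] D ⊗[F] E).toRingHom.mapMatrix :
      Matrix (Fin m) (Fin m) D →+* Matrix (Fin m) (Fin m) (D ⊗[F] E)).toMonoidHom h1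

variable {lam : E} {h0 : 2 * lam ≠ 0} {τ : E ≃ₐ[F] E}

theorem conj_involutive (hE : Module.finrank F E = 2)
    (hlam : lam ∉ Set.range (algebraMap F E)) (hτ : τ lam = -lam) (x : E) : τ (τ x) = x := by
  obtain ⟨a, b, rfl⟩ := exists_add_mul_of_finrank_two hE hlam x
  simp [hτ]

theorem conjTensor_involutive (hE : Module.finrank F E = 2)
    (hlam : lam ∉ Set.range (algebraMap F E)) (hτ : τ lam = -lam) (x : D ⊗[F] E) :
    conjTensor D τ (conjTensor D τ x) = x := by
  induction x using TensorProduct.induction_on with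
  | zero => simp
  | add x y hx hy => rw [map_add, map_add, hx, hy]
  | tmul x e => rw [conjTensor_tmul, conjTensor_tmul, conj_involutive hE hlam hτ]

theorem exists_of_conjTensor_eq (h2 : (2 : F) ≠ 0) (hE : Module.finrank F E = 2)
    (hlam : lam ∉ Set.range (algebraMap F E)) (hτ : τ lam = -lam) {z : D ⊗[F] E}
    (hz : conjTensor D τ z = z) : ∃ x : D, z = x ⊗ₜ[F] (1 : E) := by
  obtain ⟨⟨x, y⟩, rfl⟩ := pairMap_surjective hE hlam z
  have h3 : conjTensor D τ (pairMap F D lam (x, y)) = pairMap F D lam (x, -y) := by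
    rw [pairMap_apply, pairMap_apply, map_add, conjTensor_tmul, conjTensor_tmul, hτ, map_one,
      TensorProduct.tmul_neg, TensorProduct.neg_tmul]
  rw [h3] at hz
  have h4 : -y = y := congrArg Prod.snd ((pairMap_bijective (D := D) hE hlam).1 hz)
  have h5 : (2 : F) • y = 0 := by
    rw [two_smul]
    nth_rw 1 [← h4]
    exact neg_add_cancel y
  have h6 : y = 0 := (smul_eq_zero.1 h5).resolve_left h2
  exact ⟨x, by rw [pairMap_apply, h6, TensorProduct.zero_tmul, add_zero]⟩

/-- After right multiplication by `u₀⁻¹`, a matrix has to be split into a block triangular one and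
one lying in `u₀ M(D) u₀⁻¹`, which consists of the matrices with `τ(w i j) = w i.rev j.rev`. Take
for `w` the part of the given matrix below the block diagonal, extend it above by this symmetry, and
put 0 on the diagonal blocks. -/
theorem exists_lie_decomposition (h2 : (2 : F) ≠ 0) (hE : Module.finrank F E = 2)
    (hlam : lam ∉ Set.range (algebraMap F E)) (hτ : τ lam = -lam) {r : ℕ} {b : Fin (2 * r) → ℕ}
    (hb : ∀ i j, b i < b j ↔ b j.rev < b i.rev)
    (z : Matrix (Fin (2 * r)) (Fin (2 * r)) (D ⊗[F] E)) :
    ∃ x ∈ blockTriangularSubalgebra (F := F) (D ⊗[F] E) b, ∃ y : Matrix (Fin (2 * r)) (Fin (2 * r))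
        D,
      z = x * (u0 F E D (2 * r) lam h0).val +
        (u0 F E D (2 * r) lam h0).val * includeMatrix F E D (2 * r) y := by
  set u := u0 F E D (2 * r) lam h0 with hu
  let z' := z * (u⁻¹).val
  let w : Matrix (Fin (2 * r)) (Fin (2 * r)) (D ⊗[F] E) := Matrix.of fun i j =>
    if b j < b i then z' i j else if b i < b j then conjTensor D τ (z' i.rev j.rev) else 0
  have hw : (conjTensor D τ).toRingHom.mapMatrix w = w.submatrix Fin.rev Fin.rev := by
    ext i j
    change conjTensor D τ (w i j) = w i.rev j.rev
    simp only [w, Matrix.of_apply]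
    rcases lt_trichotomy (b i) (b j) with h | h | h
    · have h' := (hb i j).1 h
      simp only [h, h', if_true, if_neg h.not_gt]
      exact conjTensor_involutive hE hlam hτ _
    · have h3 : ¬ b j.rev < b i.rev := fun h4 => by
        have := (hb i j).2 h4
        omega
      have h4 : ¬ b i.rev < b j.rev := fun h4 => by
        have := (hb j i).2 h4
        omega
      simp [h, h3, h4]
    · have h' := (hb j i).1 h
      simp only [h, if_true, if_neg h'.not_gt, h', Fin.rev_rev]
  have hx : z' - w ∈ blockTriangularSubalgebra (F := F) (D ⊗[F] E) b := by
    intro i j hij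
    change z' i j - w i j = 0
    simp only [w, Matrix.of_apply, if_pos hij, sub_self]
  have hfix : (conjTensor D τ).toRingHom.mapMatrix ((u⁻¹).val * w * u.val) =
      (u⁻¹).val * w * u.val := by
    rw [map_mul, map_mul, hu, u0_conj hτ, u0_inv_conj hτ, hw]
    ext i j
    simp only [Matrix.mul_apply, Matrix.submatrix_apply, id]
    rw [← Equiv.sum_comp Fin.revPerm]
    refine Finset.sum_congr rfl fun k _ => ?_
    rw [← Equiv.sum_comp Fin.revPerm]
    simp
  have hy : ∀ i j, ∃ x : D, ((u⁻¹).val * w * u.val) i j = x ⊗ₜ[F] (1 : E) := fun i j =>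
    exists_of_conjTensor_eq h2 hE hlam hτ (congrFun (congrFun hfix i) j)
  choose y hy using hy
  refine ⟨z' - w, hx, Matrix.of y, ?_⟩
  have h3 : includeMatrix F E D (2 * r) (Matrix.of y) = (u⁻¹).val * w * u.val := by
    ext i j
    exact (hy i j).symm
  rw [h3, sub_mul, ← mul_assoc, ← mul_assoc, Units.mul_inv, one_mul, sub_add_cancel, mul_assoc,
    Units.inv_mul, mul_one]

theorem middle_index_rev {r : ℕ} (i j : Fin (2 * r)) :
    (if (i : ℕ) < r then (i : ℕ) else (i : ℕ) - 1) < (if (j : ℕ) < r then (j : ℕ) else (j : ℕ) - 1)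
    ↔ (if (j.rev : ℕ) < r then (j.rev : ℕ) else (j.rev : ℕ) - 1) <
      (if (i.rev : ℕ) < r then (i.rev : ℕ) else (i.rev : ℕ) - 1) := by
  simp only [Fin.val_rev]
  have := i.2
  have := j.2
  constructor <;> intro h <;> split_ifs at h ⊢ <;> omega

/-- `P u₀ J` is open for every open subgroup `J` of `H`. -/
theorem isOpen_middleParabolic_mul (h2 : (2 : F) ≠ 0) (hE : Module.finrank F E = 2)
    (hlam : lam ∉ Set.range (algebraMap F E)) (hτ : τ lam = -lam) {r : ℕ}
    (J : Subgroup (GLn (2 * r) D)) (hJ : IsOpen (J : Set (GLn (2 * r) D))) :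
    IsOpen {g : GLn (2 * r) (D ⊗[F] E) | ∃ p ∈ middleParabolic (D ⊗[F] E) r, ∃ h ∈ J,
      g = p * u0 F E D (2 * r) lam h0 * embH F E D (2 * r) h} := by
  have := IsModuleTopology.isTopologicalRing F (D ⊗[F] E)
  set u := u0 F E D (2 * r) lam h0 with hu
  set U := {g : GLn (2 * r) (D ⊗[F] E) | ∃ p ∈ middleParabolic (D ⊗[F] E) r, ∃ h ∈ J,
      g = p * u * embH F E D (2 * r) h} with hU
  let b : Fin (2 * r) → ℕ := fun i => if (i : ℕ) < r then (i : ℕ) else (i : ℕ) - 1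
  have hnhds : U ∈ 𝓝 u := by
    have h3 := doubleCoset_mem_nhds (F := F)
      (blockTriangularSubalgebra (F := F) (D ⊗[F] E) b) (includeMatrix F E D (2 * r)) u
      (exists_lie_decomposition h2 hE hlam hτ middle_index_rev) (J : Set (GLn (2 * r) D))
      (hJ.mem_nhds J.one_mem)
    refine Filter.mem_of_superset h3 ?_
    rintro g ⟨p, hp, j, hj, hg⟩
    exact ⟨p, ⟨hp, inv_mem_subalgebra _ hp⟩, j, hj, Units.ext hg⟩
  rw [isOpen_iff_mem_nhds]
  rintro _ ⟨p, hp, j, hj, rfl⟩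
  have hc : Continuous fun g : GLn (2 * r) (D ⊗[F] E) =>
      p⁻¹ * g * (embH F E D (2 * r) j)⁻¹ := by fun_prop
  have hpt : p⁻¹ * (p * u * embH F E D (2 * r) j) * (embH F E D (2 * r) j)⁻¹ = u := by group
  have h4 : (fun g : GLn (2 * r) (D ⊗[F] E) => p⁻¹ * g * (embH F E D (2 * r) j)⁻¹) ⁻¹' U ∈
      𝓝 (p * u * embH F E D (2 * r) j) :=
    hc.continuousAt.preimage_mem_nhds (by rw [hpt]; exact hnhds)
  refine Filter.mem_of_superset h4 ?_
  rintro g ⟨p', hp', j', hj', hg⟩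
  refine ⟨p * p', (middleParabolic _ r).mul_mem hp hp', j' * j, J.mul_mem hj' hj, ?_⟩
  rw [map_mul]
  replace hg : p⁻¹ * g * (embH F E D (2 * r) j)⁻¹ = p' * u * embH F E D (2 * r) j' := hg
  calc g = p * (p⁻¹ * g * (embH F E D (2 * r) j)⁻¹) * embH F E D (2 * r) j := by group
    _ = _ := by rw [hg]; group

/-- Indicator functions of `P C` for `C` compact and `P C` open are smooth and compactly supported
modulo `P`. -/
theorem memInd_indicator {G : Type*} [Group G] [TopologicalSpace G] [IsTopologicalGroup G]
    (P : Subgroup G) (C : Set G) (hC : IsCompact C) (U : Set G) (hU : IsOpen U)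
    (hUC : ∀ g, g ∈ U ↔ ∃ p ∈ P, ∃ c ∈ C, g = p * c) (a : ℂ) :
    MemInd P (fun _ => 1) (U.indicator fun _ => a) := by
  have hP : ∀ p ∈ P, ∀ g, p * g ∈ U ↔ g ∈ U := by
    intro p hp g
    rw [hUC, hUC]
    constructor
    · rintro ⟨p', hp', c, hc, h⟩
      exact ⟨p⁻¹ * p', P.mul_mem (P.inv_mem hp) hp', c, hc, by
        rw [mul_assoc, ← h, inv_mul_cancel_left]⟩
    · rintro ⟨p', hp', c, hc, rfl⟩
      exact ⟨p * p', P.mul_mem hp hp', c, hc, by rw [mul_assoc]⟩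
  refine ⟨?_, ?_, ?_⟩
  · intro p hp g
    rw [one_mul]
    by_cases hg : g ∈ U
    · rw [Set.indicator_of_mem hg, Set.indicator_of_mem ((hP p hp g).2 hg)]
    · rw [Set.indicator_of_notMem hg, Set.indicator_of_notMem fun h => hg ((hP p hp g).1 h)]
  · let W : Subgroup G :=
      { carrier := {k | ∀ g, g * k ∈ U ↔ g ∈ U}
        mul_mem' := by
          intro x y hx hy g
          rw [← mul_assoc, hy, hx]
        one_mem' := fun g => by rw [mul_one]
        inv_mem' := by
          intro x hx g
          rw [← hx (g * x⁻¹), inv_mul_cancel_right] }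
    have hCU : C ⊆ U := fun c hc => (hUC c).2 ⟨1, P.one_mem, c, hc, (one_mul c).symm⟩
    -- Compactness of `C` gives a neighbourhood `V` of 1 with `C V ⊆ U`. Left invariance of `U`
    -- under `P` spreads this to `U V ⊆ U`.
    obtain ⟨V, hV, hCV⟩ := compact_open_separated_mul_right hC hU hCU
    have hVW : V ∩ V⁻¹ ⊆ W := by
      have key : ∀ v ∈ V, ∀ g ∈ U, g * v ∈ U := by
        intro v hv g hg
        obtain ⟨p, hp, c, hc, rfl⟩ := (hUC g).1 hg
        rw [mul_assoc, hP p hp]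
        exact hCV (Set.mul_mem_mul hc hv)
      rintro k ⟨hk, hk'⟩ g
      refine ⟨fun h => ?_, key k hk g⟩
      have := key k⁻¹ hk' _ h
      rwa [mul_inv_cancel_right] at this
    have hW : (W : Set G) ∈ 𝓝 1 :=
      Filter.mem_of_superset (Filter.inter_mem hV (inv_mem_nhds_one G hV)) hVW
    refine ⟨W, W.isOpen_of_mem_nhds hW, ?_⟩
    intro g k hk
    by_cases hg : g ∈ U
    · rw [Set.indicator_of_mem hg, Set.indicator_of_mem ((hk g).2 hg)]
    · rw [Set.indicator_of_notMem hg, Set.indicator_of_notMem fun h => hg ((hk g).1 h)]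
  · exact ⟨C, hC, fun g hg => (hUC g).1 (Set.mem_of_indicator_ne_zero hg)⟩

end Concrete

end LocalPeriod

namespace LocalPeriod

open Topology Filter

/-! ### Orbit volumes and indices in stabilisers. -/

section IndexMeasure

open scoped Pointwise

variable {G X : Type*} [Group G] [MulAction G X] [MeasurableSpace X] [MeasurableConstSMul G X]

/-- Volumes of orbits of two subgroups `J ≤ J'` of finite index. -/
theorem measure_orbit_mul_relIndex (μ : Measure X) [SMulInvariantMeasure G X μ] (x₀ : X)
    {J J' : Subgroup G} (hJJ' : J ≤ J') (hfin : J.relIndex J' ≠ 0)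
    (hJ : MeasurableSet ((fun g : G => g • x₀) '' J))
    (hJ' : MeasurableSet ((fun g : G => g • x₀) '' J')) :
    μ ((fun g : G => g • x₀) '' J') *
        (J.relIndex (MulAction.stabilizer G x₀ ⊓ J') : ENNReal) =
      J.relIndex J' * μ ((fun g : G => g • x₀) '' J) := by
  classical
  set S := MulAction.stabilizer G x₀ with hS
  have hft : Finite (J' ⧸ J.subgroupOf J') := by
    refine Nat.finite_of_card_ne_zero ?_
    exact hfin
  have : Fintype (J' ⧸ J.subgroupOf J') := Fintype.ofFinite _
  let A : (J' ⧸ J.subgroupOf J') → Set X := fun c =>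
    ((c.out : J') : G) • ((fun g : G => g • x₀) '' J)
  have hA : ∀ c, MeasurableSet (A c) := fun c => hJ.const_smul _
  have hμA : ∀ c, μ (A c) = μ ((fun g : G => g • x₀) '' J) := fun c => measure_smul _ _ _
  have hmem : ∀ (c : J' ⧸ J.subgroupOf J') (j : J'), (j : G) • x₀ ∈ A c ↔
      ∃ s : (S ⊓ J' : Subgroup G), c = QuotientGroup.mk (j * ⟨s, s.2.2⟩) := by
    intro c j
    rw [Set.mem_smul_set]
    constructor
    · rintro ⟨_, ⟨g, hg, rfl⟩, h⟩
      have hs : (j : G)⁻¹ * ((c.out : J') * g) ∈ S := by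
        rw [hS, MulAction.mem_stabilizer_iff, mul_smul, mul_smul]
        dsimp only at h
        rw [h, inv_smul_smul]
      have hs' : (j : G)⁻¹ * ((c.out : J') * g) ∈ J' :=
        J'.mul_mem (J'.inv_mem j.2) (J'.mul_mem c.out.2 (hJJ' hg))
      refine ⟨⟨_, hs, hs'⟩, ?_⟩
      conv_lhs => rw [← QuotientGroup.out_eq' c]
      rw [QuotientGroup.eq, Subgroup.mem_subgroupOf]
      simpa using hg
    · rintro ⟨s, rfl⟩
      set c : J' ⧸ J.subgroupOf J' := QuotientGroup.mk (j * ⟨s, s.2.2⟩) with hc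
      have h1 : (QuotientGroup.mk c.out : J' ⧸ J.subgroupOf J') =
        QuotientGroup.mk (j * ⟨s, s.2.2⟩) := QuotientGroup.out_eq' c
      rw [QuotientGroup.eq, Subgroup.mem_subgroupOf] at h1
      refine ⟨_, ⟨_, h1, rfl⟩, ?_⟩
      have hs : (s : G) • x₀ = x₀ := s.2.1
      simp only [Subgroup.coe_mul, Subgroup.coe_inv, smul_smul]
      rw [mul_inv_cancel_left, mul_smul, hs]
  -- The translates of `J x₀` by representatives of `J' / J` cover each point of `J' x₀` equally
  -- often: the cosets whose translate meets a given point are parametrised by `S ∩ J'` modulo `J`.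
  have hcount : ∀ y ∈ (fun g : G => g • x₀) '' J', (∑ c, (A c).indicator (fun _ => (1 : ENNReal)) y)
      = (J.relIndex (S ⊓ J') : ENNReal) := by
    rintro _ ⟨j, hj, rfl⟩
    simp only [Set.indicator_apply]
    rw [Finset.sum_boole]
    congr 1
    let φ : ((S ⊓ J' : Subgroup G) ⧸ J.subgroupOf (S ⊓ J')) → (J' ⧸ J.subgroupOf J') :=
      Quotient.lift (fun s : (S ⊓ J' : Subgroup G) =>
        (QuotientGroup.mk ((⟨j, hj⟩ : J') * ⟨s, s.2.2⟩) : J' ⧸ J.subgroupOf J')) (by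
        intro a b hab
        rw [QuotientGroup.eq, Subgroup.mem_subgroupOf]
        have := QuotientGroup.leftRel_apply.1 hab
        rw [Subgroup.mem_subgroupOf] at this
        simpa [mul_assoc] using this)
    have hφ : Function.Injective φ := by
      rintro ⟨a⟩ ⟨b⟩ hab
      have h1 : (QuotientGroup.mk ((⟨j, hj⟩ : J') * ⟨a, a.2.2⟩) : J' ⧸ J.subgroupOf J') =
        QuotientGroup.mk ((⟨j, hj⟩ : J') * ⟨b, b.2.2⟩) := hab
      rw [QuotientGroup.eq, Subgroup.mem_subgroupOf] at h1
      refine Quotient.sound (QuotientGroup.leftRel_apply.2 ?_)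
      rw [Subgroup.mem_subgroupOf]
      simpa [mul_assoc] using h1
    have hr : Set.range φ = {c | j • x₀ ∈ A c} := by
      ext c
      constructor
      · rintro ⟨⟨s⟩, rfl⟩
        exact (hmem _ ⟨j, hj⟩).2 ⟨s, rfl⟩
      · intro hc
        obtain ⟨s, hs⟩ := (hmem c ⟨j, hj⟩).1 hc
        exact ⟨QuotientGroup.mk s, hs.symm⟩
    have h2 : Nat.card (Set.range φ) = J.relIndex (S ⊓ J') := by
      rw [Nat.card_range_of_injective hφ]; rfl
    rw [← h2, hr, Nat.card_eq_fintype_card, Fintype.card_subtype]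
    rfl
  have hsub : ∀ c, A c ⊆ (fun g : G => g • x₀) '' J' := by
    rintro c _ ⟨_, ⟨g, hg, rfl⟩, rfl⟩
    exact ⟨(c.out : J') * g, J'.mul_mem c.out.2 (hJJ' hg), mul_smul _ _ _⟩
  have h1 : ∑ c, μ (A c) = ∫⁻ y, ((fun g : G => g • x₀) '' J').indicator
      (fun _ => (J.relIndex (S ⊓ J') : ENNReal)) y ∂μ := by
    have : ∀ c, μ (A c) = ∫⁻ y, (A c).indicator (fun _ => (1 : ENNReal)) y ∂μ := fun c => by
      rw [lintegral_indicator_const (hA c), one_mul]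
    simp only [this]
    rw [← lintegral_finsetSum _ fun c _ => measurable_const.indicator (hA c)]
    refine lintegral_congr fun y => ?_
    by_cases hy : y ∈ (fun g : G => g • x₀) '' J'
    · rw [Set.indicator_of_mem hy, hcount y hy]
    · rw [Set.indicator_of_notMem hy]
      exact Finset.sum_eq_zero fun c _ => Set.indicator_of_notMem (fun h => hy (hsub c h)) _
  rw [lintegral_indicator_const hJ'] at h1
  rw [mul_comm, ← h1]
  simp only [hμA, Finset.sum_const, nsmul_eq_mul, Finset.card_univ]
  congr 2
  rw [← Nat.card_eq_fintype_card]
  rfl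

end IndexMeasure

end LocalPeriod

namespace LocalPeriod

open Topology Filter

/-! ### Triviality of the modular character on the elements needed. -/

section Unimodular

open scoped Pointwise

variable {G : Type*} [Group G] [TopologicalSpace G] [IsTopologicalGroup G] [LocallyCompactSpace G]

theorem measure_mul_right_eq_modularCharacter [MeasurableSpace G] [BorelSpace G] (ν : Measure G)
    [ν.IsHaarMeasure] (g : G) (U : Set G) (hU : IsOpen U) :
    ν ((· * g) ⁻¹' U) = Measure.modularCharacterFun g * ν U := by
  have h := Measure.measure_isHaarMeasure_eq_smul_of_isOpen (ν.map (· * g)) ν hU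
  rw [Measure.map_apply (measurable_mul_const g) hU.measurableSet,
    ← Measure.modularCharacterFun_eq_haarScalarFactor ν g] at h
  exact h

/-- Right translation by `k` preserves `K`, whose Haar measure is positive and finite. -/
theorem modularCharacterFun_eq_one_of_mem {K : Subgroup G} (hKo : IsOpen (K : Set G))
    (hKc : IsCompact (K : Set G)) {k : G} (hk : k ∈ K) : Measure.modularCharacterFun k = 1 := by
  borelize G
  have h := measure_mul_right_eq_modularCharacter (Measure.haar : Measure G) k K hKo
  have h1 : (· * k) ⁻¹' (K : Set G) = K := by
    ext x
    exact K.mul_mem_cancel_right hk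
  rw [h1] at h
  have hpos : (Measure.haar : Measure G) K ≠ 0 :=
    (hKo.measure_pos _ ⟨1, K.one_mem⟩).ne'
  have hfin : (Measure.haar : Measure G) K ≠ ⊤ := hKc.measure_ne_top
  have h2 : (1 : ENNReal) = Measure.modularCharacterFun k := by
    rwa [← ENNReal.mul_left_inj hpos hfin, one_mul]
  exact_mod_cast h2.symm

theorem modularCharacterFun_eq_one_of_central {g : G} (hg : ∀ x, x * g = g * x) :
    Measure.modularCharacterFun g = 1 := by
  borelize G
  rw [Measure.modularCharacterFun_eq_haarScalarFactor (Measure.haar : Measure G) g]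
  have h1 : Measure.map (fun x : G => x * g) (Measure.haar : Measure G) = Measure.haar := by
    rw [show (fun x : G => x * g) = fun x => g * x from funext hg]
    exact map_mul_left_eq_self _ g
  have h2 : ∀ (ν : Measure G) [ν.IsHaarMeasure], ν = Measure.haar →
      Measure.haarScalarFactor ν Measure.haar = 1 := by
    rintro _ _ rfl
    exact Measure.haarScalarFactor_self _
  exact h2 _ h1

/-- For a unimodular element the indices of a compact open subgroup and its conjugate in each other
agree. -/
theorem relIndex_conj_eq {K : Subgroup G} (hKo : IsOpen (K : Set G)) (hKc : IsCompact (K : Set G))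
    {g : G} (hg : Measure.modularCharacterFun g = 1) :
    K.relIndex (K.map (MulAut.conj g).toMonoidHom) =
      (K.map (MulAut.conj g).toMonoidHom).relIndex K ∧
    K.relIndex (K.map (MulAut.conj g).toMonoidHom) ≠ 0 := by
  borelize G
  set K' := K.map (MulAut.conj g).toMonoidHom with hK'
  have hmem : ∀ x, x ∈ K' ↔ g⁻¹ * x * g ∈ K := by
    intro x
    constructor
    · rintro ⟨k, hk, rfl⟩
      change g⁻¹ * (g * k * g⁻¹) * g ∈ K
      have : g⁻¹ * (g * k * g⁻¹) * g = k := by group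
      rw [this]
      exact hk
    · intro h
      refine ⟨_, h, ?_⟩
      change g * (g⁻¹ * x * g) * g⁻¹ = x
      group
  have hK'o : IsOpen (K' : Set G) := by
    have hc : Continuous fun x : G => g⁻¹ * x * g := by fun_prop
    have : (K' : Set G) = (fun x : G => g⁻¹ * x * g) ⁻¹' K := by
      ext x; exact hmem x
    rw [this]
    exact hKo.preimage hc
  have hK'c : IsCompact (K' : Set G) := by
    have hc : Continuous fun x : G => g * x * g⁻¹ := by fun_prop
    exact hKc.image hc
  have hfin : ∀ A C : Subgroup G, IsOpen (A : Set G) → IsCompact (C : Set G) → A.relIndex C ≠ 0 :=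
      by
    intro A C hA hC
    have : CompactSpace C := isCompact_iff_compactSpace.1 hC
    have h1 : IsOpen ((A.subgroupOf C : Subgroup C) : Set C) := hA.preimage continuous_subtype_val
    have := Subgroup.quotient_finite_of_isOpen _ h1
    exact Subgroup.index_ne_zero_of_finite
  have hKK' := hfin K K' hKo hK'c
  have hK'K := hfin K' K hK'o hKc
  refine ⟨?_, hKK'⟩
  set ν : Measure G := Measure.haar
  have himg : ∀ A : Subgroup G, (fun x : G => x • (1 : G)) '' A = A := by
    intro A
    ext x
    simp
  have hstab : MulAction.stabilizer G (1 : G) = ⊥ := by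
    ext x
    rw [MulAction.mem_stabilizer_iff, Subgroup.mem_bot]
    simp
  have key : ∀ J' J : Subgroup G, IsOpen (J : Set G) → IsOpen (J' : Set G) → J ≤ J' →
      J.relIndex J' ≠ 0 → ν J' = J.relIndex J' * ν J := by
    intro J' J hJ hJ' hle hne
    have := measure_orbit_mul_relIndex ν (1 : G) hle hne
      (by rw [himg]; exact hJ.measurableSet) (by rw [himg]; exact hJ'.measurableSet)
    rw [himg, himg, hstab, bot_inf_eq, Subgroup.relIndex_bot_right, Nat.cast_one, mul_one] at this
    exact this
  have hIo : IsOpen ((K ⊓ K' : Subgroup G) : Set G) := hKo.inter hK'o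
  have h1 := key K (K ⊓ K') hIo hKo inf_le_left (by rwa [Subgroup.inf_relIndex_left])
  have h2 := key K' (K ⊓ K') hIo hK'o inf_le_right (by rwa [Subgroup.inf_relIndex_right])
  rw [Subgroup.inf_relIndex_left] at h1
  rw [Subgroup.inf_relIndex_right] at h2
  -- `K' = g K g⁻¹` is obtained from `K` by a left translation and a right translation; the latter
  -- preserves volume by `hg`.
  have h3 : ν K' = ν K := by
    have h4 := measure_mul_right_eq_modularCharacter ν g K hKo
    rw [hg, ENNReal.coe_one, one_mul] at h4
    rw [← h4]
    have : (K' : Set G) = (fun x => g⁻¹ * x) ⁻¹' ((· * g) ⁻¹' K) := by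
      ext x; exact hmem x
    rw [this, measure_preimage_mul]
  rw [h3, h1] at h2
  have hpos : ν (K ⊓ K' : Subgroup G) ≠ 0 := (hIo.measure_pos _ ⟨1, (K ⊓ K').one_mem⟩).ne'
  have hft : ν (K ⊓ K' : Subgroup G) ≠ ⊤ :=
    ((measure_mono fun x hx => hx.1).trans_lt hKc.measure_lt_top).ne
  rw [ENNReal.mul_left_inj hpos hft] at h2
  exact_mod_cast h2.symm

end Unimodular

section MatrixCharacters

variable {D : Type*} [DivisionRing D]

/-- Diagonal matrices. -/
def diagGL (m : ℕ) (D : Type*) [Ring D] : (Fin m → Dˣ) →* GLn m D :=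
  (Units.map (Matrix.diagonalRingHom (Fin m) D).toMonoidHom).comp MulEquiv.piUnits.symm.toMonoidHom

theorem diagGL_val {m : ℕ} (v : Fin m → Dˣ) :
    (diagGL m D v).val = Matrix.diagonal fun i => (v i : D) := rfl

theorem diagGL_inv_val {m : ℕ} (v : Fin m → Dˣ) :
    ((diagGL m D v)⁻¹).val = Matrix.diagonal fun i => (((v i)⁻¹ : Dˣ) : D) := rfl

/-- Permutation matrices. -/
def permGL {m : ℕ} (D : Type*) [Ring D] (σ : Equiv.Perm (Fin m)) : GLn m D where
  val := (1 : Matrix (Fin m) (Fin m) D).submatrix σ id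
  inv := (1 : Matrix (Fin m) (Fin m) D).submatrix id σ
  val_inv := by
    rw [← Matrix.submatrix_mul _ _ σ id σ Function.bijective_id, one_mul]
    exact Matrix.submatrix_one_equiv σ
  inv_val := by
    rw [← Matrix.submatrix_mul _ _ id σ id σ.bijective, one_mul, Matrix.submatrix_id_id]

theorem permGL_mul_diagGL {m : ℕ} (σ : Equiv.Perm (Fin m)) (v : Fin m → Dˣ) :
    permGL D σ * diagGL m D v = diagGL m D (v ∘ σ) * permGL D σ := by
  apply Units.ext
  rw [Units.val_mul, Units.val_mul, diagGL_val, diagGL_val]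
  ext i j
  rw [Matrix.mul_diagonal, Matrix.diagonal_mul]
  simp only [permGL, Matrix.submatrix_apply, id, Matrix.one_apply, Function.comp]
  split_ifs with h
  · rw [h, one_mul, mul_one]
  · rw [zero_mul, mul_zero]

theorem char_diagGL_mulSingle_eq {m : ℕ} {H : Type*} [CommGroup H] (χ : GLn m D →* H) (c : Dˣ)
    (i j : Fin m) :
    χ (diagGL m D (Pi.mulSingle i c)) = χ (diagGL m D (Pi.mulSingle j c)) := by
  have h := congrArg χ (permGL_mul_diagGL (Equiv.swap i j) (Pi.mulSingle i c))
  rw [map_mul, map_mul, mul_comm, mul_left_inj] at h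
  rw [h]
  congr 2
  ext k
  rw [Function.comp, Pi.mulSingle_apply, Pi.mulSingle_apply]
  simp only [Equiv.swap_apply_eq_iff, Equiv.swap_apply_left]

theorem char_diagGL_const {m : ℕ} {H : Type*} [CommGroup H] (χ : GLn m D →* H) (c : Dˣ)
    (i : Fin m) :
    χ (diagGL m D fun _ => c) = χ (diagGL m D (Pi.mulSingle i c)) ^ m := by
  classical
  have key : ∀ s : Finset (Fin m), χ (diagGL m D fun k => if k ∈ s then c else 1) =
      χ (diagGL m D (Pi.mulSingle i c)) ^ s.card := by
    intro s
    induction s using Finset.induction_on with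
    | empty =>
      have : (fun k : Fin m => if k ∈ (∅ : Finset (Fin m)) then c else 1) = 1 := by
        funext k
        simp
      rw [this, map_one, map_one, Finset.card_empty, pow_zero]
    | insert a s ha ih =>
      have : (fun k : Fin m => if k ∈ insert a s then c else 1) =
          Pi.mulSingle a c * fun k => if k ∈ s then c else 1 := by
        funext k
        rw [Pi.mul_apply, Pi.mulSingle_apply]
        by_cases hk : k = a
        · subst hk
          simp [ha]
        · simp [hk]
      rw [this, map_mul, map_mul, ih, Finset.card_insert_of_notMem ha, pow_succ',
        char_diagGL_mulSingle_eq χ c a i]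
  have := key Finset.univ
  simpa using this

/-- The unipotent matrix `(1, x; 0, 1)`. -/
def unipGL (x : D) : GLn 2 D where
  val := !![1, x; 0, 1]
  inv := !![1, -x; 0, 1]
  val_inv := by ext i j; fin_cases i <;> fin_cases j <;> simp
  inv_val := by ext i j; fin_cases i <;> fin_cases j <;> simp

theorem unipGL_add (x y : D) : unipGL (x + y) = unipGL x * unipGL y := by
  apply Units.ext
  rw [Units.val_mul]
  change !![1, x + y; 0, 1] = !![1, x; 0, 1] * !![1, y; 0, 1]
  ext i j; fin_cases i <;> fin_cases j <;> simp [add_comm]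

/-- Conjugation by `diag(2, 1)` sends the unipotent element to its square, so its image in a
commutative group equals its own square. -/
theorem char_unipGL {H : Type*} [CommGroup H] (χ : GLn 2 D →* H) (h2 : (2 : D) ≠ 0) (x : D) :
    χ (unipGL x) = 1 := by
  have h : diagGL 2 D (Pi.mulSingle 0 (Units.mk0 2 h2)) * unipGL x =
      unipGL x * unipGL x * diagGL 2 D (Pi.mulSingle 0 (Units.mk0 2 h2)) := by
    apply Units.ext
    rw [Units.val_mul, Units.val_mul, ← unipGL_add, diagGL_val]
    change _ * !![1, x; 0, 1] = !![1, x + x; 0, 1] * _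
    ext i j; fin_cases i <;> fin_cases j <;> simp [two_mul]
  have h1 := congrArg χ h
  rw [map_mul, map_mul, map_mul, mul_comm, mul_left_inj] at h1
  exact left_eq_mul.1 h1

/-- `(1, b; 0, c)` -/
def affineGL (b : D) (c : Dˣ) : GLn 2 D := diagGL 2 D (Pi.mulSingle 1 c) * unipGL b

theorem affineGL_val (b : D) (c : Dˣ) : (affineGL b c).val = !![1, b; 0, (c : D)] := by
  rw [affineGL, Units.val_mul, diagGL_val]
  change _ * !![1, b; 0, 1] = _
  ext i j; fin_cases i <;> fin_cases j <;> simp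

end MatrixCharacters

section DivisionAlgebra

variable {F : Type*} [NontriviallyNormedField F] [IsUltrametricDist F] [LocallyCompactSpace F]
variable {D : Type*} [DivisionRing D] [Algebra F D] [FiniteDimensional F D]
  [TopologicalSpace D] [IsModuleTopology F D]

theorem diagGL_mem_integral {m : ℕ} {v : Fin m → Dˣ} (h : ∀ i, modAbs F (v i : D) = 1) :
    diagGL m D v ∈ integralSubgroup F D m := by
  intro i j
  rw [diagGL_val, diagGL_inv_val, Matrix.diagonal_apply, Matrix.diagonal_apply]
  split_ifs
  · rw [modAbs_units_inv, h i, inv_one]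
    exact ⟨le_rfl, le_rfl⟩
  · rw [modAbs_zero]
    exact ⟨zero_le_one, zero_le_one⟩

theorem modAbs_units_zpow (u : Dˣ) (k : ℤ) :
    modAbs F ((u ^ k : Dˣ) : D) = modAbs F (u : D) ^ k := by
  obtain ⟨n, rfl | rfl⟩ := k.eq_nat_or_neg
  · rw [zpow_natCast, zpow_natCast, Units.val_pow_eq_pow_val, modAbs_pow]
  · rw [zpow_neg, zpow_neg, modAbs_units_inv, zpow_natCast, zpow_natCast,
      Units.val_pow_eq_pow_val, modAbs_pow]

/-- If `|c| = q ^ k`, then `c ^ dim D` has the absolute value of the scalar `ϖ ^ (-k)`. Up to a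
power, `c` is therefore central times integral, which replaces any use of a determinant. -/
theorem exists_pow_eq_scalar_mul (hF : NormIsNormalised F) (c : Dˣ) :
    ∃ (a : Fˣ) (v : Dˣ), modAbs F (v : D) = 1 ∧
      c ^ Module.finrank F D = Units.map (algebraMap F D).toMonoidHom a * v := by
  obtain ⟨ϖ, -, hn, h0⟩ := exists_uniformiser hF
  obtain ⟨k, hk⟩ := exists_modAbs_eq_zpow F D hF c.ne_zero
  let a : Fˣ := (Units.mk0 (ϖ : F) h0) ^ (-k)
  refine ⟨a, (Units.map (algebraMap F D).toMonoidHom a)⁻¹ * c ^ Module.finrank F D, ?_, by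
    rw [mul_inv_cancel_left]⟩
  have ha : modAbs F ((Units.map (algebraMap F D).toMonoidHom a : Dˣ) : D) =
      ((residueCard F : ℝ) ^ k) ^ Module.finrank F D := by
    change modAbs F (algebraMap F D (a : F)) = _
    rw [modAbs_algebraMap]
    congr 1
    change ‖(((Units.mk0 (ϖ : F) h0) ^ (-k) : Fˣ) : F)‖ = _
    rw [Units.val_zpow_eq_zpow_val, norm_zpow, Units.val_mk0, hn, inv_zpow', neg_neg]
  have hq : (0 : ℝ) < residueCard F := by
    have := two_le_residueCard (F := F)
    positivity
  rw [Units.val_mul, modAbs_mul, modAbs_units_inv, ha, Units.val_pow_eq_pow_val, modAbs_pow, hk]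
  exact inv_mul_cancel₀ (by positivity)

theorem locallyCompactSpace_of_moduleTopology {V : Type*} [AddCommGroup V] [Module F V]
    [FiniteDimensional F V] [TopologicalSpace V] [IsModuleTopology F V] :
    LocallyCompactSpace V := by
  have := (coordHomeo F V).toHomeomorph.isClosedEmbedding
  exact this.locallyCompactSpace

theorem isTopologicalGroup_GLn (F : Type*) {D : Type*} [NontriviallyNormedField F]
    [DivisionRing D] [Algebra F D] [FiniteDimensional F D] [TopologicalSpace D]
    [IsModuleTopology F D] (m : ℕ) : IsTopologicalGroup (GLn m D) := by
  have := IsModuleTopology.isTopologicalRing F D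
  infer_instance

theorem locallyCompactSpace_GLn (F : Type*) {D : Type*} [NontriviallyNormedField F]
    [IsUltrametricDist F]
    [LocallyCompactSpace F] [DivisionRing D] [Algebra F D] [FiniteDimensional F D]
    [TopologicalSpace D] [IsModuleTopology F D] (m : ℕ) : LocallyCompactSpace (GLn m D) := by
  have := IsModuleTopology.isTopologicalRing F D
  have : T2Space D := t2Space_of_moduleTopology F
  have : LocallyCompactSpace (Matrix (Fin m) (Fin m) D) :=
    locallyCompactSpace_of_moduleTopology (F := F)
  infer_instance

theorem diagGL_scalar_central {m : ℕ} (a : Fˣ) (x : GLn m D) :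
    x * diagGL m D (fun _ => Units.map (algebraMap F D).toMonoidHom a) =
      diagGL m D (fun _ => Units.map (algebraMap F D).toMonoidHom a) * x := by
  apply Units.ext
  rw [Units.val_mul, Units.val_mul, diagGL_val]
  ext i j
  rw [Matrix.mul_diagonal, Matrix.diagonal_mul]
  exact (Algebra.commutes (a : F) _).symm

/-- A character of `GL(m, D)` trivial on `GL(m, O_D)` and on the central scalars is trivial on
diagonal matrices with one nontrivial entry. -/
theorem char_diagGL_mulSingle (hF : NormIsNormalised F) {m : ℕ} (χ : GLn m D →* NNReal)
    (hK : ∀ k ∈ integralSubgroup F D m, χ k = 1)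
    (hZ : ∀ g, (∀ x, x * g = g * x) → χ g = 1) (i : Fin m) (c : Dˣ) :
    χ (diagGL m D (Pi.mulSingle i c)) = 1 := by
  let χ' : GLn m D →* NNRealˣ := χ.toHomUnits
  have hχ' : ∀ g, ((χ' g : NNRealˣ) : NNReal) = χ g := fun _ => rfl
  obtain ⟨a, v, hv, hc⟩ := exists_pow_eq_scalar_mul hF c
  have h1 : χ' (diagGL m D fun _ => c) ^ Module.finrank F D = 1 := by
    rw [← map_pow, ← map_pow]
    have : (fun _ : Fin m => c) ^ Module.finrank F D =
        (fun _ : Fin m => Units.map (algebraMap F D).toMonoidHom a) * fun _ => v := by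
      funext k
      exact hc
    rw [this, map_mul, map_mul]
    have e1 : χ' (diagGL m D fun _ => Units.map (algebraMap F D).toMonoidHom a) = 1 :=
      Units.ext (hZ _ (diagGL_scalar_central a))
    have e2 : χ' (diagGL m D fun _ => v) = 1 :=
      Units.ext (hK _ (diagGL_mem_integral fun _ => hv))
    rw [e1, e2, one_mul]
  rw [char_diagGL_const χ' c i, ← pow_mul] at h1
  have h2 : χ (diagGL m D (Pi.mulSingle i c)) ^ (m * Module.finrank F D) = 1 :=
    congrArg Units.val h1
  have hm : 0 < m := i.pos
  exact (pow_eq_one_iff_of_nonneg zero_le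
    (mul_pos hm (Module.finrank_pos (R := F) (M := D))).ne').1 h2

variable (F) in
/-- The modular character of `GL(m, D)` is trivial on diagonal matrices with one entry. -/
theorem modularCharacterFun_diagGL (hF : NormIsNormalised F) {m : ℕ}
    [IsTopologicalGroup (GLn m D)] [LocallyCompactSpace (GLn m D)] (i : Fin m) (c : Dˣ) :
    Measure.modularCharacterFun (diagGL m D (Pi.mulSingle i c)) = 1 :=
  char_diagGL_mulSingle hF (Measure.modularCharacter (G := GLn m D))
    (fun _ hk => modularCharacterFun_eq_one_of_mem (isOpen_integralSubgroup m)
      (isCompact_integralSubgroup m) hk)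
    (fun _ hg => modularCharacterFun_eq_one_of_central hg) i c

/-- The matrices `(1, b; 0, c)` represent all points of the orbit for `m = 2`, so unimodularity is
only needed for them. -/
theorem modularCharacterFun_affineGL (hF : NormIsNormalised F) (h2 : (2 : D) ≠ 0)
    [IsTopologicalGroup (GLn 2 D)] [LocallyCompactSpace (GLn 2 D)] (b : D) (c : Dˣ) :
    Measure.modularCharacterFun (affineGL b c) = 1 := by
  rw [affineGL, Measure.modularCharacterFun_map_mul, modularCharacterFun_diagGL F hF, one_mul]
  have := char_unipGL (Measure.modularCharacter (G := GLn 2 D)).toHomUnits h2 b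
  exact congrArg Units.val this

/-- The embedding of `GL(2)` for the plane `i`. -/
def singlePlane {r : ℕ} (D : Type*) [Ring D] (i : Fin r) : GLn 2 D →* GLn (2 * r) D :=
  (planeGL D r).comp (MonoidHom.mulSingle (fun _ => GLn 2 D) i)

theorem singlePlane_diagGL {r : ℕ} (i : Fin r) (c : Dˣ) :
    singlePlane D i (diagGL 2 D (Pi.mulSingle 1 c)) =
      diagGL (2 * r) D (Pi.mulSingle (planeEquiv r (1, i)) c) := by
  apply Units.ext
  rw [singlePlane, MonoidHom.comp_apply, planeGL_val, diagGL_val]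
  apply matrix_ext_plane
  intro a b k l
  simp only [plane_apply, Matrix.diagonal_apply, (planeEquiv r).injective.eq_iff,
    Pi.mulSingle_apply, Prod.mk.injEq]
  change (if k = l then ((Pi.mulSingle i (diagGL 2 D (Pi.mulSingle 1 c)) :
    Fin r → GLn 2 D) k).val a b else 0) = _
  by_cases hk : k = i
  · subst hk
    rw [Pi.mulSingle_eq_same, diagGL_val, Matrix.diagonal_apply, Pi.mulSingle_apply]
    by_cases hkl : k = l
    · subst hkl
      fin_cases a <;> fin_cases b <;> simp
    · simp [hkl]
  · rw [Pi.mulSingle_eq_of_ne hk, Units.val_one, Matrix.one_apply]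
    by_cases hkl : k = l
    · subst hkl
      simp [hk]
    · simp [hkl]

theorem modularCharacterFun_singlePlane (hF : NormIsNormalised F) (h2 : (2 : D) ≠ 0) {r : ℕ}
    [IsTopologicalGroup (GLn (2 * r) D)] [LocallyCompactSpace (GLn (2 * r) D)] (i : Fin r) (b : D)
    (c : Dˣ) : Measure.modularCharacterFun (singlePlane D i (affineGL b c)) = 1 := by
  rw [affineGL, map_mul, Measure.modularCharacterFun_map_mul, singlePlane_diagGL,
    modularCharacterFun_diagGL F hF, one_mul]
  have := char_unipGL ((Measure.modularCharacter (G := GLn (2 * r) D)).toHomUnits.comp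
    (singlePlane D i)) h2 b
  exact congrArg Units.val this

end DivisionAlgebra

end LocalPeriod

namespace LocalPeriod

open Topology Filter

/-! ### Comparison of orbit volumes for `2r` and for 2. -/

section OrbitVolumes

/-- In the factors other than `i₀` the smaller group imposes no condition, so projection to `i₀`
computes the index. -/
theorem relIndex_pi_eq {ι : Type*} {G : ι → Type*} [∀ i, Group (G i)] (i₀ : ι)
    {A B : ∀ i, Subgroup (G i)} (h : ∀ i, i ≠ i₀ → B i ≤ A i) :
    (Subgroup.pi Set.univ A).relIndex (Subgroup.pi Set.univ B) = (A i₀).relIndex (B i₀) := by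
  classical
  have h1 : Subgroup.pi Set.univ A ⊓ Subgroup.pi Set.univ B =
      (A i₀).comap (Pi.evalMonoidHom G i₀) ⊓ Subgroup.pi Set.univ B := by
    ext x
    simp only [Subgroup.mem_inf, Subgroup.mem_pi, Set.mem_univ, true_imp_iff, Subgroup.mem_comap,
      Pi.evalMonoidHom_apply]
    constructor
    · exact fun h => ⟨h.1 i₀, h.2⟩
    · rintro ⟨h1, h2⟩
      refine ⟨fun i => ?_, h2⟩
      by_cases hi : i = i₀
      · subst hi
        exact h1
      · exact h i hi (h2 i)
  have h2 : (Subgroup.pi Set.univ B).map (Pi.evalMonoidHom G i₀) = B i₀ := by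
    ext y
    constructor
    · rintro ⟨x, hx, rfl⟩
      exact hx i₀ trivial
    · intro hy
      refine ⟨Pi.mulSingle i₀ y, fun i _ => ?_, Pi.mulSingle_eq_same (M := G) i₀ y⟩
      by_cases hi : i = i₀
      · subst hi
        rwa [Pi.mulSingle_eq_same]
      · rw [Pi.mulSingle_eq_of_ne hi]
        exact (B i).one_mem
  rw [← Subgroup.inf_relIndex_right, h1, Subgroup.inf_relIndex_right, Subgroup.relIndex_comap, h2]

open scoped Pointwise

variable {G X : Type*} [Group G] [TopologicalSpace G] [IsTopologicalGroup G]
  [LocallyCompactSpace G] [MulAction G X] [MeasurableSpace X] [MeasurableConstSMul G X]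

theorem isOpen_map_conj {K : Subgroup G} (hK : IsOpen (K : Set G)) (g : G) :
    IsOpen ((K.map (MulAut.conj g).toMonoidHom : Subgroup G) : Set G) := by
  have hc : Continuous fun x : G => g⁻¹ * x * g := by fun_prop
  have : ((K.map (MulAut.conj g).toMonoidHom : Subgroup G) : Set G) =
      (fun x : G => g⁻¹ * x * g) ⁻¹' K := by
    ext x
    constructor
    · rintro ⟨k, hk, rfl⟩
      change g⁻¹ * (g * k * g⁻¹) * g ∈ K
      have : g⁻¹ * (g * k * g⁻¹) * g = k := by group
      rw [this]
      exact hk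
    · intro h
      refine ⟨_, h, ?_⟩
      change g * (g⁻¹ * x * g) * g⁻¹ = x
      group
  rw [this]
  exact hK.preimage hc

/-- The volume of the orbit of a compact open subgroup through a unimodular translate of the base
point, in terms of indices in the stabilizer of the base point. -/
theorem measure_orbit_translate (μ : Measure X) [SMulInvariantMeasure G X μ] (x₀ : X)
    {K : Subgroup G} (hKo : IsOpen (K : Set G)) (hKc : IsCompact (K : Set G))
    (hmeas : ∀ J : Subgroup G, IsOpen (J : Set G) → MeasurableSet ((fun k : G => k • x₀) '' J))
    {g : G} (hg : Measure.modularCharacterFun g = 1) :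
    μ ((fun k : G => k • g⁻¹ • x₀) '' K) *
        K.relIndex (MulAction.stabilizer G x₀ ⊓ K.map (MulAut.conj g).toMonoidHom) =
      μ ((fun k : G => k • x₀) '' K) *
        (K.map (MulAut.conj g).toMonoidHom).relIndex (MulAction.stabilizer G x₀ ⊓ K) ∧
    K.relIndex (MulAction.stabilizer G x₀ ⊓ K.map (MulAut.conj g).toMonoidHom) ≠ 0 ∧
    (K.map (MulAut.conj g).toMonoidHom).relIndex (MulAction.stabilizer G x₀ ⊓ K) ≠ 0 := by
  obtain ⟨he, hne⟩ := relIndex_conj_eq hKo hKc hg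
  have hK'o := isOpen_map_conj hKo g
  set S := MulAction.stabilizer G x₀
  set K' := K.map (MulAut.conj g).toMonoidHom with hK'
  have himg : (fun k : G => k • g⁻¹ • x₀) '' K = g⁻¹ • ((fun k : G => k • x₀) '' K') := by
    ext y
    constructor
    · rintro ⟨k, hk, rfl⟩
      refine ⟨(g * k * g⁻¹) • x₀, ⟨_, ⟨k, hk, rfl⟩, rfl⟩, ?_⟩
      change g⁻¹ • (g * k * g⁻¹) • x₀ = k • g⁻¹ • x₀
      rw [← mul_smul, ← mul_smul]
      congr 1
      group
    · rintro ⟨_, ⟨_, ⟨k, hk, rfl⟩, rfl⟩, rfl⟩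
      refine ⟨k, hk, ?_⟩
      change k • g⁻¹ • x₀ = g⁻¹ • (g * k * g⁻¹) • x₀
      rw [← mul_smul, ← mul_smul]
      congr 1
      group
  have hne' : K'.relIndex K ≠ 0 := he ▸ hne
  have hIo : IsOpen ((K ⊓ K' : Subgroup G) : Set G) := hKo.inter hK'o
  -- The orbit through the translate is a translate of `K' x₀`. Both `K x₀` and `K' x₀` are compared
  -- with the orbit of `K ⊓ K'`, whose indices in `K` and in `K'` agree by unimodularity; only
  -- indices in the stabiliser survive.
  have h1 := measure_orbit_mul_relIndex μ x₀ (inf_le_left : K ⊓ K' ≤ K)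
    (by rwa [Subgroup.inf_relIndex_left]) (hmeas _ hIo) (hmeas _ hKo)
  have h2 := measure_orbit_mul_relIndex μ x₀ (inf_le_right : K ⊓ K' ≤ K')
    (by rwa [Subgroup.inf_relIndex_right]) (hmeas _ hIo) (hmeas _ hK'o)
  have e1 : (K ⊓ K').relIndex (S ⊓ K) = K'.relIndex (S ⊓ K) := by
    rw [← Subgroup.inf_relIndex_right, ← Subgroup.inf_relIndex_right K' (S ⊓ K)]
    congr 1
    ext x
    simp only [Subgroup.mem_inf]
    tauto
  have e2 : (K ⊓ K').relIndex (S ⊓ K') = K.relIndex (S ⊓ K') := by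
    rw [← Subgroup.inf_relIndex_right, ← Subgroup.inf_relIndex_right K (S ⊓ K')]
    congr 1
    ext x
    simp only [Subgroup.mem_inf]
    tauto
  rw [Subgroup.inf_relIndex_left, e1, ← he] at h1
  rw [Subgroup.inf_relIndex_right, e2] at h2
  refine ⟨?_, ?_, ?_⟩
  · rw [himg, measure_smul, h1, h2]
  · exact fun h => hne (Subgroup.relIndex_eq_zero_of_le_right inf_le_right h)
  · exact fun h => hne' (Subgroup.relIndex_eq_zero_of_le_right inf_le_right h)

end OrbitVolumes

section PlaneOrbits

variable {F E D : Type*} [NontriviallyNormedField F] [IsUltrametricDist F] [LocallyCompactSpace F]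
  [Field E] [Algebra F E] [DivisionRing D] [Algebra F D] [FiniteDimensional F D]
  [TopologicalSpace D] [IsModuleTopology F D]
  {lam : E} {h0 : 2 * lam ≠ 0} {τ : E ≃ₐ[F] E}

theorem stab_eq_map (hτ : τ lam = -lam) (r : ℕ) :
    stab F E D (2 * r) (u0 F E D (2 * r) lam h0) =
      (Subgroup.pi Set.univ fun _ => stab F E D 2 (u0 F E D 2 lam h0)).map (planeGL D r) := by
  ext h
  rw [mem_stab_iff hτ]
  constructor
  · rintro ⟨t, rfl, ht⟩
    exact ⟨t, fun i _ => ht i, rfl⟩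
  · rintro ⟨t, ht, rfl⟩
    exact ⟨t, rfl, fun i => ht i trivial⟩

theorem comap_planeGL_integral (r : ℕ) :
    (integralSubgroup F D (2 * r)).comap (planeGL D r) =
      Subgroup.pi Set.univ fun _ => integralSubgroup F D 2 := by
  ext k
  rw [Subgroup.mem_comap, planeGL_mem_integral]
  simp [Subgroup.mem_pi]

theorem comap_planeGL_integral_conj {r : ℕ} (i₀ : Fin r) (l : GLn 2 D) :
    ((integralSubgroup F D (2 * r)).map (MulAut.conj (singlePlane D i₀ l)).toMonoidHom).comap
      (planeGL D r) =
      Subgroup.pi Set.univ fun i => (integralSubgroup F D 2).map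
        (MulAut.conj ((Pi.mulSingle i₀ l : Fin r → GLn 2 D) i)).toMonoidHom := by
  have hmem : ∀ {G : Type _} [Group G] (K : Subgroup G) (g x : G),
      x ∈ K.map (MulAut.conj g).toMonoidHom ↔ g⁻¹ * x * g ∈ K := by
    intro G _ K g x
    constructor
    · rintro ⟨k, hk, rfl⟩
      change g⁻¹ * (g * k * g⁻¹) * g ∈ K
      have : g⁻¹ * (g * k * g⁻¹) * g = k := by group
      rw [this]
      exact hk
    · intro h
      refine ⟨_, h, ?_⟩
      change g * (g⁻¹ * x * g) * g⁻¹ = x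
      group
  ext k
  rw [Subgroup.mem_comap, hmem]
  have : (singlePlane D i₀ l)⁻¹ * planeGL D r k * singlePlane D i₀ l =
      planeGL D r ((Pi.mulSingle i₀ l : Fin r → GLn 2 D)⁻¹ * k * Pi.mulSingle i₀ l) := by
    rw [map_mul, map_mul, map_inv]
    rfl
  rw [this, planeGL_mem_integral]
  simp only [Subgroup.mem_pi, Set.mem_univ, true_imp_iff, hmem]
  rfl

theorem map_conj_one {G : Type*} [Group G] (K : Subgroup G) :
    K.map (MulAut.conj (1 : G)).toMonoidHom = K := by
  rw [map_one]
  exact K.map_id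

theorem map_pi_inf {r : ℕ} {G H : Type*} [Group G] [Group H] (f : (Fin r → G) →* H)
    (A B : Fin r → Subgroup G) {M : Subgroup H} (hM : M.comap f = Subgroup.pi Set.univ B) :
    (Subgroup.pi Set.univ A).map f ⊓ M = (Subgroup.pi Set.univ fun i => A i ⊓ B i).map f := by
  ext x
  constructor
  · rintro ⟨⟨t, ht, rfl⟩, h⟩
    have h' : t ∈ M.comap f := h
    rw [hM] at h'
    exact ⟨t, fun i _ => ⟨ht i trivial, h' i trivial⟩, rfl⟩
  · rintro ⟨t, ht, rfl⟩
    have h' : t ∈ M.comap f := by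
      rw [hM]
      exact fun i _ => (ht i trivial).2
    exact ⟨⟨t, fun i _ => (ht i trivial).1, rfl⟩, h'⟩

/-- The stabiliser is a product over the planes and conjugation by an element of the plane `i₀`
changes only that factor. Hence the index does not depend on `r`, which makes the volumes for `2r`
and for 2 proportional. -/
theorem relIndex_singlePlane_left (hτ : τ lam = -lam) {r : ℕ} (i₀ : Fin r) (l : GLn 2 D) :
    ((integralSubgroup F D (2 * r)).map (MulAut.conj (singlePlane D i₀ l)).toMonoidHom).relIndex
      (stab F E D (2 * r) (u0 F E D (2 * r) lam h0) ⊓ integralSubgroup F D (2 * r)) =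
    ((integralSubgroup F D 2).map (MulAut.conj l).toMonoidHom).relIndex
      (stab F E D 2 (u0 F E D 2 lam h0) ⊓ integralSubgroup F D 2) := by
  rw [stab_eq_map hτ, map_pi_inf _ _ _ (comap_planeGL_integral r), ← Subgroup.relIndex_comap,
    comap_planeGL_integral_conj, relIndex_pi_eq i₀, Pi.mulSingle_eq_same]
  intro i hi
  rw [Pi.mulSingle_eq_of_ne hi, map_conj_one]
  exact inf_le_right

theorem relIndex_singlePlane_right (hτ : τ lam = -lam) {r : ℕ} (i₀ : Fin r) (l : GLn 2 D) :
    (integralSubgroup F D (2 * r)).relIndex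
      (stab F E D (2 * r) (u0 F E D (2 * r) lam h0) ⊓
        (integralSubgroup F D (2 * r)).map (MulAut.conj (singlePlane D i₀ l)).toMonoidHom) =
    (integralSubgroup F D 2).relIndex
      (stab F E D 2 (u0 F E D 2 lam h0) ⊓
        (integralSubgroup F D 2).map (MulAut.conj l).toMonoidHom) := by
  rw [stab_eq_map hτ, map_pi_inf _ _ _ (comap_planeGL_integral_conj i₀ l), ←
      Subgroup.relIndex_comap,
    comap_planeGL_integral, relIndex_pi_eq i₀, Pi.mulSingle_eq_same]
  intro i hi
  rw [Pi.mulSingle_eq_of_ne hi, map_conj_one]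
  exact inf_le_right

section Measures

/-- Base point orbits. -/
theorem isOpen_orbit_mk {G : Type*} [Group G] [TopologicalSpace G] [IsTopologicalGroup G]
    (S J : Subgroup G) (hJ : IsOpen (J : Set G)) (x : G ⧸ S) :
    IsOpen ((fun k : G => k • x) '' J) := by
  obtain ⟨g, rfl⟩ := QuotientGroup.mk_surjective x
  have h1 : (fun k : G => k • (QuotientGroup.mk g : G ⧸ S)) '' J =
      (QuotientGroup.mk : G → G ⧸ S) '' ((fun k => k * g) '' J) := by
    rw [Set.image_image]
    rfl
  rw [h1]
  exact QuotientGroup.isOpenMap_coe _ (isOpenMap_mul_right g _ hJ)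

theorem isCompact_orbit_mk {G : Type*} [Group G] [TopologicalSpace G] [IsTopologicalGroup G]
    (S : Subgroup G) {J : Set G} (hJ : IsCompact J) (x : G ⧸ S) :
    IsCompact ((fun k : G => k • x) '' J) :=
  hJ.image (by fun_prop)

/-- The ratio of the volumes of the base orbits of `GL(2r, O_D)` and `GL(2, O_D)`. -/
theorem measure_orbit_singlePlane (hF : NormIsNormalised F) (h2 : (2 : D) ≠ 0)
    (hτ : τ lam = -lam) {r : ℕ} (i₀ : Fin r)
    [MeasurableSpace (Orbit F E D (2 * r) (u0 F E D (2 * r) lam h0))]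
    [BorelSpace (Orbit F E D (2 * r) (u0 F E D (2 * r) lam h0))]
    (μ : Measure (Orbit F E D (2 * r) (u0 F E D (2 * r) lam h0)))
    [SMulInvariantMeasure (GLn (2 * r) D) (Orbit F E D (2 * r) (u0 F E D (2 * r) lam h0)) μ]
    [MeasurableSpace (Orbit F E D 2 (u0 F E D 2 lam h0))]
    [BorelSpace (Orbit F E D 2 (u0 F E D 2 lam h0))]
    (μ₂ : Measure (Orbit F E D 2 (u0 F E D 2 lam h0)))
    [SMulInvariantMeasure (GLn 2 D) (Orbit F E D 2 (u0 F E D 2 lam h0)) μ₂]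
    (b : D) (c : Dˣ) :
    μ ((fun k : GLn (2 * r) D => k • (QuotientGroup.mk (singlePlane D i₀ (affineGL b c))⁻¹ :
        Orbit F E D (2 * r) (u0 F E D (2 * r) lam h0))) '' integralSubgroup F D (2 * r)) *
      μ₂ ((fun k : GLn 2 D => k • (QuotientGroup.mk 1 :
        Orbit F E D 2 (u0 F E D 2 lam h0))) '' integralSubgroup F D 2) =
    μ ((fun k : GLn (2 * r) D => k • (QuotientGroup.mk 1 :
        Orbit F E D (2 * r) (u0 F E D (2 * r) lam h0))) '' integralSubgroup F D (2 * r)) *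
      μ₂ ((fun k : GLn 2 D => k • (QuotientGroup.mk (affineGL b c)⁻¹ :
        Orbit F E D 2 (u0 F E D 2 lam h0))) '' integralSubgroup F D 2) := by
  have := isTopologicalGroup_GLn F (D := D) (2 * r)
  have := isTopologicalGroup_GLn F (D := D) 2
  have := locallyCompactSpace_GLn F (D := D) (2 * r)
  have := locallyCompactSpace_GLn F (D := D) 2
  have key : ∀ (m : ℕ) (S : Subgroup (GLn m D)) (g : GLn m D),
      g • (QuotientGroup.mk 1 : GLn m D ⧸ S) = QuotientGroup.mk g := by
    intro m S g
    exact congrArg QuotientGroup.mk (mul_one g)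
  obtain ⟨h3, h4, h5⟩ := measure_orbit_translate μ (QuotientGroup.mk 1 :
      Orbit F E D (2 * r) (u0 F E D (2 * r) lam h0)) (isOpen_integralSubgroup (F := F) (2 * r))
    (isCompact_integralSubgroup (F := F) (2 * r))
    (fun J hJ => (isOpen_orbit_mk _ J hJ _).measurableSet)
    (modularCharacterFun_singlePlane hF h2 i₀ b c)
  obtain ⟨h6, h7, h8⟩ := measure_orbit_translate μ₂ (QuotientGroup.mk 1 :
      Orbit F E D 2 (u0 F E D 2 lam h0)) (isOpen_integralSubgroup (F := F) 2)
    (isCompact_integralSubgroup (F := F) 2)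
    (fun J hJ => (isOpen_orbit_mk _ J hJ _).measurableSet)
    (modularCharacterFun_affineGL hF h2 b c)
  rw [MulAction.stabilizer_quotient] at h3 h4 h5 h6 h7 h8
  rw [key] at h3 h6
  rw [relIndex_singlePlane_left hτ] at h3 h5
  rw [relIndex_singlePlane_right hτ] at h3 h4
  -- The two volume formulas contain the same pair of stabiliser indices, which are finite and
  -- nonzero and cancel.
  refine (ENNReal.mul_left_inj (mul_ne_zero (Nat.cast_ne_zero.2 h7) (Nat.cast_ne_zero.2 h8))
    (ENNReal.mul_ne_top (ENNReal.natCast_ne_top _) (ENNReal.natCast_ne_top _))).1 ?_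
  rw [mul_mul_mul_comm, h3, ← h6]
  ring

end Measures

end PlaneOrbits

end LocalPeriod

namespace LocalPeriod

open Topology Filter

/-! ### Affine representatives and values of the spherical function. -/

section Affine

variable {F E D : Type*} [NontriviallyNormedField F] [IsUltrametricDist F] [LocallyCompactSpace F]
  [Field E] [Algebra F E] [FiniteDimensional F E] [DivisionRing D] [Algebra F D]
  [FiniteDimensional F D] [IsDomain (D ⊗[F] E)]
  [TopologicalSpace D] [IsModuleTopology F D]
  [TopologicalSpace (D ⊗[F] E)] [IsModuleTopology F (D ⊗[F] E)]
  {lam : E} {h0 : 2 * lam ≠ 0} {τ : E ≃ₐ[F] E}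

theorem u0_two_val : (u0 F E D 2 lam h0).val =
    !![(1 : D) ⊗ₜ[F] (1 : E), (1 : D) ⊗ₜ (-lam); (1 : D) ⊗ₜ (1 : E), (1 : D) ⊗ₜ lam] := by
  ext i j
  change (1 : D) ⊗ₜ[F] u0Matrix 2 lam i j = _
  fin_cases i <;> fin_cases j <;> simp [u0Matrix]

theorem u0_two_mul_embH_bottom (g : GLn 2 D) (j : Fin 2) :
    (u0 F E D 2 lam h0 * embH F E D 2 g).val 1 j = pairMap F D lam (g.val 0 j, g.val 1 j) := by
  rw [Units.val_mul, Matrix.mul_apply, Fin.sum_univ_two, u0_two_val, pairMap_apply, embH_apply,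
    embH_apply]
  simp

/-- Upper triangularity of `u₀ s u₀⁻¹` means that right multiplication by `s` carries the bottom row
`(1, lam)` of `u₀` to a left multiple of itself. -/
theorem mem_stab_two_of_bottom {s : GLn 2 D} {a : D ⊗[F] E}
    (h1 : pairMap F D lam (s.val 0 0, s.val 1 0) = a)
    (h2 : pairMap F D lam (s.val 0 1, s.val 1 1) = a * ((1 : D) ⊗ₜ[F] lam)) :
    s ∈ stab F E D 2 (u0 F E D 2 lam h0) := by
  rw [mem_stab]
  refine mem_minParabolic_two_of_apply ?_
  have h3 : ∀ j, (u0 F E D 2 lam h0 * embH F E D 2 s).val 1 j =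
      a * (u0 F E D 2 lam h0).val 1 j := by
    intro j
    rw [u0_two_mul_embH_bottom, u0_two_val]
    fin_cases j
    · exact h1.trans (mul_one a).symm
    · exact h2
  rw [MulAut.conj_apply, Units.val_mul, Matrix.mul_apply]
  simp only [h3, mul_assoc]
  rw [← Finset.mul_sum, ← Matrix.mul_apply, Units.mul_inv, Matrix.one_apply_ne (by decide),
    mul_zero]

theorem pairMap_mul {Δ : F} (hΔ : algebraMap F E Δ = lam ^ 2) (x y x' y' : D) :
    pairMap F D lam (x, y) * pairMap F D lam (x', y') =
      pairMap F D lam (x * x' + Δ • (y * y'), x * y' + y * x') := by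
  simp only [pairMap_apply, add_mul, mul_add, Algebra.TensorProduct.tmul_mul_tmul, one_mul, mul_one,
    TensorProduct.add_tmul, show lam * lam = algebraMap F E Δ by rw [hΔ, pow_two]]
  rw [Algebra.algebraMap_eq_smul_one, TensorProduct.tmul_smul, TensorProduct.smul_tmul']
  abel

/-- Every element of `GL(2, D)` is in `(u₀⁻¹ P u₀ ∩ H) · {(1, b; 0, c)}`. -/
theorem exists_stab_mul_affine (hE : Module.finrank F E = 2)
    (hlam : lam ∉ Set.range (algebraMap F E)) (hlam2 : lam ^ 2 ∈ Set.range (algebraMap F E))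
    (g : GLn 2 D) : ∃ s ∈ stab F E D 2 (u0 F E D 2 lam h0), ∃ (b : D) (c : Dˣ),
      g = s * affineGL b c := by
  obtain ⟨Δ, hΔ⟩ := hlam2
  have hbij := pairMap_bijective (D := D) hE hlam
  set x := g.val 0 0 with hx
  set y := g.val 1 0 with hy
  have ha : pairMap F D lam (x, y) ≠ 0 := by
    intro h
    have h1 : (x, y) = (0, 0) := hbij.1 (h.trans (map_zero _).symm)
    have h2 : ((g⁻¹).val * g.val) 0 0 = 1 := by rw [Units.inv_mul]; rfl
    rw [Matrix.mul_apply, Fin.sum_univ_two, ← hx, ← hy, (Prod.mk.inj h1).1, (Prod.mk.inj h1).2]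
        at h2
    simp at h2
  obtain ⟨a, ha'⟩ := FiniteDimensional.isUnit F ha
  obtain ⟨⟨x', y'⟩, hx'⟩ := hbij.2 (a⁻¹ : (D ⊗[F] E)ˣ)
  have hone : (1 : D ⊗[F] E) = pairMap F D lam (1, 0) := by
    rw [pairMap_apply, TensorProduct.zero_tmul, add_zero]
    rfl
  have e1 : pairMap F D lam (x, y) * pairMap F D lam (x', y') = 1 := by
    rw [← ha', hx', Units.mul_inv]
  have e2 : pairMap F D lam (x', y') * pairMap F D lam (x, y) = 1 := by
    rw [← ha', hx', Units.inv_mul]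
  rw [pairMap_mul hΔ, hone] at e1 e2
  obtain ⟨p1, p2⟩ := Prod.mk.inj (hbij.1 e1)
  obtain ⟨p3, p4⟩ := Prod.mk.inj (hbij.1 e2)
  -- This is the matrix of left multiplication by `x + y lam` on `D ⊗ E = D ⊕ D lam`. It has the
  -- same first column as `g`, so `s⁻¹ g` has first column `(1, 0)`.
  let s : GLn 2 D :=
    { val := !![x, Δ • y; y, x]
      inv := !![x', Δ • y'; y', x']
      val_inv := by
        ext i j
        fin_cases i <;> fin_cases j <;>
          simp [Matrix.mul_apply, Fin.sum_univ_two, p1, p2, ← smul_add, add_comm (y * x')]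
        rw [add_comm, p1]
      inv_val := by
        ext i j
        fin_cases i <;> fin_cases j <;>
          simp [Matrix.mul_apply, Fin.sum_univ_two, p3, p4, ← smul_add, add_comm (y' * x)]
        rw [add_comm, p3] }
  have hs : s ∈ stab F E D 2 (u0 F E D 2 lam h0) := by
    refine mem_stab_two_of_bottom (a := pairMap F D lam (x, y)) rfl ?_
    have hl : (1 : D) ⊗ₜ[F] lam = pairMap F D lam (0, 1) := by
      rw [pairMap_apply, TensorProduct.zero_tmul, zero_add]
    rw [hl, pairMap_mul hΔ]
    change pairMap F D lam (Δ • y, x) = _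
    simp
  have q1 : (s⁻¹ * g).val 0 0 = 1 := by
    rw [Units.val_mul, Matrix.mul_apply, Fin.sum_univ_two]
    change x' * x + (Δ • y') * y = 1
    rw [smul_mul_assoc, p3]
  have q2 : (s⁻¹ * g).val 1 0 = 0 := by
    rw [Units.val_mul, Matrix.mul_apply, Fin.sum_univ_two]
    change y' * x + x' * y = 0
    rw [add_comm, p4]
  have q3 : (s⁻¹ * g).val 1 1 ≠ 0 := by
    intro h
    have h2 : ((s⁻¹ * g).val * ((s⁻¹ * g)⁻¹).val) 1 1 = 1 := by rw [Units.mul_inv]; rfl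
    rw [Matrix.mul_apply, Fin.sum_univ_two, q2, h] at h2
    simp at h2
  refine ⟨s, hs, (s⁻¹ * g).val 0 1, Units.mk0 _ q3, ?_⟩
  have : affineGL ((s⁻¹ * g).val 0 1) (Units.mk0 _ q3) = s⁻¹ * g := by
    apply Units.ext
    rw [affineGL_val]
    ext i j
    fin_cases i <;> fin_cases j
    · exact q1.symm
    · rfl
    · exact q2.symm
    · rfl
  rw [this, mul_inv_cancel_left]

theorem u0_two_mul_affine (b : D) (c : Dˣ) :
    (u0 F E D 2 lam h0 * embH F E D 2 (affineGL b c)).val =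
      !![1, b ⊗ₜ[F] (1 : E) - (c : D) ⊗ₜ lam; 1, pairMap F D lam (b, c)] := by
  rw [Units.val_mul, embH_val, affineGL_val, u0_two_val]
  ext i j
  rw [Matrix.mul_apply, Fin.sum_univ_two]
  change _ * (!![1, b; 0, (c : D)] _ _ ⊗ₜ[F] (1 : E)) + _ * (!![1, b; 0, (c : D)] _ _ ⊗ₜ[F] (1 : E))
      = _
  have h1 : (1 : D) ⊗ₜ[F] (1 : E) = 1 := rfl
  fin_cases i <;> fin_cases j <;> simp [pairMap_apply, h1, TensorProduct.tmul_neg, sub_eq_add_neg]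

theorem modAbs_tmul (a : D) (e : E) : modAbs F (a ⊗ₜ[F] e) =
    modAbs F a ^ Module.finrank F E * modAbs F e ^ Module.finrank F D := by
  rw [modAbs, norm_tmul, norm_mul, norm_pow, norm_pow]
  rfl

theorem exists_iwasawa_affine (hE : Module.finrank F E = 2) (b : D) (c : Dˣ) :
    ∃ p ∈ minParabolic (D ⊗[F] E) 2, ∃ k ∈ integralSubgroup F (D ⊗[F] E) 2,
      u0 F E D 2 lam h0 * embH F E D 2 (affineGL b c) = p * k ∧
      borelModulus F p = modAbs F (c : D) ^ 2 * modAbs F (2 * lam) ^ Module.finrank F D /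
        max 1 (modAbs F (pairMap F D lam (b, c))) ^ 2 := by
  obtain ⟨p, hp, k, hk, h, hd⟩ := exists_iwasawa_two (F := F)
    (u0_two_mul_affine (F := F) (lam := lam) (h0 := h0) b c)
  refine ⟨p, hp, k, hk, h, hd.trans ?_⟩
  have : pairMap F D lam (b, c) - (b ⊗ₜ[F] (1 : E) - (c : D) ⊗ₜ lam) = (c : D) ⊗ₜ (2 * lam) := by
    rw [pairMap_apply, two_mul, TensorProduct.tmul_add]
    abel
  rw [this, modAbs_tmul, hE]

theorem iwasawaModulus_affine (hE : Module.finrank F E = 2) (b : D) (c : Dˣ) :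
    iwasawaModulus F (u0 F E D 2 lam h0 * embH F E D 2 (affineGL b c)) =
      modAbs F (c : D) ^ 2 * modAbs F (2 * lam) ^ Module.finrank F D /
        max 1 (modAbs F (pairMap F D lam (b, c))) ^ 2 := by
  obtain ⟨p, hp, k, hk, h, hd⟩ := exists_iwasawa_affine (F := F) (D := D) (lam := lam) (h0 := h0) hE
      b c
  rw [h, iwasawaModulus_mul hp hk, hd]

theorem exists_iwasawa_embH_two (hE : Module.finrank F E = 2)
    (hlam : lam ∉ Set.range (algebraMap F E)) (hlam2 : lam ^ 2 ∈ Set.range (algebraMap F E))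
    (l : GLn 2 D) :
    ∃ p ∈ minParabolic (D ⊗[F] E) 2, ∃ k ∈ integralSubgroup F (D ⊗[F] E) 2,
      u0 F E D 2 lam h0 * embH F E D 2 l = p * k := by
  obtain ⟨s, hs, b, c, rfl⟩ := exists_stab_mul_affine (h0 := h0) hE hlam hlam2 l
  obtain ⟨p, hp, k, hk, h, -⟩ := exists_iwasawa_affine (F := F) (D := D) (lam := lam) (h0 := h0) hE
      b c
  refine ⟨_, (minParabolic _ 2).mul_mem (mem_stab.1 hs) hp, k, hk, ?_⟩
  rw [mul_assoc, ← h, MulAut.conj_apply, map_mul]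
  group

/-- The exponent of `κ`: the odd numbers up to `2r - 1` add up to `r ^ 2`, and the term 1 of the
middle plane is left out. -/
theorem sum_odd (r : ℕ) (hr : 1 ≤ r) :
    ∑ i : Fin r, (if (i : ℕ) + 1 = r then 0 else 2 * r - 1 - 2 * (i : ℕ)) = r ^ 2 - 1 := by
  obtain ⟨r, rfl⟩ : ∃ k, r = k + 1 := ⟨r - 1, by omega⟩
  rw [Fin.sum_univ_castSucc]
  have h1 : ∀ i : Fin r, (if ((i.castSucc : Fin (r + 1)) : ℕ) + 1 = r + 1 then 0
      else 2 * (r + 1) - 1 - 2 * ((i.castSucc : Fin (r + 1)) : ℕ)) = 2 * (r - 1 - (i : ℕ)) + 3 := by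
    intro i
    have := i.2
    rw [Fin.val_castSucc, if_neg (by omega)]
    omega
  simp only [h1, Fin.val_last, if_true, add_zero]
  rw [Finset.sum_add_distrib, ← Finset.mul_sum, Fin.sum_univ_eq_sum_range (fun i => r - 1 - i),
    Finset.sum_range_reflect (fun i => i), mul_comm 2, Finset.sum_range_id_mul_two]
  simp only [Finset.sum_const, Finset.card_univ, Fintype.card_fin, smul_eq_mul]
  rcases r with _ | r
  · simp
  · simp only [Nat.add_sub_cancel]
    have : (r + 1 + 1) ^ 2 = (r + 1) * r + (r + 1) * 3 + 1 := by ring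
    omega

/-- The values of the spherical modulus on the plane `r - 1`. -/
theorem iwasawaModulus_singlePlane (hE : Module.finrank F E = 2)
    (hlam : lam ∉ Set.range (algebraMap F E)) (hlam2 : lam ^ 2 ∈ Set.range (algebraMap F E))
    {r : ℕ} (i₀ : Fin r) (hi₀ : (i₀ : ℕ) + 1 = r) (l : GLn 2 D) :
    iwasawaModulus F (u0 F E D (2 * r) lam h0 * embH F E D (2 * r) (singlePlane D i₀ l)) =
      (modAbs F (2 * lam) / max 1 (modAbs F lam) ^ 2) ^ (Module.finrank F D * (r ^ 2 - 1)) *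
        iwasawaModulus F (u0 F E D 2 lam h0 * embH F E D 2 l) := by
  classical
  obtain ⟨p₀, hp₀, k₀, hk₀, e₀⟩ := exists_iwasawa_embH_two (h0 := h0) hE hlam hlam2 l
  -- `b = 0` and `c = 1` give the decomposition of `u₀` itself, which occurs in every plane other
  -- than `i₀`.
  obtain ⟨p₁, hp₁, k₁, hk₁, e₁, d₁⟩ :=
    exists_iwasawa_affine (F := F) (D := D) (lam := lam) (h0 := h0) hE 0 1
  have e₁' : u0 F E D 2 lam h0 = p₁ * k₁ := by
    rw [← e₁]
    have : affineGL (0 : D) 1 = 1 := by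
      apply Units.ext
      rw [affineGL_val]
      ext i j
      fin_cases i <;> fin_cases j <;> rfl
    rw [this, map_one, mul_one]
  have d₁' : borelModulus F p₁ =
      (modAbs F (2 * lam) / max 1 (modAbs F lam) ^ 2) ^ Module.finrank F D := by
    rw [d₁, pairMap_apply, TensorProduct.zero_tmul, zero_add, Units.val_one, modAbs_tmul,
      modAbs_one, one_pow, one_mul, one_pow, one_mul, div_pow, ← pow_mul, mul_comm 2 (Module.finrank
          F D), pow_mul]
    congr 2
    have hx := modAbs_nonneg (F := F) lam
    rcases le_total (modAbs F lam) 1 with h | h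
    · rw [max_eq_left h, max_eq_left (pow_le_one₀ hx h), one_pow]
    · rw [max_eq_right h, max_eq_right (one_le_pow₀ h)]
  let p : Fin r → GLn 2 (D ⊗[F] E) := fun i => if i = i₀ then p₀ else p₁
  let k : Fin r → GLn 2 (D ⊗[F] E) := fun i => if i = i₀ then k₀ else k₁
  have hp : ∀ i, p i ∈ minParabolic (D ⊗[F] E) 2 := fun i => by
    simp only [p]; split_ifs <;> assumption
  have hk : ∀ i, k i ∈ integralSubgroup F (D ⊗[F] E) 2 := fun i => by
    simp only [k]; split_ifs <;> assumption
  have h1 : u0 F E D (2 * r) lam h0 * embH F E D (2 * r) (singlePlane D i₀ l) =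
      planeGL (D ⊗[F] E) r p * planeGL (D ⊗[F] E) r k := by
    rw [singlePlane, MonoidHom.comp_apply, u0_eq_planeGL, embH_planeGL, ← map_mul, ← map_mul]
    congr 1
    funext i
    change u0 F E D 2 lam h0 * embH F E D 2 ((Pi.mulSingle i₀ l : Fin r → GLn 2 D) i) = p i * k i
    simp only [p, k]
    split_ifs with h
    · subst h
      rw [Pi.mulSingle_eq_same, e₀]
    · rw [Pi.mulSingle_eq_of_ne h, map_one, mul_one, e₁']
  have hP : planeGL (D ⊗[F] E) r p ∈ minParabolic (D ⊗[F] E) (2 * r) :=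
    (planeGL_mem_parabolic (b := fun i => (i : ℕ)) (fun i j h => h) p).2 fun i _ => hp i
  rw [h1, iwasawaModulus_mul hP ((planeGL_mem_integral k).2 hk), e₀, iwasawaModulus_mul hp₀ hk₀,
    borelModulus_planeGL p hp, pow_mul]
  have hs := sum_odd r (by omega)
  rw [← hs, ← d₁', ← Finset.prod_pow_eq_pow_sum, ← Finset.mul_prod_erase _ _ (Finset.mem_univ i₀),
    ← Finset.mul_prod_erase _ _ (Finset.mem_univ i₀)]
  simp only [p, if_true, hi₀, pow_zero, one_mul]
  have : 2 * r - 1 - 2 * (i₀ : ℕ) = 1 := by omega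
  rw [this, pow_one, mul_comm]
  congr 1
  refine Finset.prod_congr rfl fun i hi => ?_
  have hne := Finset.ne_of_mem_erase hi
  rw [if_neg hne, if_neg]
  intro h
  exact hne (Fin.ext (by omega))

end Affine

end LocalPeriod

namespace LocalPeriod

open Topology Filter

/-! ### Integrals as sums over orbits of integral matrices. -/

section Partition

variable {X Q : Type*} [MeasurableSpace X] [Countable Q] {μ : Measure X} {O : Q → Set X}
  {f : X → ℂ} {g : Q → ℂ}

theorem setIntegral_of_eq_const {s : Set X} (hs : MeasurableSet s) {c : ℂ} (h : ∀ x ∈ s, f x = c) :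
    ∫ x in s, f x ∂μ = μ.real s * c := by
  rw [setIntegral_congr_fun hs h, setIntegral_const, Complex.real_smul]

theorem integrableOn_of_eq_const {s : Set X} (hs : MeasurableSet s) (hfin : μ s ≠ ⊤) {c : ℂ}
    (h : ∀ x ∈ s, f x = c) : IntegrableOn f s μ :=
  (integrableOn_congr_fun h hs).2 (integrableOn_const hfin)

/-- A function which is constant on the parts of a countable measurable partition is integrable if
the corresponding series converges absolutely. -/
theorem integrable_of_partition (hO : ∀ q, MeasurableSet (O q)) (hfin : ∀ q, μ (O q) ≠ ⊤)
    (hf : ∀ q, ∀ x ∈ O q, f x = g q) (hf0 : ∀ x, (∀ q, x ∉ O q) → f x = 0)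
    (hs : Summable fun q => μ.real (O q) * ‖g q‖) : Integrable f μ := by
  have h1 : IntegrableOn f (⋃ q, O q) μ := by
    refine integrableOn_iUnion_of_summable_integral_norm
      (fun q => integrableOn_of_eq_const (hO q) (hfin q) (hf q)) ?_
    refine hs.congr fun q => ?_
    rw [setIntegral_congr_fun (hO q) (fun x hx => congrArg norm (hf q x hx) : Set.EqOn (fun x => ‖f
        x‖) (fun _ => ‖g q‖) (O q)),
      setIntegral_const, smul_eq_mul]
  refine (integrableOn_iff_integrable_of_support_subset ?_).1 h1
  intro x hx
  by_contra h
  exact hx (hf0 x fun q hq => h (Set.mem_iUnion.2 ⟨q, hq⟩))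

theorem hasSum_integral_of_partition (hO : ∀ q, MeasurableSet (O q))
    (hd : Pairwise (Function.onFun Disjoint O))
    (hf : ∀ q, ∀ x ∈ O q, f x = g q) (hf0 : ∀ x, (∀ q, x ∉ O q) → f x = 0) (hi : Integrable f μ) :
    HasSum (fun q => μ.real (O q) * g q : Q → ℂ) (∫ x, f x ∂μ) := by
  have h1 := hasSum_integral_iUnion hO hd hi.integrableOn
  rw [setIntegral_eq_integral_of_forall_compl_eq_zero] at h1
  · refine h1.congr_fun fun q => ?_
    rw [setIntegral_of_eq_const (hO q) (hf q)]
  · intro x hx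
    exact hf0 x fun q hq => hx (Set.mem_iUnion.2 ⟨q, hq⟩)

theorem summable_of_partition (hO : ∀ q, MeasurableSet (O q))
    (hd : Pairwise (Function.onFun Disjoint O))
    (hf : ∀ q, ∀ x ∈ O q, f x = g q) (hi : Integrable f μ) :
    Summable fun q => μ.real (O q) * ‖g q‖ := by
  have h1 := hasSum_integral_iUnion hO hd hi.norm.integrableOn
  refine h1.summable.congr fun q => ?_
  rw [setIntegral_congr_fun (hO q) (fun x hx => congrArg norm (hf q x hx) : Set.EqOn (fun x => ‖f
      x‖) (fun _ => ‖g q‖) (O q)),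
      setIntegral_const, smul_eq_mul]

end Partition

section OrbitFunctions

variable {F E D : Type*} [Field F] [Field E] [Algebra F E] [DivisionRing D] [Algebra F D]
  {m : ℕ} {u : GLn m (D ⊗[F] E)} {Ψ : GLn m (D ⊗[F] E) → ℂ}

theorem orbitFun_mk (hΨ : ∀ s ∈ stab F E D m u, ∀ h, Ψ (u * embH F E D m (s * h)) =
    Ψ (u * embH F E D m h)) (g : GLn m D) :
    orbitFun F E D m u Ψ (QuotientGroup.mk g) = Ψ (u * embH F E D m g⁻¹) := by
  obtain ⟨s, hs⟩ := QuotientGroup.mk_out_eq_mul (stab F E D m u) g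
  change Ψ (u * (embH F E D m (Quotient.out (QuotientGroup.mk g : GLn m D ⧸ stab F E D m u)))⁻¹) = _
  have : (Quotient.out (QuotientGroup.mk g : GLn m D ⧸ stab F E D m u)) = g * s := hs
  rw [this, ← map_inv, mul_inv_rev]
  exact hΨ _ (inv_mem s.2) _

theorem mul_embH_stab (s h : GLn m D) : u * embH F E D m (s * h) =
    MulAut.conj u (embH F E D m s) * (u * embH F E D m h) := by
  rw [map_mul, MulAut.conj_apply]
  group

/-- Invariance of the period under right translation. -/
theorem integrable_and_period_translate [TopologicalSpace D]
    [MeasurableSpace (Orbit F E D m u)] [MeasurableConstSMul (GLn m D) (Orbit F E D m u)]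
    (μ : Measure (Orbit F E D m u)) [SMulInvariantMeasure (GLn m D) (Orbit F E D m u) μ]
    (hΨ : ∀ s ∈ stab F E D m u, ∀ g, Ψ (MulAut.conj u (embH F E D m s) * g) = Ψ g)
    (hi : Integrable (orbitFun F E D m u Ψ) μ) (h : GLn m D) :
    Integrable (orbitFun F E D m u fun g => Ψ (g * embH F E D m h)) μ ∧
      period F E D m u μ (fun g => Ψ (g * embH F E D m h)) = period F E D m u μ Ψ := by
  have h1 : orbitFun F E D m u (fun g => Ψ (g * embH F E D m h)) =
      fun x => orbitFun F E D m u Ψ (h⁻¹ • x) := by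
    funext x
    obtain ⟨g, rfl⟩ := QuotientGroup.mk_surjective x
    have h2 : h⁻¹ • (QuotientGroup.mk g : Orbit F E D m u) = QuotientGroup.mk (h⁻¹ * g) := rfl
    rw [h2, orbitFun_mk, orbitFun_mk]
    · rw [mul_inv_rev, inv_inv, map_mul, mul_assoc]
    · intro s hs h
      rw [mul_embH_stab, hΨ s hs]
    · intro s hs h
      rw [mul_embH_stab, mul_assoc, hΨ s hs]
  rw [period, h1]
  exact ⟨(measurePreserving_smul h⁻¹ μ).integrable_comp_of_integrable hi, integral_smul_eq_self _⟩

end OrbitFunctions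

section Comparison

variable {F E D : Type*} [NontriviallyNormedField F] [IsUltrametricDist F] [LocallyCompactSpace F]
  [Field E] [Algebra F E] [FiniteDimensional F E] [DivisionRing D] [Algebra F D]
  [FiniteDimensional F D] [IsDomain (D ⊗[F] E)]
  [TopologicalSpace D] [IsModuleTopology F D]
  [TopologicalSpace (D ⊗[F] E)] [IsModuleTopology F (D ⊗[F] E)]
  {lam : E} {h0 : 2 * lam ≠ 0} {τ : E ≃ₐ[F] E}

variable (F D) in
/-- Orbits of `GL(m, O_D)` on a quotient of `GL(m, D)`. -/
abbrev IntegralOrbits (m : ℕ) (S : Subgroup (GLn m D)) : Type _ :=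
  MulAction.orbitRel.Quotient (integralSubgroup F D m) (GLn m D ⧸ S)

theorem integralOrbits_eq_iff {m : ℕ} {S : Subgroup (GLn m D)} {x y : GLn m D ⧸ S} :
    (Quotient.mk'' x : IntegralOrbits F D m S) = Quotient.mk'' y ↔
      ∃ k ∈ integralSubgroup F D m, k • y = x := by
  rw [Quotient.eq'']
  constructor
  · rintro ⟨k, hk⟩
    exact ⟨k.1, k.2, hk⟩
  · rintro ⟨k, hk, h⟩
    exact ⟨⟨k, hk⟩, h⟩

theorem secondCountableTopology_GLn (F : Type*) {D : Type*} [NontriviallyNormedField F]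
    [LocallyCompactSpace F] [DivisionRing D] [Algebra F D] [FiniteDimensional F D]
    [TopologicalSpace D] [IsModuleTopology F D] (m : ℕ) : SecondCountableTopology (GLn m D) := by
  have := IsModuleTopology.isTopologicalRing F D
  have hp : ProperSpace F := ProperSpace.of_locallyCompactSpace F
  have h2 : SecondCountableTopology F := secondCountable_of_proper
  have h1 : SecondCountableTopology D :=
    (coordHomeo F D).toHomeomorph.symm.isQuotientMap.secondCountableTopology
      (coordHomeo F D).toHomeomorph.symm.isOpenMap
  have h3 : SecondCountableTopology (Matrix (Fin m) (Fin m) D) :=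
    inferInstanceAs (SecondCountableTopology (Fin m → Fin m → D))
  exact (isOpenEmbedding_units_val F (C := Matrix (Fin m) (Fin m)
      D)).isInducing.secondCountableTopology

theorem countable_integralOrbits (m : ℕ) (S : Subgroup (GLn m D)) :
    Countable (IntegralOrbits F D m S) := by
  have := isTopologicalGroup_GLn F (D := D) m
  have := secondCountableTopology_GLn F (D := D) m
  obtain ⟨s, hs, hd⟩ := TopologicalSpace.exists_countable_dense (GLn m D)
  have : Countable s := hs
  refine Function.Surjective.countable (f := fun x : s =>
    (Quotient.mk'' (QuotientGroup.mk x.1) : IntegralOrbits F D m S)) ?_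
  intro q
  obtain ⟨x, rfl⟩ := Quotient.mk''_surjective q
  obtain ⟨g, rfl⟩ := QuotientGroup.mk_surjective x
  have ho : IsOpen ((fun k => k * g) '' (integralSubgroup F D m : Set (GLn m D))) :=
    isOpenMap_mul_right g _ (isOpen_integralSubgroup m)
  obtain ⟨_, h1, ⟨k, hk, rfl⟩⟩ :=
    hd.exists_mem_open ho ⟨1 * g, 1, (integralSubgroup F D m).one_mem, rfl⟩
  exact ⟨⟨_, h1⟩, integralOrbits_eq_iff.2 ⟨k, hk, rfl⟩⟩

theorem singlePlane_mem_stab (hτ : τ lam = -lam) {r : ℕ} (i₀ : Fin r) {s : GLn 2 D}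
    (hs : s ∈ stab F E D 2 (u0 F E D 2 lam h0)) :
    singlePlane D i₀ s ∈ stab F E D (2 * r) (u0 F E D (2 * r) lam h0) := by
  rw [mem_stab_iff hτ]
  refine ⟨Pi.mulSingle i₀ s, rfl, fun i => ?_⟩
  by_cases h : i = i₀
  · subst h
    rwa [Pi.mulSingle_eq_same]
  · rw [Pi.mulSingle_eq_of_ne h]
    exact Subgroup.one_mem _

theorem singlePlane_mem_integral {r : ℕ} (i₀ : Fin r) {k : GLn 2 D}
    (hk : k ∈ integralSubgroup F D 2) : singlePlane D i₀ k ∈ integralSubgroup F D (2 * r) := by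
  refine (planeGL_mem_integral _).2 fun i => ?_
  change (Pi.mulSingle i₀ k : Fin r → GLn 2 D) i ∈ _
  by_cases h : i = i₀
  · subst h
    rwa [Pi.mulSingle_eq_same]
  · rw [Pi.mulSingle_eq_of_ne h]
    exact Subgroup.one_mem _

/-- The map from orbits of `GL(2, O_D)` to orbits of `GL(2r, O_D)` is well defined and injective. -/
theorem singlePlane_orbit_iff (hτ : τ lam = -lam) {r : ℕ} (i₀ : Fin r) (l l' : GLn 2 D) :
    (∃ k ∈ integralSubgroup F D (2 * r), k • (QuotientGroup.mk (singlePlane D i₀ l)⁻¹ :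
      Orbit F E D (2 * r) (u0 F E D (2 * r) lam h0)) = QuotientGroup.mk (singlePlane D i₀ l')⁻¹) ↔
    ∃ k ∈ integralSubgroup F D 2, k • (QuotientGroup.mk l⁻¹ :
      Orbit F E D 2 (u0 F E D 2 lam h0)) = QuotientGroup.mk l'⁻¹ := by
  constructor
  · rintro ⟨k, hk, h⟩
    have h1 : (QuotientGroup.mk (k * (singlePlane D i₀ l)⁻¹) :
      Orbit F E D (2 * r) (u0 F E D (2 * r) lam h0)) = QuotientGroup.mk (singlePlane D i₀ l')⁻¹ := h
    rw [QuotientGroup.eq, mem_stab_iff hτ] at h1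
    obtain ⟨t, ht, hts⟩ := h1
    -- Both representatives and the stabiliser element preserve the planes, so `k` does too, and its
    -- component at `i₀` is the element sought.
    have hk2 : k = planeGL D r ((Pi.mulSingle i₀ l')⁻¹ * t⁻¹ * Pi.mulSingle i₀ l) := by
      rw [map_mul, map_mul, map_inv, map_inv, ht]
      change k = (singlePlane D i₀ l')⁻¹ * _ * singlePlane D i₀ l
      group
    rw [hk2, planeGL_mem_integral] at hk
    have hk3 := hk i₀
    rw [Pi.mul_apply, Pi.mul_apply, Pi.inv_apply, Pi.inv_apply, Pi.mulSingle_eq_same,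
      Pi.mulSingle_eq_same] at hk3
    refine ⟨_, hk3, ?_⟩
    change (QuotientGroup.mk (l'⁻¹ * (t i₀)⁻¹ * l * l⁻¹) : Orbit F E D 2 (u0 F E D 2 lam h0)) = _
    rw [QuotientGroup.eq]
    have : (l'⁻¹ * (t i₀)⁻¹ * l * l⁻¹)⁻¹ * l'⁻¹ = t i₀ := by group
    rw [this]
    exact hts i₀
  · rintro ⟨k, hk, h⟩
    refine ⟨singlePlane D i₀ k, singlePlane_mem_integral i₀ hk, ?_⟩
    have h1 : (QuotientGroup.mk (k * l⁻¹) : Orbit F E D 2 (u0 F E D 2 lam h0)) =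
      QuotientGroup.mk l'⁻¹ := h
    rw [QuotientGroup.eq] at h1
    change (QuotientGroup.mk (singlePlane D i₀ k * (singlePlane D i₀ l)⁻¹) :
      Orbit F E D (2 * r) (u0 F E D (2 * r) lam h0)) = _
    rw [QuotientGroup.eq, ← map_inv, ← map_inv, ← map_mul, ← map_inv, ← map_mul]
    exact singlePlane_mem_stab hτ i₀ h1

variable {r : ℕ}
    [MeasurableSpace (Orbit F E D (2 * r) (u0 F E D (2 * r) lam h0))]
    [BorelSpace (Orbit F E D (2 * r) (u0 F E D (2 * r) lam h0))]
    [MeasurableSpace (Orbit F E D 2 (u0 F E D 2 lam h0))]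
    [BorelSpace (Orbit F E D 2 (u0 F E D 2 lam h0))]

/-- Comparison of the integrals over the orbits for `2r` and for `2`. -/
theorem integral_comparison (hF : NormIsNormalised F) (h2 : (2 : F) ≠ 0)
    (hE : Module.finrank F E = 2)
    (hlam : lam ∉ Set.range (algebraMap F E)) (hlam2 : lam ^ 2 ∈ Set.range (algebraMap F E))
    (hτ : τ lam = -lam) (i₀ : Fin r)
    (μ : Measure (Orbit F E D (2 * r) (u0 F E D (2 * r) lam h0))) [IsFiniteMeasureOnCompacts μ]
    [SMulInvariantMeasure (GLn (2 * r) D) (Orbit F E D (2 * r) (u0 F E D (2 * r) lam h0)) μ]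
    (μ₂ : Measure (Orbit F E D 2 (u0 F E D 2 lam h0))) [IsFiniteMeasureOnCompacts μ₂]
    [SMulInvariantMeasure (GLn 2 D) (Orbit F E D 2 (u0 F E D 2 lam h0)) μ₂]
    {v v₂ : ℝ} (hv : v = μ.real ((fun k : GLn (2 * r) D => k • (QuotientGroup.mk 1 :
        Orbit F E D (2 * r) (u0 F E D (2 * r) lam h0))) '' integralSubgroup F D (2 * r)))
    (hv₂ : v₂ = μ₂.real ((fun k : GLn 2 D => k • (QuotientGroup.mk 1 :
        Orbit F E D 2 (u0 F E D 2 lam h0))) '' integralSubgroup F D 2)) (hv₂0 : v₂ ≠ 0)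
    {f : Orbit F E D (2 * r) (u0 F E D (2 * r) lam h0) → ℂ}
    {f₂ : Orbit F E D 2 (u0 F E D 2 lam h0) → ℂ} (a : ℂ)
    (hf₂ : ∀ k ∈ integralSubgroup F D 2, ∀ x, f₂ (k • x) = f₂ x)
    (hf : ∀ l : GLn 2 D, ∀ k ∈ integralSubgroup F D (2 * r),
      f (k • QuotientGroup.mk (singlePlane D i₀ l)⁻¹) = a * f₂ (QuotientGroup.mk l⁻¹))
    (hf0 : ∀ x, f x ≠ 0 → ∃ l : GLn 2 D, ∃ k ∈ integralSubgroup F D (2 * r),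
      x = k • QuotientGroup.mk (singlePlane D i₀ l)⁻¹) (hi : Integrable f₂ μ₂) :
    Integrable f μ ∧ ∫ x, f x ∂μ = (v / v₂ : ℝ) * (a * ∫ x, f₂ x ∂μ₂) := by
  have := isTopologicalGroup_GLn F (D := D) (2 * r)
  have := isTopologicalGroup_GLn F (D := D) 2
  have hD2 : (2 : D) ≠ 0 := by
    rw [← map_ofNat (algebraMap F D) 2]
    exact (map_ne_zero _).2 h2
  let S₂ := stab F E D 2 (u0 F E D 2 lam h0)
  have hcount := countable_integralOrbits (F := F) 2 S₂
  let O₂ : IntegralOrbits F D 2 S₂ → Set (Orbit F E D 2 (u0 F E D 2 lam h0)) :=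
    fun q => {x | Quotient.mk'' x = q}
  -- All representatives `l` of `q` are admitted so that no choice is made; `singlePlane_orbit_iff`
  -- shows that they yield a single `GL(2r, O_D)`-orbit.
  let O : IntegralOrbits F D 2 S₂ → Set (Orbit F E D (2 * r) (u0 F E D (2 * r) lam h0)) :=
    fun q => {x | ∃ l : GLn 2 D, (Quotient.mk'' (QuotientGroup.mk l⁻¹) : IntegralOrbits F D 2 S₂) =
        q ∧
      ∃ k ∈ integralSubgroup F D (2 * r), x = k • QuotientGroup.mk (singlePlane D i₀ l)⁻¹}
  have hO₂ : ∀ l : GLn 2 D, O₂ (Quotient.mk'' (QuotientGroup.mk l⁻¹)) =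
      (fun k : GLn 2 D => k • (QuotientGroup.mk l⁻¹ : Orbit F E D 2 (u0 F E D 2 lam h0))) ''
        integralSubgroup F D 2 := by
    intro l
    ext x
    exact integralOrbits_eq_iff
  have hO : ∀ l : GLn 2 D, O (Quotient.mk'' (QuotientGroup.mk l⁻¹)) =
      (fun k : GLn (2 * r) D => k • (QuotientGroup.mk (singlePlane D i₀ l)⁻¹ :
        Orbit F E D (2 * r) (u0 F E D (2 * r) lam h0))) '' integralSubgroup F D (2 * r) := by
    intro l
    ext x
    constructor
    · rintro ⟨l', h, k, hk, rfl⟩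
      obtain ⟨k', hk', h'⟩ :=
        (singlePlane_orbit_iff (h0 := h0) hτ i₀ l l').2 (integralOrbits_eq_iff.1 h)
      refine ⟨k * k', Subgroup.mul_mem _ hk hk', ?_⟩
      change (k * k') • _ = _
      rw [mul_smul, h']
    · rintro ⟨k, hk, rfl⟩
      exact ⟨l, rfl, k, hk, rfl⟩
  -- Affine representatives are needed because the comparison of volumes is available only at these
  -- points.
  have hrep : ∀ q : IntegralOrbits F D 2 S₂, ∃ (b : D) (c : Dˣ),
      q = Quotient.mk'' (QuotientGroup.mk (affineGL b c)⁻¹) := by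
    intro q
    obtain ⟨x, rfl⟩ := Quotient.mk''_surjective q
    obtain ⟨g, rfl⟩ := QuotientGroup.mk_surjective x
    obtain ⟨s, hs, b, c, h⟩ := exists_stab_mul_affine (h0 := h0) hE hlam hlam2 g⁻¹
    refine ⟨b, c, ?_⟩
    congr 1
    rw [QuotientGroup.eq, h, mul_assoc, mul_inv_cancel, mul_one]
    exact hs
  have hmeas₂ : ∀ q, MeasurableSet (O₂ q) := by
    intro q
    obtain ⟨b, c, rfl⟩ := hrep q
    rw [hO₂]
    exact (isOpen_orbit_mk _ _ (isOpen_integralSubgroup 2) _).measurableSet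
  have hmeas : ∀ q, MeasurableSet (O q) := by
    intro q
    obtain ⟨b, c, rfl⟩ := hrep q
    rw [hO]
    exact (isOpen_orbit_mk _ _ (isOpen_integralSubgroup (2 * r)) _).measurableSet
  have hfin : ∀ q, μ (O q) ≠ ⊤ := by
    intro q
    obtain ⟨b, c, rfl⟩ := hrep q
    rw [hO]
    exact (isCompact_orbit_mk _ (isCompact_integralSubgroup (2 * r)) _).measure_ne_top
  have hvol : ∀ q, μ.real (O q) = v / v₂ * μ₂.real (O₂ q) := by
    intro q
    obtain ⟨b, c, rfl⟩ := hrep q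
    have h1 := congrArg ENNReal.toReal (measure_orbit_singlePlane (h0 := h0) hF hD2 hτ i₀ μ μ₂ b c)
    rw [ENNReal.toReal_mul, ENNReal.toReal_mul] at h1
    rw [hO, hO₂, Measure.real, Measure.real, div_mul_eq_mul_div, eq_div_iff hv₂0, hv₂, hv]
    exact h1
  have hd₂ : Pairwise (Function.onFun Disjoint O₂) := by
    intro q q' hne
    refine Set.disjoint_left.2 fun x h h' => hne ?_
    exact h.symm.trans h'
  have hd : Pairwise (Function.onFun Disjoint O) := by
    intro q q' hne
    refine Set.disjoint_left.2 ?_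
    rintro x ⟨l, rfl, k, hk, rfl⟩ ⟨l', rfl, k', hk', h⟩
    refine hne (integralOrbits_eq_iff.2 ((singlePlane_orbit_iff hτ i₀ l' l).1
      ⟨k⁻¹ * k', Subgroup.mul_mem _ (Subgroup.inv_mem _ hk) hk', ?_⟩))
    rw [mul_smul, ← h, inv_smul_smul]
  let g₂ : IntegralOrbits F D 2 S₂ → ℂ := fun q => f₂ (Quotient.out q)
  have hg₂ : ∀ q, ∀ x ∈ O₂ q, f₂ x = g₂ q := by
    rintro _ x rfl
    have h1 : (Quotient.mk'' (Quotient.out (Quotient.mk'' x : IntegralOrbits F D 2 S₂)) :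
      IntegralOrbits F D 2 S₂) = Quotient.mk'' x := Quotient.out_eq' _
    obtain ⟨k, hk, h⟩ := integralOrbits_eq_iff.1 h1
    change f₂ x = f₂ (Quotient.out _)
    rw [← h, hf₂ k hk]
  have hg : ∀ q, ∀ x ∈ O q, f x = a * g₂ q := by
    rintro _ x ⟨l, rfl, k, hk, rfl⟩
    rw [hf l k hk, hg₂ _ _ rfl]
  have hg0 : ∀ x, (∀ q, x ∉ O q) → f x = 0 := by
    intro x hx
    by_contra h
    obtain ⟨l, k, hk, hxk⟩ := hf0 x h
    exact hx _ ⟨l, rfl, k, hk, hxk⟩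
  have hsum : Summable fun q => μ.real (O q) * ‖a * g₂ q‖ := by
    have h1 := (summable_of_partition hmeas₂ hd₂ hg₂ hi).mul_left (v / v₂ * ‖a‖)
    refine h1.congr fun q => ?_
    rw [hvol, norm_mul]
    ring
  have hif := integrable_of_partition hmeas hfin hg hg0 hsum
  refine ⟨hif, ?_⟩
  have h1 := hasSum_integral_of_partition hmeas hd hg hg0 hif
  have h3 := hasSum_integral_of_partition hmeas₂ hd₂ hg₂ (fun x hx => absurd rfl (hx _)) hi
  have h4 := h3.mul_left (((v / v₂ : ℝ) : ℂ) * a)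
  rw [← mul_assoc]
  refine h1.unique (h4.congr_fun fun q => ?_)
  rw [hvol, Complex.ofReal_mul]
  ring

end Comparison

end LocalPeriod

namespace LocalPeriod

open Topology Filter

/-! ### The test function supported in the open double coset. -/

section TestFunction

variable {F E D : Type*} [NontriviallyNormedField F] [IsUltrametricDist F] [LocallyCompactSpace F]
  [Field E] [Algebra F E] [FiniteDimensional F E] [DivisionRing D] [Algebra F D]
  [FiniteDimensional F D] [IsDomain (D ⊗[F] E)]
  [TopologicalSpace D] [IsModuleTopology F D]
  [TopologicalSpace (D ⊗[F] E)] [IsModuleTopology F (D ⊗[F] E)]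
  {lam : E} {h0 : 2 * lam ≠ 0} {τ : E ≃ₐ[F] E}

theorem embH_mem_integral {m : ℕ} {k : GLn m D} (hk : k ∈ integralSubgroup F D m) :
    embH F E D m k ∈ integralSubgroup F (D ⊗[F] E) m := by
  have h : ∀ x : D, modAbs F x ≤ 1 → modAbs F (x ⊗ₜ[F] (1 : E)) ≤ 1 := by
    intro x hx
    rw [modAbs_tmul, modAbs_one, one_pow, mul_one]
    exact pow_le_one₀ (modAbs_nonneg x) hx
  intro i j
  rw [embH_apply, embH_inv_apply]
  exact ⟨h _ (hk i j).1, h _ (hk i j).2⟩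

theorem measureReal_orbit_pos (F : Type*) {D : Type*} [NontriviallyNormedField F]
    [IsUltrametricDist F]
    [LocallyCompactSpace F] [DivisionRing D] [Algebra F D] [FiniteDimensional F D]
    [TopologicalSpace D] [IsModuleTopology F D] {m : ℕ}
    (S : Subgroup (GLn m D)) [MeasurableSpace (GLn m D ⧸ S)]
    [BorelSpace (GLn m D ⧸ S)] (μ : Measure (GLn m D ⧸ S)) [μ.Regular]
    [SMulInvariantMeasure (GLn m D) (GLn m D ⧸ S) μ] (hμ : μ ≠ 0) {J : Subgroup (GLn m D)}
    (hJ : IsOpen (J : Set (GLn m D))) (hJ' : IsCompact (J : Set (GLn m D))) (x : GLn m D ⧸ S) :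
    0 < μ.real ((fun k : GLn m D => k • x) '' J) := by
  have := isTopologicalGroup_GLn F (D := D) m
  refine ENNReal.toReal_pos ?_ (isCompact_orbit_mk S hJ' x).measure_ne_top
  exact (measure_isOpen_pos_of_smulInvariant_of_ne_zero (GLn m D) hμ (isOpen_orbit_mk S J hJ x)
    ⟨_, 1, J.one_mem, rfl⟩).ne'

theorem iwasawaModulus_conj_stab (hτ : τ lam = -lam) {r : ℕ} {s : GLn (2 * r) D}
    (hs : s ∈ stab F E D (2 * r) (u0 F E D (2 * r) lam h0)) (g : GLn (2 * r) (D ⊗[F] E)) :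
    iwasawaModulus F (MulAut.conj (u0 F E D (2 * r) lam h0) (embH F E D (2 * r) s) * g) =
      iwasawaModulus F g := by
  rw [iwasawaModulus_left (mem_stab.1 hs), borelModulus_stab hτ hs, one_mul]

theorem orbitFun_phi_mk (hτ : τ lam = -lam) (s : ℂ) (g : GLn 2 D) :
    orbitFun F E D 2 (u0 F E D 2 lam h0) (phi F s) (QuotientGroup.mk g) =
      (iwasawaModulus F (u0 F E D 2 lam h0 * embH F E D 2 g⁻¹) : ℂ) ^ s := by
  refine orbitFun_mk (fun t ht h => ?_) g
  rw [mul_embH_stab, phi, iwasawaModulus_conj_stab (r := 1) hτ ht]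
  rfl

theorem singlePlane_conj_mem_middleParabolic (hτ : τ lam = -lam) {r : ℕ} (i₀ : Fin r)
    (hi₀ : (i₀ : ℕ) + 1 = r) (l : GLn 2 D) :
    MulAut.conj (u0 F E D (2 * r) lam h0) (embH F E D (2 * r) (singlePlane D i₀ l)) ∈
      middleParabolic (D ⊗[F] E) r := by
  rw [conj_mem_middleParabolic_iff hτ]
  refine ⟨Pi.mulSingle i₀ l, rfl, fun i hi => ?_⟩
  rw [Pi.mulSingle_eq_of_ne]
  · exact Subgroup.one_mem _
  · rintro rfl
    omega

/-- Dividing by the unconstrained middle component leaves an element all of whose components lie in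
the stabiliser for `m = 2`. -/
theorem exists_singlePlane_of_conj_mem (hτ : τ lam = -lam) {r : ℕ} (i₀ : Fin r)
    (hi₀ : (i₀ : ℕ) + 1 = r) {h : GLn (2 * r) D}
    (hh : MulAut.conj (u0 F E D (2 * r) lam h0) (embH F E D (2 * r) h) ∈
      middleParabolic (D ⊗[F] E) r) :
    ∃ s ∈ stab F E D (2 * r) (u0 F E D (2 * r) lam h0), ∃ l, h = s * singlePlane D i₀ l := by
  obtain ⟨t, rfl, ht⟩ := (conj_mem_middleParabolic_iff hτ h).1 hh
  refine ⟨planeGL D r (t * (Pi.mulSingle i₀ (t i₀))⁻¹), ?_, t i₀, ?_⟩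
  · rw [mem_stab_iff hτ]
    refine ⟨_, rfl, fun i => ?_⟩
    rw [Pi.mul_apply, Pi.inv_apply]
    by_cases hi : i = i₀
    · subst hi
      rw [Pi.mulSingle_eq_same, mul_inv_cancel]
      exact Subgroup.one_mem _
    · rw [Pi.mulSingle_eq_of_ne hi, inv_one, mul_one]
      refine ht i ?_
      have : (i : ℕ) ≠ i₀ := fun h => hi (Fin.ext h)
      omega
  · rw [map_mul, map_inv]
    exact (inv_mul_cancel_right _ _).symm

variable {r : ℕ}
    [MeasurableSpace (Orbit F E D (2 * r) (u0 F E D (2 * r) lam h0))]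
    [BorelSpace (Orbit F E D (2 * r) (u0 F E D (2 * r) lam h0))]
    [MeasurableSpace (Orbit F E D 2 (u0 F E D 2 lam h0))]
    [BorelSpace (Orbit F E D 2 (u0 F E D 2 lam h0))]

/-- The function `f` supported in `P u₀ H` whose periods reduce to the periods for `m = 2`. -/
theorem exists_test_function (hF : NormIsNormalised F) (h2 : (2 : F) ≠ 0)
    (hE : Module.finrank F E = 2)
    (hlam : lam ∉ Set.range (algebraMap F E)) (hlam2 : lam ^ 2 ∈ Set.range (algebraMap F E))
    (hτ : τ lam = -lam) (hr : 1 ≤ r)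
    (μ : Measure (Orbit F E D (2 * r) (u0 F E D (2 * r) lam h0))) [μ.Regular]
    [SMulInvariantMeasure (GLn (2 * r) D) (Orbit F E D (2 * r) (u0 F E D (2 * r) lam h0)) μ]
    (hμ : μ ≠ 0)
    (μ₂ : Measure (Orbit F E D 2 (u0 F E D 2 lam h0))) [μ₂.Regular]
    [SMulInvariantMeasure (GLn 2 D) (Orbit F E D 2 (u0 F E D 2 lam h0)) μ₂] (hμ₂ : μ₂ ≠ 0)
    {κ : ℝ} (hκ : κ = (modAbs F (2 * lam) / max 1 (modAbs F lam) ^ 2) ^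
      (Module.finrank F D * (r ^ 2 - 1))) :
    ∃ f : GLn (2 * r) (D ⊗[F] E) → ℂ,
      MemInd (middleParabolic (D ⊗[F] E) r) (fun _ => 1) f ∧
      (∀ g, f g ≠ 0 → g ∈ doubleCoset F E D (2 * r) (middleParabolic (D ⊗[F] E) r)
        (u0 F E D (2 * r) lam h0)) ∧
      ∀ s : ℂ, Integrable (orbitFun F E D 2 (u0 F E D 2 lam h0) (phi F s)) μ₂ →
        Integrable (orbitFun F E D (2 * r) (u0 F E D (2 * r) lam h0) fun g => f g * phi F s g) μ ∧
        period F E D (2 * r) (u0 F E D (2 * r) lam h0) μ (fun g => f g * phi F s g) =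
          (κ : ℂ) ^ s * period F E D 2 (u0 F E D 2 lam h0) μ₂ (phi F s) := by
  have := isTopologicalGroup_GLn F (D := D) (2 * r)
  have := IsModuleTopology.isTopologicalRing F (D ⊗[F] E)
  let i₀ : Fin r := ⟨r - 1, by omega⟩
  have hi₀ : (i₀ : ℕ) + 1 = r := by
    change r - 1 + 1 = r
    omega
  set P := middleParabolic (D ⊗[F] E) r with hP
  set K := integralSubgroup F D (2 * r) with hK
  obtain ⟨v, hv⟩ : ∃ v : ℝ, v = μ.real ((fun k : GLn (2 * r) D => k • (QuotientGroup.mk 1 :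
        Orbit F E D (2 * r) (u0 F E D (2 * r) lam h0))) '' integralSubgroup F D (2 * r)) := ⟨_, rfl⟩
  obtain ⟨v₂, hv₂⟩ : ∃ v : ℝ, v = μ₂.real ((fun k : GLn 2 D => k • (QuotientGroup.mk 1 :
        Orbit F E D 2 (u0 F E D 2 lam h0))) '' integralSubgroup F D 2) := ⟨_, rfl⟩
  have hvpos : 0 < v := by
    rw [hv]
    exact measureReal_orbit_pos F _ μ hμ (isOpen_integralSubgroup _)
      (isCompact_integralSubgroup _) _
  have hvpos₂ : 0 < v₂ := by
    rw [hv₂]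
    exact measureReal_orbit_pos F _ μ₂ hμ₂ (isOpen_integralSubgroup _)
      (isCompact_integralSubgroup _) _
  let U : Set (GLn (2 * r) (D ⊗[F] E)) := {g | ∃ p ∈ P, ∃ h ∈ K, g = p * u0 F E D (2 * r) lam h0 *
      embH F E D (2 * r) h}
  have hUo : IsOpen U := isOpen_middleParabolic_mul h2 hE hlam hτ K (isOpen_integralSubgroup _)
  let C : Set (GLn (2 * r) (D ⊗[F] E)) := (fun h => u0 F E D (2 * r) lam h0 * embH F E D (2 * r) h)
      '' K
  have hC : IsCompact C := (isCompact_integralSubgroup (2 * r)).image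
    (continuous_const.mul (continuous_embH (2 * r)))
  have hUC : ∀ g, g ∈ U ↔ ∃ p ∈ P, ∃ c ∈ C, g = p * c := by
    intro g
    constructor
    · rintro ⟨p, hp, h, hh, rfl⟩
      exact ⟨p, hp, _, ⟨h, hh, rfl⟩, mul_assoc _ _ _⟩
    · rintro ⟨p, hp, _, ⟨h, hh, rfl⟩, rfl⟩
      exact ⟨p, hp, h, hh, (mul_assoc _ _ _).symm⟩
  -- The constant `v₂ / v` compensates the ratio of volumes in `integral_comparison`, so that the
  -- periods differ by `κ ^ s` alone.
  let f : GLn (2 * r) (D ⊗[F] E) → ℂ := U.indicator fun _ => ((v₂ / v : ℝ) : ℂ)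
  have hf : MemInd P (fun _ => 1) f := memInd_indicator P C hC U hUo hUC _
  refine ⟨f, hf, ?_, ?_⟩
  · intro g hg
    obtain ⟨p, hp, h, -, e⟩ := Set.mem_of_indicator_ne_zero hg
    exact ⟨p, hp, h, e⟩
  intro s hi
  have hmk : ∀ g : GLn (2 * r) D, orbitFun F E D (2 * r) (u0 F E D (2 * r) lam h0) (fun g => f g *
      phi F s g)
      (QuotientGroup.mk g) = f (u0 F E D (2 * r) lam h0 * embH F E D (2 * r) g⁻¹) * phi F s (u0 F E
          D (2 * r) lam h0 * embH F E D (2 * r) g⁻¹) := by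
    refine orbitFun_mk fun t ht h => ?_
    rw [mul_embH_stab, phi, iwasawaModulus_conj_stab hτ ht,
      hf.equivariant _ (minParabolic_le_middleParabolic _ r (mem_stab.1 ht)), one_mul]
    rfl
  have hA : ∀ k ∈ integralSubgroup F D 2, ∀ x, orbitFun F E D 2 (u0 F E D 2 lam h0) (phi F s) (k •
      x) = orbitFun F E D 2 (u0 F E D 2 lam h0) (phi F s) x := by
    intro k hk x
    obtain ⟨g, rfl⟩ := QuotientGroup.mk_surjective x
    have h1 : k • (QuotientGroup.mk g : Orbit F E D 2 (u0 F E D 2 lam h0)) = QuotientGroup.mk (k *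
        g) := rfl
    rw [h1, orbitFun_phi_mk hτ, orbitFun_phi_mk hτ, mul_inv_rev, map_mul, ← mul_assoc,
      iwasawaModulus_right (embH_mem_integral (Subgroup.inv_mem _ hk))]
  have hB : ∀ l : GLn 2 D, ∀ k ∈ integralSubgroup F D (2 * r),
      orbitFun F E D (2 * r) (u0 F E D (2 * r) lam h0) (fun g => f g * phi F s g)
        (k • QuotientGroup.mk (singlePlane D i₀ l)⁻¹) =
      ((v₂ / v : ℝ) : ℂ) * (κ : ℂ) ^ s * orbitFun F E D 2 (u0 F E D 2 lam h0) (phi F s)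
          (QuotientGroup.mk l⁻¹) := by
    intro l k hk
    have h1 : k • (QuotientGroup.mk (singlePlane D i₀ l)⁻¹ : Orbit F E D (2 * r) (u0 F E D (2 * r)
        lam h0)) =
      QuotientGroup.mk (k * (singlePlane D i₀ l)⁻¹) := rfl
    rw [h1, hmk, orbitFun_phi_mk hτ, mul_inv_rev, inv_inv, inv_inv, mul_assoc]
    congr 1
    · refine Set.indicator_of_mem ?_ _
      refine ⟨_, singlePlane_conj_mem_middleParabolic (h0 := h0) hτ i₀ hi₀ l, k⁻¹,
        Subgroup.inv_mem _ hk, ?_⟩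
      rw [map_mul, MulAut.conj_apply]
      group
    -- Nonnegativity of both factors is what makes the complex power of their product split.
    · have hx : 0 ≤ modAbs F (2 * lam) := modAbs_nonneg _
      have ht : 0 ≤ iwasawaModulus F (u0 F E D 2 lam h0 * embH F E D 2 l) := by
        obtain ⟨p, hp, k, hk, h⟩ := exists_iwasawa_embH_two (h0 := h0) hE hlam hlam2 l
        rw [h, iwasawaModulus_mul hp hk]
        exact (borelModulus_pos hp).le
      rw [phi, map_mul, ← mul_assoc, iwasawaModulus_right (embH_mem_integral (Subgroup.inv_mem _
          hk)),
        iwasawaModulus_singlePlane hE hlam hlam2 i₀ hi₀ l, ← hκ, Complex.ofReal_mul,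
        Complex.mul_cpow_ofReal_nonneg (by rw [hκ]; positivity) ht]
  have hC' : ∀ x, orbitFun F E D (2 * r) (u0 F E D (2 * r) lam h0) (fun g => f g * phi F s g) x ≠ 0
      →
      ∃ l : GLn 2 D, ∃ k ∈ integralSubgroup F D (2 * r),
      x = k • QuotientGroup.mk (singlePlane D i₀ l)⁻¹ := by
    intro x hx
    obtain ⟨g, rfl⟩ := QuotientGroup.mk_surjective x
    rw [hmk] at hx
    obtain ⟨p, hp, h, hh, e⟩ := Set.mem_of_indicator_ne_zero (left_ne_zero_of_mul hx)
    -- From `u₀ g⁻¹ = p u₀ h` one gets `u₀ (g⁻¹ h⁻¹) u₀⁻¹ = p`, so `g⁻¹ h⁻¹` is a stabiliser element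
    -- times one from the middle plane.
    have h1 : MulAut.conj (u0 F E D (2 * r) lam h0) (embH F E D (2 * r) (g⁻¹ * h⁻¹)) ∈ P := by
      have : MulAut.conj (u0 F E D (2 * r) lam h0) (embH F E D (2 * r) (g⁻¹ * h⁻¹)) = p := by
        rw [MulAut.conj_apply, map_mul, ← mul_assoc, e, map_inv]
        group
      rw [this]
      exact hp
    obtain ⟨t, ht, l, hl⟩ := exists_singlePlane_of_conj_mem hτ i₀ hi₀ h1
    refine ⟨l, h⁻¹, Subgroup.inv_mem _ hh, ?_⟩
    change (QuotientGroup.mk g : Orbit F E D (2 * r) (u0 F E D (2 * r) lam h0)) =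
      QuotientGroup.mk (h⁻¹ * (singlePlane D i₀ l)⁻¹)
    rw [QuotientGroup.eq]
    have : g⁻¹ * (h⁻¹ * (singlePlane D i₀ l)⁻¹) = t := by
      rw [← mul_assoc, hl, mul_inv_cancel_right]
    rw [this]
    exact ht
  obtain ⟨hi1, hi2⟩ := integral_comparison hF h2 hE hlam hlam2 hτ i₀ μ μ₂ hv hv₂ hvpos₂.ne'
    (f := orbitFun F E D (2 * r) (u0 F E D (2 * r) lam h0) fun g => f g * phi F s g)
    (f₂ := orbitFun F E D 2 (u0 F E D 2 lam h0) (phi F s)) (((v₂ / v : ℝ) : ℂ) * (κ : ℂ) ^ s) hA hB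
        hC' hi
  refine ⟨hi1, ?_⟩
  rw [period, hi2, period, ← mul_assoc, ← mul_assoc, ← Complex.ofReal_mul,
    div_mul_div_comm, mul_comm v₂ v, div_self (mul_pos hvpos hvpos₂).ne', Complex.ofReal_one,
    one_mul]

end TestFunction

end LocalPeriod

namespace LocalPeriod

open Topology Filter

/-! ### Coordinates on the orbit for `m = 2`. -/

section Coordinates

variable {F E D : Type*} [NontriviallyNormedField F] [IsUltrametricDist F] [LocallyCompactSpace F]
  [Field E] [Algebra F E] [FiniteDimensional F E] [DivisionRing D] [Algebra F D]
  [FiniteDimensional F D] [IsDomain (D ⊗[F] E)]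
  [TopologicalSpace D] [IsModuleTopology F D]
  [TopologicalSpace (D ⊗[F] E)] [IsModuleTopology F (D ⊗[F] E)]
  {lam : E} {h0 : 2 * lam ≠ 0}

theorem affineGL_mul (b b' : D) (c c' : Dˣ) :
    affineGL b c * affineGL b' c' = affineGL (b' + b * c') (c * c') := by
  apply Units.ext
  rw [Units.val_mul, affineGL_val, affineGL_val, affineGL_val]
  ext i j
  fin_cases i <;> fin_cases j <;> simp [Matrix.mul_apply, Fin.sum_univ_two]

theorem affineGL_inv (b : D) (c : Dˣ) : (affineGL b c)⁻¹ = affineGL (-(b * ↑c⁻¹)) c⁻¹ := by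
  rw [inv_eq_iff_mul_eq_one, affineGL_mul]
  apply Units.ext
  rw [affineGL_val]
  ext i j
  fin_cases i <;> fin_cases j <;> simp

theorem affineGL_mem_integral {b : D} {c : Dˣ} (hb : modAbs F b ≤ 1) (hc : modAbs F (c : D) = 1) :
    affineGL b c ∈ integralSubgroup F D 2 := by
  intro i j
  rw [affineGL_inv, affineGL_val, affineGL_val]
  have h1 : modAbs F ((c⁻¹ : Dˣ) : D) = 1 := by rw [modAbs_units_inv, hc, inv_one]
  have h2 : modAbs F (1 : D) = 1 := modAbs_one
  have h3 : modAbs F (0 : D) = 0 := modAbs_zero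
  have h4 : modAbs F (-(b * ((c⁻¹ : Dˣ) : D))) ≤ 1 := by
    rwa [modAbs_neg, modAbs_mul, h1, mul_one]
  fin_cases i <;> fin_cases j
  · exact ⟨h2.le, h2.le⟩
  · exact ⟨hb, h4⟩
  · exact ⟨h3.le.trans zero_le_one, h3.le.trans zero_le_one⟩
  · exact ⟨hc.le, h1.le⟩

/-- Coordinates on the orbit for `m = 2`. -/
theorem exists_orbit_coord (hE : Module.finrank F E = 2)
    (hlam : lam ∉ Set.range (algebraMap F E)) :
    ∃ coord : Orbit F E D 2 (u0 F E D 2 lam h0) → D × D, Continuous coord ∧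
      ∀ (b : D) (c : Dˣ), coord (QuotientGroup.mk (affineGL b c)⁻¹) = (b, (c : D)) := by
  have := IsModuleTopology.isTopologicalRing F (D ⊗[F] E)
  have := isTopologicalGroup_GLn F (D := D) 2
  have hbij := pairMap_bijective (D := D) hE hlam
  let L : (D × D) ≃ₗ[F] D ⊗[F] E := LinearEquiv.ofBijective (pairMap F D lam) hbij
  have hLc : Continuous L.symm := continuous_linear_of_moduleTopology L.symm.toLinearMap
  have hrow : ∀ (g : GLn 2 D) (j : Fin 2), (u0 F E D 2 lam h0 * embH F E D 2 g).val 1 j =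
      pairMap F D lam (g.val 0 j, g.val 1 j) := u0_two_mul_embH_bottom
  have hunit : ∀ g : GLn 2 D, ∃ x : (D ⊗[F] E)ˣ, (x : D ⊗[F] E) =
      (u0 F E D 2 lam h0 * embH F E D 2 g).val 1 0 := by
    intro g
    refine FiniteDimensional.isUnit F ?_
    rw [hrow]
    intro h
    have h1 : (g.val 0 0, g.val 1 0) = (0, 0) := hbij.1 (h.trans (map_zero _).symm)
    have h2 : ((g⁻¹).val * g.val) 0 0 = 1 := by rw [Units.inv_mul]; rfl
    rw [Matrix.mul_apply, Fin.sum_univ_two, (Prod.mk.inj h1).1, (Prod.mk.inj h1).2] at h2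
    simp at h2
  choose x hx using hunit
  have hentry : ∀ i j, Continuous fun g : GLn 2 D => g.val i j := fun i j =>
    Units.continuous_val.matrix_elem i j
  have hrowc : ∀ j, Continuous fun g : GLn 2 D =>
      (u0 F E D 2 lam h0 * embH F E D 2 g).val 1 j := by
    intro j
    simp only [hrow]
    exact (continuous_linear_of_moduleTopology (pairMap F D lam)).comp
      ((hentry 0 j).prodMk (hentry 1 j))
  have hxc : Continuous x := by
    refine (isOpenEmbedding_units_val F (C := D ⊗[F] E)).isInducing.continuous_iff.2 ?_
    exact (hrowc 0).congr fun g => (hx g).symm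
  -- The stabiliser multiplies the bottom row of `u₀ g` by a unit on the left. The first entry
  -- inverted times the second is thus a function on the orbit, and at `(1, b; 0, c)` it equals `b +
  -- c lam`.
  let z : GLn 2 D → D ⊗[F] E := fun g =>
    ((x g)⁻¹ : (D ⊗[F] E)ˣ) * (u0 F E D 2 lam h0 * embH F E D 2 g).val 1 1
  have hzc : Continuous z := (Units.continuous_val.comp hxc.inv).mul (hrowc 1)
  have hzs : ∀ s ∈ stab F E D 2 (u0 F E D 2 lam h0), ∀ g, z (s * g) = z g := by
    intro s hs g
    set a := (MulAut.conj (u0 F E D 2 lam h0) (embH F E D 2 s)).val 1 1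
    have h1 : ∀ j, (u0 F E D 2 lam h0 * embH F E D 2 (s * g)).val 1 j =
        a * (u0 F E D 2 lam h0 * embH F E D 2 g).val 1 j := by
      intro j
      rw [mul_embH_stab, Units.val_mul, Matrix.mul_apply, Fin.sum_univ_two,
        (mem_minParabolic_two.1 (mem_stab.1 hs)).1, zero_mul, zero_add]
    have h2 : (x (s * g) : D ⊗[F] E) = a * x g := by rw [hx, hx, h1]
    simp only [z]
    rw [h1, Units.inv_mul_eq_iff_eq_mul, h2, mul_assoc, Units.mul_inv_cancel_left]
  refine ⟨Quotient.lift (fun g => L.symm (z g⁻¹)) ?_, ?_, ?_⟩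
  · intro g g' h
    have h1 : g⁻¹ * g' ∈ stab F E D 2 (u0 F E D 2 lam h0) := QuotientGroup.leftRel_apply.1 h
    have h2 := hzs _ h1 g'⁻¹
    rw [mul_inv_cancel_right] at h2
    change L.symm (z g⁻¹) = L.symm (z g'⁻¹)
    rw [h2]
  · exact (hLc.comp (hzc.comp continuous_inv)).quotient_lift _
  · intro b c
    change L.symm (z ((affineGL b c)⁻¹)⁻¹) = _
    rw [inv_inv, LinearEquiv.symm_apply_eq]
    change ((x (affineGL b c))⁻¹ : (D ⊗[F] E)ˣ) *
      (u0 F E D 2 lam h0 * embH F E D 2 (affineGL b c)).val 1 1 = pairMap F D lam (b, (c : D))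
    have h1 : x (affineGL b c) = 1 := by
      apply Units.ext
      rw [hx, u0_two_mul_affine]
      rfl
    rw [h1, inv_one, Units.val_one, one_mul, u0_two_mul_affine]
    rfl

theorem exists_mk_affine (hE : Module.finrank F E = 2)
    (hlam : lam ∉ Set.range (algebraMap F E)) (hlam2 : lam ^ 2 ∈ Set.range (algebraMap F E))
    (x : Orbit F E D 2 (u0 F E D 2 lam h0)) :
    ∃ (b : D) (c : Dˣ), x = QuotientGroup.mk (affineGL b c)⁻¹ := by
  obtain ⟨g, rfl⟩ := QuotientGroup.mk_surjective x
  obtain ⟨s, hs, b, c, h⟩ := exists_stab_mul_affine (h0 := h0) hE hlam hlam2 g⁻¹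
  refine ⟨b, c, ?_⟩
  rw [QuotientGroup.eq, h, mul_assoc, mul_inv_cancel, mul_one]
  exact hs

/-- Distance of `lam` to `D`, and the absolute value of `b + lam c`. -/
theorem exists_nearest (hE : Module.finrank F E = 2) (hlam : lam ∉ Set.range (algebraMap F E)) :
    ∃ b₀ : D, ∃ ρ : ℝ, 0 < ρ ∧ ρ = modAbs F (pairMap F D lam (b₀, 1)) ∧
      ∀ b c : D, modAbs F (pairMap F D lam (b, c)) =
        max (modAbs F (b - b₀ * c) ^ 2) (ρ * modAbs F c ^ 2) := by
  have htens : ∀ x : D, modAbs F (x ⊗ₜ[F] (1 : E)) = modAbs F x ^ 2 := by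
    intro x
    rw [modAbs_tmul, modAbs_one, one_pow, mul_one, hE]
  have hc : Continuous fun b : D => modAbs F (pairMap F D lam (b, 1)) :=
    continuous_modAbs.comp ((continuous_linear_of_moduleTopology (pairMap F D lam)).comp
      (by fun_prop))
  set t := modAbs F (pairMap F D lam (0, 1)) with ht
  have ht0 : 0 ≤ t := modAbs_nonneg _
  -- A minimum over this ball is global: if `|b| > √t`, then `|b ⊗ 1| = |b|²` exceeds `t = |lam|`,
  -- so `|b + lam| = |b|² > t`, and `t` is already attained at `b = 0`.
  obtain ⟨b₀, hb₀, hmin⟩ := (isCompact_modAbs_le (F := F) (B := D) (Real.sqrt t)).exists_isMinOn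
    ⟨0, by
      change modAbs F (0 : D) ≤ _
      rw [modAbs_zero]
      exact Real.sqrt_nonneg _⟩ hc.continuousOn
  have hadd : ∀ b b' c c' : D, pairMap F D lam (b, c) + pairMap F D lam (b', c') =
      pairMap F D lam (b + b', c + c') := by
    intro b b' c c'
    rw [← map_add]
    rfl
  have hleft : ∀ b : D, pairMap F D lam (b, 0) = b ⊗ₜ[F] (1 : E) := by
    intro b
    rw [pairMap_apply, TensorProduct.zero_tmul, add_zero]
  have hmin' : ∀ b : D, modAbs F (pairMap F D lam (b₀, 1)) ≤ modAbs F (pairMap F D lam (b, 1)) := by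
    intro b
    by_cases hb : modAbs F b ≤ Real.sqrt t
    · exact hmin hb
    · have h1 : t < modAbs F (pairMap F D lam (b, 0)) := by
        rw [hleft, htens]
        exact (Real.sqrt_lt' ((Real.sqrt_nonneg t).trans_lt (not_le.1 hb))).1 (not_le.1 hb)
      have h2 := modAbs_add_eq_of_lt h1
      rw [hadd, zero_add, add_zero] at h2
      rw [h2]
      have h3 : modAbs F (pairMap F D lam (b₀, 1)) ≤ t := hmin (by
        change modAbs F (0 : D) ≤ _
        rw [modAbs_zero]
        exact Real.sqrt_nonneg _)
      exact h3.trans h1.le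
  refine ⟨b₀, _, ?_, rfl, ?_⟩
  · refine modAbs_pos ?_
    intro h
    have := (pairMap_bijective (D := D) hE hlam).1 (h.trans (map_zero _).symm)
    exact one_ne_zero (Prod.mk.inj this).2
  · intro b c
    have hmul : ∀ b' : D, pairMap F D lam (b', 1) * (c ⊗ₜ[F] (1 : E)) =
        pairMap F D lam (b' * c, c) := by
      intro b'
      rw [pairMap_apply, pairMap_apply, add_mul, Algebra.TensorProduct.tmul_mul_tmul,
        Algebra.TensorProduct.tmul_mul_tmul, one_mul, one_mul, mul_one]
    have hsplit : pairMap F D lam (b, c) =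
        pairMap F D lam (b - b₀ * c, 0) + pairMap F D lam (b₀ * c, c) := by
      rw [hadd, sub_add_cancel, zero_add]
    have hr : modAbs F (pairMap F D lam (b₀ * c, c)) =
        modAbs F (pairMap F D lam (b₀, 1)) * modAbs F c ^ 2 := by
      rw [← hmul, modAbs_mul, htens]
    have hl : modAbs F (pairMap F D lam (b - b₀ * c, 0)) = modAbs F (b - b₀ * c) ^ 2 := by
      rw [hleft, htens]
    -- For `c ≠ 0`, factoring `c` out on the right reduces the inequality to the minimality of `b₀`.
    have hge : modAbs F (pairMap F D lam (b₀ * c, c)) ≤ modAbs F (pairMap F D lam (b, c)) := by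
      rcases eq_or_ne c 0 with rfl | hc0
      · rw [mul_zero, show pairMap F D lam ((0 : D), (0 : D)) = 0 from map_zero _,
          modAbs_zero]
        exact modAbs_nonneg _
      · have : pairMap F D lam (b, c) = pairMap F D lam (b * c⁻¹, 1) * (c ⊗ₜ[F] (1 : E)) := by
          rw [hmul, inv_mul_cancel_right₀ hc0]
        rw [this, ← hmul, modAbs_mul, modAbs_mul]
        exact mul_le_mul_of_nonneg_right (hmin' _) (modAbs_nonneg _)
    rw [← hr, ← hl]
    refine le_antisymm ?_ (max_le ?_ hge)
    · rw [hsplit]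
      exact modAbs_add_le _ _
    -- If the sum were smaller than the first summand, that summand, being the sum minus the second
    -- one, would be bounded by the sum as well.
    · by_contra! hlt
      have h1 := modAbs_sub_le (F := F) (pairMap F D lam (b, c)) (pairMap F D lam (b₀ * c, c))
      rw [hsplit, add_sub_cancel_right, ← hsplit] at h1
      exact absurd (h1.trans (max_le le_rfl hge)) (not_le.2 hlt)

end Coordinates

end LocalPeriod

namespace LocalPeriod

open Topology Filter

/-! ### Volumes of the cells. -/

section CellVolumes

variable {F E D : Type*} [NontriviallyNormedField F] [IsUltrametricDist F] [LocallyCompactSpace F]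
  [Field E] [Algebra F E] [FiniteDimensional F E] [DivisionRing D] [Algebra F D]
  [FiniteDimensional F D] [IsDomain (D ⊗[F] E)]
  [TopologicalSpace D] [IsModuleTopology F D]
  [TopologicalSpace (D ⊗[F] E)] [IsModuleTopology F (D ⊗[F] E)]
  {lam : E} {h0 : 2 * lam ≠ 0}

/-- A measure decomposes over the cosets in a ball when it is invariant under translations. -/
theorem measure_ball_eq_relIndex_mul {X : Type*} [MeasurableSpace X] (μ : Measure X) {A : Type*}
    [AddCommGroup A] (B B' : AddSubgroup A) (hBB' : B ≤ B') (hne : B.relIndex B' ≠ 0)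
    (W : Set X) (y : X → A)
    (hm : ∀ a, MeasurableSet {x | x ∈ W ∧ y x - a ∈ B})
    (hinv : ∀ a, μ {x | x ∈ W ∧ y x - a ∈ B} = μ {x | x ∈ W ∧ y x ∈ B}) :
    μ {x | x ∈ W ∧ y x ∈ B'} = B.relIndex B' * μ {x | x ∈ W ∧ y x ∈ B} := by
  have hfi : (B.addSubgroupOf B').FiniteIndex := ⟨hne⟩
  have : Fintype (B' ⧸ B.addSubgroupOf B') := AddSubgroup.fintypeQuotientOfFiniteIndex
  let T : (B' ⧸ B.addSubgroupOf B') → Set X := fun q => {x | x ∈ W ∧ y x - (q.out : B') ∈ B}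
  have hT : {x | x ∈ W ∧ y x ∈ B'} = ⋃ q, T q := by
    ext x
    simp only [Set.mem_ofPred_eq, Set.mem_iUnion, T]
    constructor
    · rintro ⟨hx, hy⟩
      refine ⟨QuotientAddGroup.mk ⟨y x, hy⟩, hx, ?_⟩
      have h1 := QuotientAddGroup.out_eq' (QuotientAddGroup.mk (s := B.addSubgroupOf B') ⟨y x, hy⟩)
      have h2 := QuotientAddGroup.eq.1 h1
      rw [AddSubgroup.mem_addSubgroupOf] at h2
      rw [sub_eq_neg_add]
      exact h2
    · rintro ⟨q, hx, hq⟩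
      refine ⟨hx, ?_⟩
      have := B'.add_mem (hBB' hq) q.out.2
      rwa [sub_add_cancel] at this
  have hd : Pairwise (Function.onFun Disjoint T) := by
    intro q q' hqq'
    refine Set.disjoint_left.2 ?_
    rintro x ⟨_, h1⟩ ⟨_, h2⟩
    refine hqq' ?_
    rw [← QuotientAddGroup.out_eq' q, ← QuotientAddGroup.out_eq' q']
    refine QuotientAddGroup.eq.2 ?_
    rw [AddSubgroup.mem_addSubgroupOf]
    have := B.sub_mem h1 h2
    rw [sub_sub_sub_cancel_left] at this
    rw [AddSubgroup.coe_add, AddSubgroup.coe_neg, ← sub_eq_neg_add]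
    exact this
  rw [hT, measure_iUnion hd fun q => hm _, tsum_fintype]
  simp only [T, hinv, Finset.sum_const, nsmul_eq_mul, Finset.card_univ]
  congr 2
  rw [← Nat.card_eq_fintype_card]
  rfl

variable
    [MeasurableSpace (Orbit F E D 2 (u0 F E D 2 lam h0))]
    [BorelSpace (Orbit F E D 2 (u0 F E D 2 lam h0))]

/-- Volumes of the cells in the orbit for `m = 2`. -/
theorem exists_cell_volume (hF : NormIsNormalised F)
    (hE : Module.finrank F E = 2)
    (hlam : lam ∉ Set.range (algebraMap F E)) (hlam2 : lam ^ 2 ∈ Set.range (algebraMap F E))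
    (μ₂ : Measure (Orbit F E D 2 (u0 F E D 2 lam h0))) [μ₂.Regular]
    [SMulInvariantMeasure (GLn 2 D) (Orbit F E D 2 (u0 F E D 2 lam h0)) μ₂] (hμ₂ : μ₂ ≠ 0)
    {coord : Orbit F E D 2 (u0 F E D 2 lam h0) → D × D} (hcont : Continuous coord)
    (hcoord : ∀ (b : D) (c : Dˣ), coord (QuotientGroup.mk (affineGL b c)⁻¹) = (b, (c : D)))
    (b₀ : D) {e : ℕ} (hu : ∃ u : Dˣ, modAbs F (u : D) = ((residueCard F : ℝ) ^ e))
    (hgen : ∀ x : D, x ≠ 0 → ∃ n : ℤ, modAbs F x = ((residueCard F : ℝ) ^ e) ^ n) :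
    ∃ v : ℝ, 0 < v ∧ ∀ γ k : ℤ,
      MeasurableSet {x | modAbs F (coord x).2 = ((residueCard F : ℝ) ^ e) ^ γ ∧
        modAbs F ((coord x).1 - b₀ * (coord x).2) ≤ ((residueCard F : ℝ) ^ e) ^ k} ∧
      μ₂ {x | modAbs F (coord x).2 = ((residueCard F : ℝ) ^ e) ^ γ ∧
        modAbs F ((coord x).1 - b₀ * (coord x).2) ≤ ((residueCard F : ℝ) ^ e) ^ k} ≠ ⊤ ∧
      μ₂.real {x | modAbs F (coord x).2 = ((residueCard F : ℝ) ^ e) ^ γ ∧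
        modAbs F ((coord x).1 - b₀ * (coord x).2) ≤ ((residueCard F : ℝ) ^ e) ^ k} =
        v * ((residueCard F : ℝ) ^ e) ^ (k - γ) := by
  have := IsModuleTopology.isTopologicalRing F D
  have := isTopologicalGroup_GLn F (D := D) 2
  have hq0 : (0 : ℝ) < residueCard F := by
    have := two_le_residueCard (F := F)
    positivity
  have hQ0 : 0 < (residueCard F : ℝ) ^ e := by positivity
  obtain ⟨Q, hQ⟩ : ∃ Q : ℝ, Q = (residueCard F : ℝ) ^ e := ⟨_, rfl⟩
  rw [← hQ] at hu hgen hQ0 ⊢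
  set V : ℤ → ℤ → Set (Orbit F E D 2 (u0 F E D 2 lam h0)) := fun γ k =>
    {x | modAbs F (coord x).2 = Q ^ γ ∧ modAbs F ((coord x).1 - b₀ * (coord x).2) ≤ Q ^ k} with hV
  have hrep := exists_mk_affine (h0 := h0) (D := D) hE hlam hlam2
  -- In coordinates, affine elements act by right scaling of both `b` and `c`, followed by a
  -- translation of `b`. These two motions determine all cell volumes from one.
  have hact : ∀ (b' : D) (c' : Dˣ) x, coord ((affineGL b' c')⁻¹ • x) =
      (b' + (coord x).1 * c', (coord x).2 * c') := by
    intro b' c' x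
    obtain ⟨b, c, rfl⟩ := hrep x
    have h1 : (affineGL b' c')⁻¹ • (QuotientGroup.mk (affineGL b c)⁻¹ :
        Orbit F E D 2 (u0 F E D 2 lam h0)) =
        QuotientGroup.mk (affineGL (b' + b * c') (c * c'))⁻¹ := by
      rw [← affineGL_mul, mul_inv_rev]
      rfl
    rw [h1, hcoord, hcoord, Units.val_mul]
  have hc2 : Continuous fun x => (coord x).2 := hcont.snd
  have hcy : Continuous fun x => (coord x).1 - b₀ * (coord x).2 :=
    hcont.fst.sub (continuous_const.mul hcont.snd)
  have hmeasa : ∀ (γ k : ℤ) (a : D), MeasurableSet {x | x ∈ {x | modAbs F (coord x).2 = Q ^ γ} ∧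
      ((coord x).1 - b₀ * (coord x).2) - a ∈ modBall F D (Q ^ k)} := by
    intro γ k a
    have h1 : MeasurableSet {x | modAbs F (coord x).2 = Q ^ γ} :=
      (isClosed_eq (continuous_modAbs.comp hc2) continuous_const).measurableSet
    have h2 : MeasurableSet {x | modAbs F ((coord x).1 - b₀ * (coord x).2 - a) ≤ Q ^ k} :=
      (isClosed_le (continuous_modAbs.comp (hcy.sub continuous_const))
        continuous_const).measurableSet
    convert h1.inter h2 using 1
    ext x
    exact and_congr_right fun _ => mem_modBall F (by positivity)
  have hball : ∀ γ k : ℤ, {x | x ∈ {x | modAbs F (coord x).2 = Q ^ γ} ∧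
      ((coord x).1 - b₀ * (coord x).2) ∈ modBall F D (Q ^ k)} = V γ k := by
    intro γ k
    ext x
    exact and_congr_right fun _ => mem_modBall F (by positivity)
  have hmeas : ∀ γ k, MeasurableSet (V γ k) := by
    intro γ k
    rw [← hball]
    simpa only [sub_zero] using hmeasa γ k 0
  obtain ⟨u, hu⟩ := hu
  -- Scaling by `u ^ γ` multiplies both `|c|` and `|b - b₀ c|` by `Q ^ γ`.
  have hscale : ∀ γ k, μ₂ (V γ k) = μ₂ (V 0 (k - γ)) := by
    intro γ k
    rw [← measure_preimage_smul μ₂ (affineGL 0 (u ^ γ))⁻¹ (V γ k)]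
    congr 1
    ext x
    simp only [V, Set.mem_preimage, Set.mem_ofPred_eq, hact, zero_add, modAbs_mul,
      modAbs_units_zpow, hu, ← mul_assoc, ← sub_mul]
    rw [zpow_zero, mul_eq_right₀ (by positivity), zpow_sub₀ hQ0.ne', le_div_iff₀ (by positivity)]
  -- Translations of `b` permute the cosets of the smaller ball, so the volume grows by the index of
  -- the balls.
  have hstep : ∀ k, μ₂ (V 0 (k + 1)) = (residueCard F ^ e : ℕ) * μ₂ (V 0 k) := by
    intro k
    have hri := relIndex_modBall_generator F D hF ⟨u, hQ ▸ hu⟩ (hQ ▸ hgen) k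
    rw [← hQ] at hri
    have hQ1 : 1 ≤ Q := by
      rw [hQ]
      exact one_le_pow₀ (by exact_mod_cast one_le_two.trans (two_le_residueCard (F := F)))
    have h1 := measure_ball_eq_relIndex_mul μ₂ (modBall F D (Q ^ k)) (modBall F D (Q ^ (k + 1)))
      (modBall_mono F D (zpow_le_zpow_right₀ hQ1 (by omega)))
      (by rw [hri]; have := two_le_residueCard (F := F); positivity)
      {x | modAbs F (coord x).2 = Q ^ (0 : ℤ)} (fun x => (coord x).1 - b₀ * (coord x).2)
      (hmeasa 0 k) ?_
    · rw [hball, hball, hri] at h1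
      exact h1
    · intro a
      rw [← measure_preimage_smul μ₂ (affineGL a 1)⁻¹
        {x | x ∈ {x | modAbs F (coord x).2 = Q ^ (0 : ℤ)} ∧
          (coord x).1 - b₀ * (coord x).2 - a ∈ modBall F D (Q ^ k)}]
      congr 1
      ext x
      simp only [Set.mem_preimage, Set.mem_ofPred_eq, hact, Units.val_one, mul_one]
      have : a + (coord x).1 - b₀ * (coord x).2 - a = (coord x).1 - b₀ * (coord x).2 := by abel
      rw [this]
  -- This cell is contained in the compact `GL(2, O_D)`-orbit of the point `(b₀, 1)`; it has
  -- positive measure because it contains an open neighbourhood of that point.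
  have hfin0 : μ₂ (V 0 0) ≠ ⊤ := by
    have hsub : V 0 0 ⊆ (fun k : GLn 2 D => k • (QuotientGroup.mk (affineGL b₀ 1)⁻¹ :
        Orbit F E D 2 (u0 F E D 2 lam h0))) '' integralSubgroup F D 2 := by
      intro x hx
      obtain ⟨b, c, rfl⟩ := hrep x
      obtain ⟨h1, h2⟩ := hx
      rw [hcoord] at h1 h2
      rw [zpow_zero] at h1 h2
      refine ⟨(affineGL (b - b₀ * c) c)⁻¹,
        Subgroup.inv_mem _ (affineGL_mem_integral h2 h1), ?_⟩
      change (QuotientGroup.mk ((affineGL (b - b₀ * c) c)⁻¹ * (affineGL b₀ 1)⁻¹) :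
        Orbit F E D 2 (u0 F E D 2 lam h0)) = _
      rw [← mul_inv_rev, affineGL_mul, sub_add_cancel, one_mul]
    exact ((measure_mono hsub).trans_lt
      (isCompact_orbit_mk _ (isCompact_integralSubgroup 2) _).measure_lt_top).ne
  have hpos0 : μ₂ (V 0 0) ≠ 0 := by
    have hop : IsOpen {x | modAbs F ((coord x).2 - 1) < 1 ∧
        modAbs F ((coord x).1 - b₀ * (coord x).2) < 1} :=
      (isOpen_lt (continuous_modAbs.comp (hc2.sub continuous_const)) continuous_const).inter
        (isOpen_lt (continuous_modAbs.comp hcy) continuous_const)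
    have hsub : {x | modAbs F ((coord x).2 - 1) < 1 ∧
        modAbs F ((coord x).1 - b₀ * (coord x).2) < 1} ⊆ V 0 0 := by
      rintro x ⟨h1, h2⟩
      refine ⟨?_, by rw [zpow_zero]; exact h2.le⟩
      have h3 := modAbs_add_eq_of_lt (F := F) (x := (coord x).2 - 1) (y := (1 : D))
        (by rw [modAbs_one]; exact h1)
      rw [sub_add_cancel, modAbs_one] at h3
      rw [zpow_zero]
      exact h3
    refine ((measure_isOpen_pos_of_smulInvariant_of_ne_zero (GLn 2 D) hμ₂ hop
      ⟨QuotientGroup.mk (affineGL b₀ 1)⁻¹, ?_⟩).trans_le (measure_mono hsub)).ne'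
    simp only [Set.mem_ofPred_eq, hcoord, Units.val_one, mul_one, sub_self, modAbs_zero]
    exact ⟨one_pos, one_pos⟩
  have hQN : ((residueCard F ^ e : ℕ) : ENNReal) ≠ 0 := by
    have := two_le_residueCard (F := F)
    positivity
  have hfin : ∀ k : ℤ, μ₂ (V 0 k) ≠ ⊤ := by
    intro k
    induction k using Int.induction_on with
    | zero => exact hfin0
    | succ k ih =>
      rw [hstep]
      exact ENNReal.mul_ne_top (ENNReal.natCast_ne_top _) ih
    | pred k ih =>
      intro h
      have h1 := hstep (-(k : ℤ) - 1)
      rw [sub_add_cancel, h, ENNReal.mul_top hQN] at h1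
      exact ih h1
  have hreal : ∀ k : ℤ, μ₂.real (V 0 (k + 1)) = Q * μ₂.real (V 0 k) := by
    intro k
    rw [Measure.real, hstep, ENNReal.toReal_mul, ENNReal.toReal_natCast, hQ, Nat.cast_pow]
    rfl
  have hval : ∀ k : ℤ, μ₂.real (V 0 k) = μ₂.real (V 0 0) * Q ^ k := by
    intro k
    induction k using Int.induction_on with
    | zero => rw [zpow_zero, mul_one]
    | succ k ih => rw [hreal, ih, zpow_add_one₀ hQ0.ne']; ring
    | pred k ih =>
      have h1 := hreal (-(k : ℤ) - 1)
      rw [sub_add_cancel, ih] at h1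
      rw [zpow_sub_one₀ hQ0.ne']
      field_simp
      linarith
  refine ⟨μ₂.real (V 0 0), ENNReal.toReal_pos hpos0 hfin0, fun γ k => ⟨hmeas γ k, ?_, ?_⟩⟩
  · rw [hscale]
    exact hfin _
  · rw [Measure.real, hscale]
    exact hval _

end CellVolumes

end LocalPeriod

namespace LocalPeriod

open Topology Filter

/-! ### The period for `m = 2` as a series over cells. -/

section Cells

/-- Volumes of the cells, up to a constant. -/
def cellWeight (Q : ℝ) : ℤ ⊕ ℤ × ℕ → ℝ
  | .inl _ => 1
  | .inr (_, n) => (Q - 1) * Q ^ n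

/-- Exponents of the values of the spherical modulus on the cells. -/
def cellExponent (e : ℕ) (j c ρ : ℤ) : ℤ ⊕ ℤ × ℕ → ℤ
  | .inl γ => if γ < -j then c + 2 * e * γ else c - 2 * ρ - 2 * e * γ
  | .inr (k, n) => c - 2 * e * (j + n + 1) - 2 * e * |k|

variable {F E D : Type*} [NontriviallyNormedField F] [IsUltrametricDist F] [LocallyCompactSpace F]
  [Field E] [Algebra F E] [FiniteDimensional F E] [DivisionRing D] [Algebra F D]
  [FiniteDimensional F D] [IsDomain (D ⊗[F] E)]
  [TopologicalSpace D] [IsModuleTopology F D]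
  [TopologicalSpace (D ⊗[F] E)] [IsModuleTopology F (D ⊗[F] E)]
  {lam : E} {h0 : 2 * lam ≠ 0} {τ : E ≃ₐ[F] E}
    [MeasurableSpace (Orbit F E D 2 (u0 F E D 2 lam h0))]
    [BorelSpace (Orbit F E D 2 (u0 F E D 2 lam h0))]

theorem ofReal_zpow_cpow {q : ℕ} (hq : 0 < q) (N : ℤ) (s : ℂ) :
    (((q : ℝ) ^ N : ℝ) : ℂ) ^ s = ((q : ℂ) ^ (-s)) ^ (-N) := by
  have hq0 : (q : ℂ) ≠ 0 := Nat.cast_ne_zero.2 hq.ne'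
  have hqr : (0 : ℝ) < q := by exact_mod_cast hq
  have h1 : (((q : ℝ) ^ N : ℝ) : ℂ) ≠ 0 := Complex.ofReal_ne_zero.2 (zpow_pos hqr N).ne'
  rw [Complex.cpow_def_of_ne_zero h1, ← Complex.ofReal_log (zpow_pos hqr N).le, Real.log_zpow,
    Complex.cpow_def_of_ne_zero hq0, ← Complex.natCast_log, ← Complex.exp_int_mul]
  congr 1
  push_cast
  ring

theorem max_zpow_left {q : ℝ} (hq : 1 < q) {e : ℕ} {j ρ γ : ℤ} (hj : 2 * e * j ≤ ρ) {y : ℝ}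
    (hy0 : 0 ≤ y) (hy : y ≤ q ^ ((e : ℤ) * (γ + j))) :
    max (y ^ 2) (q ^ ρ * (q ^ ((e : ℤ) * γ)) ^ 2) = q ^ (ρ + 2 * (e * γ)) := by
  have hq0 : q ≠ 0 := by positivity
  have h1 : q ^ (ρ + 2 * ((e : ℤ) * γ)) = q ^ ρ * (q ^ ((e : ℤ) * γ)) ^ 2 := by
    rw [zpow_add₀ hq0, mul_comm 2 ((e : ℤ) * γ), zpow_mul]
    rfl
  rw [h1]
  refine max_eq_right ?_
  rw [← h1]
  refine (pow_le_pow_left₀ hy0 hy 2).trans ?_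
  rw [← zpow_natCast, ← zpow_mul]
  refine zpow_le_zpow_right₀ hq.le ?_
  push_cast
  linarith

theorem max_zpow_right {q : ℝ} (hq : 1 < q) {e : ℕ} {j ρ k : ℤ} (hj : ρ < 2 * e * (j + 1)) (n : ℕ) :
    max ((q ^ ((e : ℤ) * k)) ^ 2) (q ^ ρ * (q ^ ((e : ℤ) * (k - j - n - 1))) ^ 2) =
      q ^ (2 * ((e : ℤ) * k)) := by
  have hq0 : q ≠ 0 := by positivity
  have h1 : q ^ (2 * ((e : ℤ) * k)) = (q ^ ((e : ℤ) * k)) ^ 2 := by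
    rw [mul_comm 2 ((e : ℤ) * k), zpow_mul]
    rfl
  rw [← h1]
  refine max_eq_left ?_
  rw [← zpow_natCast, ← zpow_mul, ← zpow_add₀ hq0]
  refine zpow_le_zpow_right₀ hq.le ?_
  push_cast
  have : (0 : ℤ) ≤ e * n := by positivity
  linarith

/-- By the two inequalities on `j`, the exponent `ρ + 2 e γ` is negative exactly for `γ < -j`; this
is where `max 1 |b + c lam|` changes its form. -/
theorem cellExponent_inl {e : ℕ} {j c ρ : ℤ} (hj1 : 2 * e * j ≤ ρ) (hj2 : ρ < 2 * e * (j + 1))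
    (γ : ℤ) : c + 2 * (e * γ) - 2 * max 0 (ρ + 2 * (e * γ)) = cellExponent e j c ρ (.inl γ) := by
  rw [cellExponent]
  have he : (0 : ℤ) ≤ e := Int.natCast_nonneg e
  split_ifs with h
  · have h1 : (e : ℤ) * (γ + (j + 1)) ≤ 0 := mul_nonpos_of_nonneg_of_nonpos he (by omega)
    rw [max_eq_left (by linarith)]
    ring
  · have h1 : 0 ≤ (e : ℤ) * (γ + j) := mul_nonneg he (by omega)
    rw [max_eq_right (by linarith)]
    ring

theorem cellExponent_inr {e : ℕ} {j c ρ : ℤ} (k : ℤ) (n : ℕ) :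
    c + 2 * (e * (k - j - n - 1)) - 2 * max 0 (2 * (e * k)) =
      cellExponent e j c ρ (.inr (k, n)) := by
  rw [cellExponent]
  have he : (0 : ℤ) ≤ e := Int.natCast_nonneg e
  rcases le_total 0 k with h | h
  · rw [max_eq_right (by positivity), abs_of_nonneg h]
    ring
  · have h1 : (e : ℤ) * k ≤ 0 := mul_nonpos_of_nonneg_of_nonpos he h
    rw [max_eq_left (by linarith), abs_of_nonpos h]
    ring

/-- The absolute value of `b + lam c` in terms of exponents determines the spherical modulus. -/
theorem iwasawaModulus_affine_eq_zpow (hE : Module.finrank F E = 2) {b : D} {c : Dˣ} {q : ℝ}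
    (hq : 1 < q) {c₀ γ ζ : ℤ} (hc₀ : modAbs F (2 * lam) ^ Module.finrank F D = q ^ c₀)
    (hγ : modAbs F (c : D) = q ^ γ) (hζ : modAbs F (pairMap F D lam (b, c)) = q ^ ζ) :
    iwasawaModulus F (u0 F E D 2 lam h0 * embH F E D 2 (affineGL b c)) =
      q ^ (c₀ + 2 * γ - 2 * max 0 ζ) := by
  have hq0 : q ≠ 0 := by positivity
  have h1 : max 1 (q ^ ζ) = q ^ max 0 ζ := by
    rcases le_total 0 ζ with h | h
    · rw [max_eq_right h, max_eq_right (one_le_zpow₀ hq.le h)]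
    · rw [max_eq_left h, max_eq_left (zpow_le_one_of_nonpos₀ hq.le h), zpow_zero]
  rw [iwasawaModulus_affine hE, hc₀, hγ, hζ, h1, zpow_sub₀ hq0, zpow_add₀ hq0, mul_comm 2 γ,
    mul_comm 2 (max 0 ζ), zpow_mul, zpow_mul, mul_comm (q ^ c₀)]
  rfl

/-- The period for `m = 2` as a series. -/
theorem exists_period_two_series (hF : NormIsNormalised F)
    (hE : Module.finrank F E = 2)
    (hlam : lam ∉ Set.range (algebraMap F E)) (hlam2 : lam ^ 2 ∈ Set.range (algebraMap F E))
    (hτ : τ lam = -lam)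
    (μ₂ : Measure (Orbit F E D 2 (u0 F E D 2 lam h0))) [μ₂.Regular]
    [SMulInvariantMeasure (GLn 2 D) (Orbit F E D 2 (u0 F E D 2 lam h0)) μ₂] (hμ₂ : μ₂ ≠ 0) :
    ∃ (v : ℝ) (e : ℕ) (j c₀ ρ₀ : ℤ), 0 < v ∧ 0 < e ∧ 2 * e * j ≤ ρ₀ ∧
      ∀ (s S : ℂ), HasSum (fun i => (cellWeight ((residueCard F : ℝ) ^ e) i : ℂ) *
          ((residueCard F : ℂ) ^ (-s)) ^ (-cellExponent e j c₀ ρ₀ i)) S →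
        Integrable (orbitFun F E D 2 (u0 F E D 2 lam h0) (phi F s)) μ₂ ∧
        period F E D 2 (u0 F E D 2 lam h0) μ₂ (phi F s) = v * S := by
  obtain ⟨coord, hcont, hcoord⟩ := exists_orbit_coord (D := D) (h0 := h0) hE hlam
  obtain ⟨b₀, ρ, hρpos, hρ, hz⟩ := exists_nearest (D := D) hE hlam
  obtain ⟨e, he, hu, hgen⟩ := exists_modAbs_generator F D hF
  obtain ⟨v, hv, hvol⟩ := exists_cell_volume hF hE hlam hlam2 μ₂ hμ₂ hcont hcoord b₀ hu hgen
  have hrep := exists_mk_affine (h0 := h0) (D := D) hE hlam hlam2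
  have hqN : 1 < residueCard F := two_le_residueCard
  obtain ⟨q, hqdef⟩ : ∃ q : ℝ, q = residueCard F := ⟨_, rfl⟩
  rw [← hqdef] at hu hgen hvol ⊢
  have hq : 1 < q := by rw [hqdef]; exact_mod_cast hqN
  have hq0 : q ≠ 0 := by positivity
  obtain ⟨ρ₀, hρ₀⟩ : ∃ n : ℤ, ρ = q ^ n := by
    rw [hρ, hqdef]
    refine exists_modAbs_eq_zpow F (D ⊗[F] E) hF fun h => ?_
    rw [hρ, h, modAbs_zero] at hρpos
    exact lt_irrefl _ hρpos
  obtain ⟨c₀, hc₀⟩ : ∃ n : ℤ, modAbs F (2 * lam) ^ Module.finrank F D = q ^ n := by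
    obtain ⟨n, hn⟩ := exists_norm_eq_zpow hF
      (fun h => h0 (Algebra.norm_eq_zero_iff.1 h) : Algebra.norm F (2 * lam) ≠ 0)
    refine ⟨n * (Module.finrank F D : ℤ), ?_⟩
    rw [modAbs, hn, zpow_mul, zpow_natCast, hqdef]
  have he0 : (0 : ℤ) < 2 * e := by positivity
  -- With `|c| = Q ^ γ` and `|b - b₀ c| = Q ^ k`, the inequality `|b - b₀ c|² ≤ ρ |c|²` says exactly
  -- `k ≤ γ + j`.
  obtain ⟨j, hj1, hj2⟩ : ∃ j : ℤ, 2 * e * j ≤ ρ₀ ∧ ρ₀ < 2 * e * (j + 1) := by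
    refine ⟨ρ₀ / (2 * e), Int.mul_ediv_self_le he0.ne', ?_⟩
    have := Int.lt_ediv_add_one_mul_self ρ₀ he0
    linarith
  have hzp : ∀ n : ℤ, (q ^ e) ^ n = q ^ ((e : ℤ) * n) := fun n => by
    rw [zpow_mul, zpow_natCast]
  simp only [hzp] at hgen hvol
  have hlt : ∀ {m n : ℤ}, q ^ m < q ^ n ↔ m < n := zpow_lt_zpow_iff_right₀ hq
  have hle : ∀ {m n : ℤ}, q ^ m ≤ q ^ n ↔ m ≤ n := zpow_le_zpow_iff_right₀ hq
  have hinj : ∀ {m n : ℤ}, q ^ m = q ^ n ↔ m = n := zpow_right_inj₀ (by positivity) hq.ne'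
  have heZ : (0 : ℤ) < e := by exact_mod_cast he
  have hele : ∀ {m n : ℤ}, (e : ℤ) * m ≤ e * n ↔ m ≤ n := mul_le_mul_iff_right₀ heZ
  have helt : ∀ {m n : ℤ}, (e : ℤ) * m < e * n ↔ m < n := mul_lt_mul_iff_right₀ heZ
  have heq : ∀ {m n : ℤ}, (e : ℤ) * m = e * n ↔ m = n := mul_right_inj' heZ.ne'
  let V : ℤ → ℤ → Set (Orbit F E D 2 (u0 F E D 2 lam h0)) := fun γ k =>
    {x | modAbs F (coord x).2 = q ^ ((e : ℤ) * γ) ∧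
      modAbs F ((coord x).1 - b₀ * (coord x).2) ≤ q ^ ((e : ℤ) * k)}
  have hVmono : ∀ γ k k', k ≤ k' → V γ k ⊆ V γ k' := by
    rintro γ k k' hk x ⟨h1, h2⟩
    exact ⟨h1, h2.trans (hle.2 (hele.2 hk))⟩
  -- On the cells `inl γ` the term `ρ |c|²` dominates, with `|c| = Q ^ γ`, and the exact value of
  -- `|b - b₀ c|` is irrelevant. On `inr (k, n)` the term `|b - b₀ c|² = Q ^ (2 k)` dominates, and
  -- `n ≥ 0` measures how far `k` exceeds the first exponent `γ + j + 1` past the threshold.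
  let O : ℤ ⊕ ℤ × ℕ → Set (Orbit F E D 2 (u0 F E D 2 lam h0))
    | .inl γ => V γ (γ + j)
    | .inr (k, n) => V (k - j - n - 1) k \ V (k - j - n - 1) (k - 1)
  have hmem : ∀ (k : ℤ) (n : ℕ) x, x ∈ O (.inr (k, n)) →
      modAbs F (coord x).2 = q ^ ((e : ℤ) * (k - j - n - 1)) ∧
      modAbs F ((coord x).1 - b₀ * (coord x).2) = q ^ ((e : ℤ) * k) := by
    rintro k n x ⟨⟨h1, h2⟩, h3⟩
    refine ⟨h1, ?_⟩
    have h4 : q ^ ((e : ℤ) * (k - 1)) < modAbs F ((coord x).1 - b₀ * (coord x).2) := by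
      by_contra! h
      exact h3 ⟨h1, h⟩
    have h5 : (coord x).1 - b₀ * (coord x).2 ≠ 0 := by
      intro h
      rw [h, modAbs_zero] at h4
      exact absurd h4 (by positivity : (0 : ℝ) < q ^ ((e : ℤ) * (k - 1))).not_gt
    obtain ⟨m, hm⟩ := hgen _ h5
    rw [hm] at h2 h4 ⊢
    rw [hle, hele] at h2
    rw [hlt, helt] at h4
    rw [show m = k by omega]
  have hmem' : ∀ (k : ℤ) (n : ℕ) x, modAbs F (coord x).2 = q ^ ((e : ℤ) * (k - j - n - 1)) →
      modAbs F ((coord x).1 - b₀ * (coord x).2) = q ^ ((e : ℤ) * k) → x ∈ O (.inr (k, n)) := by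
    intro k n x h1 h2
    refine ⟨⟨h1, h2.le⟩, fun h => ?_⟩
    have := h.2
    rw [h2, hle, hele] at this
    omega
  have hmeas : ∀ i, MeasurableSet (O i) := by
    rintro (γ | ⟨k, n⟩)
    · exact (hvol _ _).1
    · exact (hvol _ _).1.diff (hvol _ _).1
  have hfin : ∀ i, μ₂ (O i) ≠ ⊤ := by
    rintro (γ | ⟨k, n⟩)
    · exact (hvol _ _).2.1
    · exact ((measure_mono Set.sdiff_subset).trans_lt (hvol _ _).2.1.lt_top).ne
  have hreal : ∀ i, μ₂.real (O i) = v * (q ^ e) ^ j * cellWeight (q ^ e) i := by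
    rintro (γ | ⟨k, n⟩)
    · change μ₂.real (V γ (γ + j)) = _
      rw [(hvol γ (γ + j)).2.2, add_sub_cancel_left, cellWeight, mul_one, hzp]
    · change μ₂.real (V (k - j - n - 1) k \ V (k - j - n - 1) (k - 1)) = _
      rw [measureReal_sdiff (hVmono _ _ _ (by omega)) (hvol _ _).1 (hvol _ _).2.1,
        (hvol _ _).2.2, (hvol _ _).2.2, cellWeight]
      have e1 : k - (k - j - (n : ℤ) - 1) = j + n + 1 := by ring
      have e2 : k - 1 - (k - j - (n : ℤ) - 1) = j + n := by ring
      rw [e1, e2, ← hzp, ← hzp, zpow_add_one₀ (pow_ne_zero _ hq0), zpow_add₀ (pow_ne_zero _ hq0),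
        zpow_natCast]
      ring
  have hd : Pairwise (Function.onFun Disjoint O) := by
    have hlr : ∀ (γ k : ℤ) (n : ℕ) x, x ∈ O (.inl γ) → x ∉ O (.inr (k, n)) := by
      intro γ k n x h h'
      obtain ⟨h1, h2⟩ := h
      obtain ⟨h3, h4⟩ := hmem k n x h'
      rw [h1, hinj, heq] at h3
      rw [h4, hle, hele] at h2
      omega
    rintro (γ | ⟨k, n⟩) (γ' | ⟨k', n'⟩) hne
    · refine Set.disjoint_left.2 fun x h h' => hne ?_
      have h1 := h.1.symm.trans h'.1
      rw [hinj, heq] at h1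
      rw [h1]
    · exact Set.disjoint_left.2 fun x h h' => hlr _ _ _ x h h'
    · exact Set.disjoint_left.2 fun x h h' => hlr _ _ _ x h' h
    · refine Set.disjoint_left.2 fun x h h' => hne ?_
      obtain ⟨h1, h2⟩ := hmem k n x h
      obtain ⟨h3, h4⟩ := hmem k' n' x h'
      rw [h1, hinj, heq] at h3
      rw [h2, hinj, heq] at h4
      have : n = n' := by omega
      rw [h4, this]
  have hcover : ∀ x, ∃ i, x ∈ O i := by
    intro x
    obtain ⟨b, c, rfl⟩ := hrep x
    obtain ⟨γ, hγ⟩ := hgen c c.ne_zero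
    by_cases hy : modAbs F (b - b₀ * c) ≤ q ^ ((e : ℤ) * (γ + j))
    · refine ⟨.inl γ, ?_, ?_⟩
      · rw [hcoord]; exact hγ
      · rw [hcoord]; exact hy
    · have h5 : b - b₀ * (c : D) ≠ 0 := by
        intro h
        rw [h, modAbs_zero] at hy
        exact hy (by positivity)
      obtain ⟨k, hk⟩ := hgen _ h5
      rw [hk, hle, hele, not_le] at hy
      refine ⟨.inr (k, (k - γ - j - 1).toNat), hmem' _ _ _ ?_ ?_⟩
      · rw [hcoord, hγ, hinj, heq, Int.toNat_of_nonneg (by omega)]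
        ring
      · rw [hcoord]; exact hk
  have hval : ∀ (i : ℤ ⊕ ℤ × ℕ) (b : D) (c : Dˣ),
      (QuotientGroup.mk (affineGL b c)⁻¹ : Orbit F E D 2 (u0 F E D 2 lam h0)) ∈ O i →
      iwasawaModulus F (u0 F E D 2 lam h0 * embH F E D 2 (affineGL b c)) =
        q ^ cellExponent e j c₀ ρ₀ i := by
    rintro (γ | ⟨k, n⟩) b c hx
    · obtain ⟨h1, h2⟩ := hx
      rw [hcoord] at h1 h2
      have hζ := hz b c
      rw [h1, hρ₀, max_zpow_left hq hj1 (modAbs_nonneg _) h2] at hζ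
      rw [iwasawaModulus_affine_eq_zpow hE hq hc₀ h1 hζ, cellExponent_inl hj1 hj2]
    · obtain ⟨h1, h2⟩ := hmem _ _ _ hx
      rw [hcoord] at h1 h2
      have hζ := hz b c
      rw [h1, h2, hρ₀, max_zpow_right hq hj2] at hζ
      rw [iwasawaModulus_affine_eq_zpow hE hq hc₀ h1 hζ, cellExponent_inr]
  refine ⟨v * (q ^ e) ^ j, e, j, c₀, ρ₀, by positivity, he, hj1, fun s S hS => ?_⟩
  have hf : ∀ i, ∀ x ∈ O i, orbitFun F E D 2 (u0 F E D 2 lam h0) (phi F s) x =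
      ((residueCard F : ℂ) ^ (-s)) ^ (-cellExponent e j c₀ ρ₀ i) := by
    intro i x hx
    obtain ⟨b, c, rfl⟩ := hrep x
    rw [orbitFun_phi_mk hτ, inv_inv, hval i b c hx, hqdef, ofReal_zpow_cpow (by omega)]
  have hS' := hS.mul_left ((v * (q ^ e) ^ j : ℝ) : ℂ)
  have hi : Integrable (orbitFun F E D 2 (u0 F E D 2 lam h0) (phi F s)) μ₂ := by
    refine integrable_of_partition hmeas hfin hf
      (fun x hx => absurd (hcover x).choose_spec (hx _)) (hS'.summable.norm.congr fun i => ?_)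
    rw [hreal, ← mul_assoc, ← Complex.ofReal_mul, norm_mul, Complex.norm_real, ← hreal,
      Real.norm_of_nonneg measureReal_nonneg]
  refine ⟨hi, (hasSum_integral_of_partition hmeas hd hf
    (fun x hx => absurd (hcover x).choose_spec (hx _)) hi).unique (hS'.congr_fun fun i => ?_)⟩
  rw [hreal, ← mul_assoc, ← Complex.ofReal_mul]

end Cells

end LocalPeriod

namespace LocalPeriod

open Topology Filter

/-! ### Summation of the series and its value at `s = 0`. -/

section Series

theorem hasSum_natAbs {x : ℂ} (hx : ‖x‖ < 1) :
    HasSum (fun k : ℤ => x ^ k.natAbs) ((1 + x) / (1 - x)) := by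
  have h1 := hasSum_geometric_of_norm_lt_one hx
  have h2 : HasSum (fun n : ℕ => x ^ (n + 1)) (x * (1 - x)⁻¹) := by
    simpa only [pow_succ'] using h1.mul_left x
  have h3 : HasSum (fun k : ℤ => x ^ k.natAbs) ((1 - x)⁻¹ + x * (1 - x)⁻¹) := by
    refine HasSum.of_nat_of_neg_add_one (f := fun k : ℤ => x ^ k.natAbs) ?_ ?_
    · exact h1
    · exact h2.congr_fun fun n => by
        have : (-((n : ℤ) + 1)).natAbs = n + 1 := by omega
        rw [this]
  convert h3 using 1
  rw [div_eq_mul_inv]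
  ring

theorem hasSum_natAbs_mul_geometric {x y : ℂ} (hx : ‖x‖ < 1) (hy : ‖y‖ < 1) :
    HasSum (fun i : ℤ × ℕ => x ^ i.1.natAbs * y ^ i.2) ((1 + x) / (1 - x) * (1 - y)⁻¹) := by
  have h2 := hasSum_natAbs hx
  have h3 := hasSum_geometric_of_norm_lt_one hy
  exact h2.mul h3 (summable_mul_of_summable_norm (f := fun k : ℤ => x ^ k.natAbs)
    (g := fun n : ℕ => y ^ n) h2.summable.norm h3.summable.norm)

/-- Shifting `γ` by `-j` moves the break of the exponent to 0; the two halves are geometric series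
in `x = X ^ (2 e)`. -/
theorem hasSum_cells_inl {Q : ℝ} {X x : ℂ} (hX0 : X ≠ 0) {e : ℕ} (hx : ‖x‖ < 1)
    (hpow : ∀ n : ℕ, x ^ n = X ^ (2 * (e : ℤ) * n)) (j c ρ : ℤ) :
    HasSum (fun γ : ℤ => (cellWeight Q (.inl γ) : ℂ) * X ^ (-cellExponent e j c ρ (.inl γ)))
      (X ^ (-c + 2 * ρ - 2 * e * j) * (1 - x)⁻¹ + X ^ (-c + 2 * e * (j + 1)) * (1 - x)⁻¹) := by
  have h1 := hasSum_geometric_of_norm_lt_one hx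
  rw [← (Equiv.addRight (-j)).hasSum_iff]
  refine HasSum.of_nat_of_neg_add_one ?_ ?_
  · refine (h1.mul_left _).congr_fun fun n => ?_
    have : ¬ ((n : ℤ) + -j < -j) := by omega
    have hc : cellExponent e j c ρ (.inl ((n : ℤ) + -j)) = c - 2 * ρ - 2 * e * (n + -j) := by
      rw [cellExponent, if_neg this]
    change (cellWeight Q (.inl ((n : ℤ) + -j)) : ℂ) * X ^ (-cellExponent e j c ρ (.inl (n + -j))) =
        _
    rw [hc, cellWeight, Complex.ofReal_one, one_mul, hpow, ← zpow_add₀ hX0]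
    congr 1
    ring
  · refine (h1.mul_left _).congr_fun fun n => ?_
    have : -((n : ℤ) + 1) + -j < -j := by omega
    have hc : cellExponent e j c ρ (.inl (-((n : ℤ) + 1) + -j)) =
        c + 2 * e * (-((n : ℤ) + 1) + -j) := by
      rw [cellExponent, if_pos this]
    change (cellWeight Q (.inl (-((n : ℤ) + 1) + -j)) : ℂ) *
      X ^ (-cellExponent e j c ρ (.inl (-((n : ℤ) + 1) + -j))) = _
    rw [hc, cellWeight, Complex.ofReal_one, one_mul, hpow, ← zpow_add₀ hX0]
    congr 1
    ring

/-- The exponent separates `|k|` from `n`, so the double series is a product of the sum of `x ^ |k|`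
and the sum of `(Q x) ^ n`. The second factor is where `|Q x| < 1` is needed. -/
theorem hasSum_cells_inr {Q : ℝ} {X x : ℂ} (hX0 : X ≠ 0) {e : ℕ} (hx : ‖x‖ < 1)
    (hpow : ∀ n : ℕ, x ^ n = X ^ (2 * (e : ℤ) * n)) (hQx : ‖(Q : ℂ) * x‖ < 1) (j c ρ : ℤ) :
    HasSum (fun i : ℤ × ℕ => (cellWeight Q (.inr i) : ℂ) * X ^ (-cellExponent e j c ρ (.inr i)))
      ((Q - 1) * X ^ (-c + 2 * e * (j + 1)) * ((1 + x) / (1 - x) * (1 - Q * x)⁻¹)) := by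
  refine ((hasSum_natAbs_mul_geometric hx hQx).mul_left
    (((Q : ℂ) - 1) * X ^ (-c + 2 * e * (j + 1)))).congr_fun ?_
  rintro ⟨k, n⟩
  have : X ^ (-(c - 2 * (e : ℤ) * (j + n + 1) - 2 * e * |k|)) =
      X ^ (-c + 2 * e * (j + 1)) * X ^ (2 * (e : ℤ) * |k|) * X ^ (2 * (e : ℤ) * n) := by
    rw [← zpow_add₀ hX0, ← zpow_add₀ hX0]
    congr 1
    ring
  rw [cellWeight, cellExponent, this, mul_pow, hpow, hpow, Int.natCast_natAbs]
  push_cast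
  ring

theorem hasSum_cells {Q : ℝ} {X x : ℂ} (hX0 : X ≠ 0) {e : ℕ} (hx : ‖x‖ < 1)
    (hpow : ∀ n : ℕ, x ^ n = X ^ (2 * (e : ℤ) * n)) (hQx : ‖(Q : ℂ) * x‖ < 1) (j c ρ : ℤ) :
    HasSum (fun i => (cellWeight Q i : ℂ) * X ^ (-cellExponent e j c ρ i))
      (X ^ (-c) / (1 - x) * (X ^ (2 * e * (j + 1)) + X ^ (2 * ρ - 2 * e * j) +
        (Q - 1) * X ^ (2 * e * (j + 1)) * (1 + x) / (1 - Q * x))) := by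
  have h5 := HasSum.sum (f := fun i => (cellWeight Q i : ℂ) * X ^ (-cellExponent e j c ρ i))
    (hasSum_cells_inl hX0 hx hpow j c ρ) (hasSum_cells_inr hX0 hx hpow hQx j c ρ)
  convert h5 using 1
  have e1 : X ^ (-c + 2 * ρ - 2 * e * j) = X ^ (-c) * X ^ (2 * ρ - 2 * (e : ℤ) * j) := by
    rw [← zpow_add₀ hX0]
    congr 1
    ring
  have e2 : X ^ (-c + 2 * (e : ℤ) * (j + 1)) = X ^ (-c) * X ^ (2 * (e : ℤ) * (j + 1)) := by
    rw [← zpow_add₀ hX0]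
  rw [e1, e2]
  ring

/-- A power of `X = q ^ (-s)` is 1 at `X = 1`; positive powers go into the numerator and negative
ones into the denominator. -/
theorem HasValueAtZero.zpow_mul {q : ℕ} (hq : 0 < q) {J : ℂ → ℂ} {z : ℂ}
    (h : HasValueAtZero q J z) (n : ℤ) {J' : ℂ → ℂ} {σ : ℝ}
    (hJ' : ∀ s : ℂ, σ < s.re → J' s = ((q : ℂ) ^ (-s)) ^ n * J s) : HasValueAtZero q J' z := by
  obtain ⟨N, Q, hQ, hz, σ', h⟩ := h
  refine ⟨N * Polynomial.X ^ n.toNat, Q * Polynomial.X ^ (-n).toNat, ?_, ?_, max σ σ', ?_⟩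
  · simpa using hQ
  · simpa using hz
  · intro s hs
    have hX : (q : ℂ) ^ (-s) ≠ 0 := by
      rw [Ne, Complex.cpow_eq_zero_iff, not_and_or]
      exact Or.inl (Nat.cast_ne_zero.2 hq.ne')
    have h1 := h s ((le_max_right _ _).trans_lt hs)
    rw [hJ' s ((le_max_left _ _).trans_lt hs)]
    simp only [Polynomial.eval_mul, Polynomial.eval_pow, Polynomial.eval_X]
    rw [← h1]
    have h2 : ((q : ℂ) ^ (-s)) ^ n.toNat =
        ((q : ℂ) ^ (-s)) ^ (-n).toNat * ((q : ℂ) ^ (-s)) ^ n := by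
      rw [← zpow_natCast, ← zpow_natCast, ← zpow_add₀ hX]
      congr 1
      omega
    rw [h2]
    ring

theorem norm_cpow_neg_lt {q : ℕ} (hq : 1 < q) {s : ℂ} (hs : 1 < s.re) :
    ‖(q : ℂ) ^ (-s)‖ < (q : ℝ)⁻¹ := by
  rw [Complex.norm_natCast_cpow_of_pos (by omega), Complex.neg_re, ← Real.rpow_neg_one]
  exact Real.rpow_lt_rpow_of_exponent_lt (by exact_mod_cast hq) (by linarith)

theorem norm_mul_pow_lt_one {q : ℕ} (hq : 1 < q) {e : ℕ} (he : 0 < e) {X : ℂ}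
    (hX : ‖X‖ < (q : ℝ)⁻¹) : ‖(((q : ℝ) ^ e : ℝ) : ℂ) * X ^ (2 * e)‖ < 1 := by
  have hq1 : (1 : ℝ) < q := by exact_mod_cast hq
  have hX1 : ‖X‖ < 1 := hX.trans (inv_lt_one_of_one_lt₀ hq1)
  have h1 : (q : ℝ) * ‖X‖ < 1 := by
    have := mul_lt_mul_of_pos_left hX (by linarith : (0 : ℝ) < q)
    rwa [mul_inv_cancel₀ (by linarith)] at this
  rw [norm_mul, norm_pow, Complex.norm_real, norm_pow, Real.norm_of_nonneg (by linarith),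
    show 2 * e = e + e by ring, pow_add, ← mul_assoc, ← mul_pow, ← mul_pow]
  refine pow_lt_one₀ (by positivity) ?_ he.ne'
  calc (q : ℝ) * ‖X‖ * ‖X‖ ≤ 1 * ‖X‖ := by gcongr
    _ < 1 := by rwa [one_mul]

/-- The rational function attached to the series over the cells is regular at `s = 0` with nonzero
value. -/
theorem exists_value_of_cells {q : ℕ} (hq : 2 ≤ q) {v : ℝ} (hv : 0 < v) {e : ℕ} (he : 0 < e)
    {j c ρ : ℤ} (hj : 2 * e * j ≤ ρ) {J : ℂ → ℂ} {σ : ℝ}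
    (hJ : ∀ s : ℂ, σ < s.re → J s = v * (((q : ℂ) ^ (-s)) ^ (-c) / (1 - ((q : ℂ) ^ (-s)) ^ (2 * e))
        *
      (((q : ℂ) ^ (-s)) ^ (2 * e * (j + 1)) + ((q : ℂ) ^ (-s)) ^ (2 * ρ - 2 * e * j) +
        (((q : ℝ) ^ e : ℝ) - 1) * ((q : ℂ) ^ (-s)) ^ (2 * e * (j + 1)) *
          (1 + ((q : ℂ) ^ (-s)) ^ (2 * e)) / (1 - ((q : ℝ) ^ e : ℝ) * ((q : ℂ) ^ (-s)) ^ (2 * e)))))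
              :
    ∃ z : ℂ, z ≠ 0 ∧ HasValueAtZero q J z := by
  obtain ⟨Q, hQ⟩ : ∃ Q : ℝ, Q = (q : ℝ) ^ e := ⟨_, rfl⟩
  rw [← hQ] at hJ
  have hq1 : (1 : ℝ) < q := by exact_mod_cast hq
  have hQ1 : 1 < Q := hQ ▸ one_lt_pow₀ hq1 he.ne'
  -- `M` is any shift large enough to turn the integer exponents of `X` into natural numbers.
  obtain ⟨M, a, b, c', ha, hb, hc⟩ : ∃ M a b c' : ℕ, (2 * e * (j + 1) + M : ℤ) = a ∧
      (2 * ρ - 2 * e * j + M : ℤ) = b ∧ c + M = c' := by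
    refine ⟨(2 * e * (j + 1) : ℤ).natAbs + (2 * ρ - 2 * e * j : ℤ).natAbs + c.natAbs,
      (2 * e * (j + 1) + ((2 * e * (j + 1) : ℤ).natAbs + (2 * ρ - 2 * e * j : ℤ).natAbs +
        c.natAbs : ℕ) : ℤ).toNat,
      (2 * ρ - 2 * e * j + ((2 * e * (j + 1) : ℤ).natAbs + (2 * ρ - 2 * e * j : ℤ).natAbs +
        c.natAbs : ℕ) : ℤ).toNat,
      (c + ((2 * e * (j + 1) : ℤ).natAbs + (2 * ρ - 2 * e * j : ℤ).natAbs +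
        c.natAbs : ℕ) : ℤ).toNat, ?_, ?_, ?_⟩ <;> omega
  let T : Polynomial ℂ := Polynomial.X
  -- The numerator over the denominator `X ^ c' (1 - Q X ^ (2 e)) (1 - X ^ (2 e))`, up to the factor
  -- `v`. It vanishes at `X = 1`, which cancels the zero of `1 - X ^ (2 e)`.
  let P : Polynomial ℂ := (T ^ a + T ^ b) * (1 - Polynomial.C (Q : ℂ) * T ^ (2 * e)) +
    Polynomial.C ((Q : ℂ) - 1) * T ^ a * (1 + T ^ (2 * e))
  have hroot : P.IsRoot 1 := by
    simp only [P, T, Polynomial.IsRoot, Polynomial.eval_add, Polynomial.eval_mul,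
      Polynomial.eval_pow, Polynomial.eval_X, Polynomial.eval_C, Polynomial.eval_sub,
      Polynomial.eval_one, one_pow]
    ring
  obtain ⟨P₁, hP₁⟩ := Polynomial.dvd_iff_isRoot.2 hroot
  -- After removal of the factor `X - 1`, the value at 1 is the derivative of `P` there.
  have hP1 : P₁.eval 1 = ((Q - 1) * ((a : ℝ) - b) - 2 * e * (Q + 1) : ℝ) := by
    have h1 : P.derivative.eval 1 = P₁.eval 1 := by
      rw [hP₁, Polynomial.derivative_mul]
      simp
    rw [← h1]
    simp only [P, T, Polynomial.derivative_add, Polynomial.derivative_mul,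
        Polynomial.derivative_sub,
      Polynomial.derivative_X_pow, Polynomial.derivative_C, Polynomial.derivative_one,
      Polynomial.eval_add, Polynomial.eval_mul,
      Polynomial.eval_pow, Polynomial.eval_X, Polynomial.eval_C, Polynomial.eval_sub,
      Polynomial.eval_one, Polynomial.eval_zero, one_pow]
    push_cast
    ring
  have hP1' : P₁.eval 1 ≠ 0 := by
    rw [hP1, Complex.ofReal_ne_zero]
    -- Here `a - b = 2 e + 2 (2 e j - ρ)`, and `2 e j ≤ ρ` is the hypothesis `hj`. Hence the value
    -- at 1 is at most `2 e (Q - 1) - 2 e (Q + 1) = -4 e < 0`.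
    have h1 : ((a : ℤ) - b : ℤ) ≤ 2 * e := by
      rw [← ha, ← hb]
      linarith
    have h2 : (a : ℝ) - b ≤ 2 * e := by exact_mod_cast h1
    have h3 : (0 : ℝ) < e := by exact_mod_cast he
    nlinarith [mul_le_mul_of_nonneg_left h2 (sub_nonneg.2 hQ1.le)]
  -- The denominator divided by `X - 1`; the geometric sum is the quotient of `X ^ (2 e) - 1`, and
  -- the sign comes from `1 - X ^ (2 e)`.
  let R : Polynomial ℂ := T ^ c' * (1 - Polynomial.C (Q : ℂ) * T ^ (2 * e)) *
    -(∑ i ∈ Finset.range (2 * e), T ^ i)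
  have hR : R.eval 1 = ((Q - 1) * (2 * e) : ℝ) := by
    simp only [R, T, Polynomial.eval_mul, Polynomial.eval_pow, Polynomial.eval_X,
      Polynomial.eval_C, Polynomial.eval_sub, Polynomial.eval_one, one_pow, Polynomial.eval_neg,
      Polynomial.eval_finsetSum, Finset.sum_const, Finset.card_range, nsmul_eq_mul]
    push_cast
    ring
  have hR0 : R.eval 1 ≠ 0 := by
    rw [hR, Complex.ofReal_ne_zero]
    have h3 : (0 : ℝ) < e := by exact_mod_cast he
    exact (mul_pos (by linarith) (by positivity)).ne'
  have hvC : (v : ℂ) ≠ 0 := Complex.ofReal_ne_zero.2 hv.ne'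
  refine ⟨(Polynomial.C (v : ℂ) * P₁).eval 1 / R.eval 1, ?_, Polynomial.C (v : ℂ) * P₁, R, hR0, rfl,
    max σ 1, ?_⟩
  · refine div_ne_zero ?_ hR0
    rw [Polynomial.eval_mul, Polynomial.eval_C]
    exact mul_ne_zero hvC hP1'
  · intro s hs
    have hs1 : 1 < s.re := (le_max_right _ _).trans_lt hs
    rw [hJ s ((le_max_left _ _).trans_lt hs)]
    have hnorm := norm_cpow_neg_lt (by omega : 1 < q) hs1
    have hX : (q : ℂ) ^ (-s) ≠ 0 := by
      rw [Ne, Complex.cpow_eq_zero_iff, not_and_or]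
      exact Or.inl (Nat.cast_ne_zero.2 (by omega))
    generalize (q : ℂ) ^ (-s) = X at hnorm hX ⊢
    have hXlt : ‖X‖ < 1 := hnorm.trans (inv_lt_one_of_one_lt₀ hq1)
    have hx1 : 1 - X ^ (2 * e) ≠ 0 := by
      intro h
      have h1 : ‖X ^ (2 * e)‖ = 1 := by rw [← sub_eq_zero.1 h, norm_one]
      rw [norm_pow] at h1
      exact absurd h1 (pow_lt_one₀ (norm_nonneg X) hXlt (by omega)).ne
    have hQx : 1 - (Q : ℂ) * X ^ (2 * e) ≠ 0 := by
      intro h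
      have h1 : ‖(Q : ℂ) * X ^ (2 * e)‖ = 1 := by rw [← sub_eq_zero.1 h, norm_one]
      rw [hQ] at h1
      exact absurd h1 (norm_mul_pow_lt_one (by omega) he hnorm).ne
    have hX1 : X - 1 ≠ 0 := by
      intro h
      rw [sub_eq_zero.1 h, norm_one] at hXlt
      exact lt_irrefl _ hXlt
    have hPX : P.eval X = (X - 1) * P₁.eval X := by
      rw [hP₁]
      simp
    have hRX : (X - 1) * R.eval X = X ^ c' * (1 - Q * X ^ (2 * e)) * (1 - X ^ (2 * e)) := by
      have h1 := geom_sum_mul X (2 * e)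
      simp only [R, T, Polynomial.eval_mul, Polynomial.eval_pow, Polynomial.eval_X,
        Polynomial.eval_C, Polynomial.eval_sub, Polynomial.eval_one, Polynomial.eval_neg,
        Polynomial.eval_finsetSum]
      linear_combination (-(X ^ c' * (1 - Q * X ^ (2 * e)))) * h1
    have hc2 : X ^ c' * X ^ (-c) = X ^ M := by
      rw [← zpow_natCast, ← zpow_natCast, ← zpow_add₀ hX]
      congr 1
      omega
    have ha2 : X ^ M * X ^ (2 * (e : ℤ) * (j + 1)) = X ^ a := by
      rw [← zpow_natCast, ← zpow_natCast, ← zpow_add₀ hX, ← ha, add_comm]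
    have hb2 : X ^ M * X ^ (2 * ρ - 2 * (e : ℤ) * j) = X ^ b := by
      rw [← zpow_natCast, ← zpow_natCast, ← zpow_add₀ hX, ← hb, add_comm]
    refine mul_left_cancel₀ hX1 ?_
    rw [← mul_assoc, hRX, Polynomial.eval_mul, Polynomial.eval_C, mul_left_comm (X - 1), ← hPX]
    have hPX2 : P.eval X = (X ^ a + X ^ b) * (1 - Q * X ^ (2 * e)) +
        (Q - 1) * X ^ a * (1 + X ^ (2 * e)) := by
      simp [P, T]
    rw [hPX2, ← ha2, ← hb2, ← hc2]
    field_simp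

end Series

end LocalPeriod

namespace LocalPeriod

/-! ### Value of the period for `m = 2` and the main theorem. -/

section Value

variable {F E D : Type*} [NontriviallyNormedField F] [IsUltrametricDist F] [LocallyCompactSpace F]
  [Field E] [Algebra F E] [FiniteDimensional F E] [DivisionRing D] [Algebra F D]
  [FiniteDimensional F D] [IsDomain (D ⊗[F] E)]
  [TopologicalSpace D] [IsModuleTopology F D]
  [TopologicalSpace (D ⊗[F] E)] [IsModuleTopology F (D ⊗[F] E)]
  {lam : E} {h0 : 2 * lam ≠ 0} {τ : E ≃ₐ[F] E}
    [MeasurableSpace (Orbit F E D 2 (u0 F E D 2 lam h0))]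
    [BorelSpace (Orbit F E D 2 (u0 F E D 2 lam h0))]

theorem exists_period_two_value (hF : NormIsNormalised F) (hE : Module.finrank F E = 2)
    (hlam : lam ∉ Set.range (algebraMap F E)) (hlam2 : lam ^ 2 ∈ Set.range (algebraMap F E))
    (hτ : τ lam = -lam)
    (μ₂ : Measure (Orbit F E D 2 (u0 F E D 2 lam h0))) [μ₂.Regular]
    [SMulInvariantMeasure (GLn 2 D) (Orbit F E D 2 (u0 F E D 2 lam h0)) μ₂] (hμ₂ : μ₂ ≠ 0) :
    (∀ s : ℂ, 1 < s.re → Integrable (orbitFun F E D 2 (u0 F E D 2 lam h0) (phi F s)) μ₂) ∧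
      ∃ z : ℂ, z ≠ 0 ∧ HasValueAtZero (residueCard F)
        (fun s => period F E D 2 (u0 F E D 2 lam h0) μ₂ (phi F s)) z := by
  obtain ⟨v, e, j, c, ρ, hv, he, hj, h⟩ :=
    exists_period_two_series (D := D) (h0 := h0) hF hE hlam hlam2 hτ μ₂ hμ₂
  have hq : 2 ≤ residueCard F := two_le_residueCard
  have key : ∀ s : ℂ, 1 < s.re → _ := fun s hs =>
    have hX : ((residueCard F : ℂ) ^ (-s)) ≠ 0 := by
      rw [Ne, Complex.cpow_eq_zero_iff, not_and_or]
      exact Or.inl (Nat.cast_ne_zero.2 (by omega))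
    have hn := norm_cpow_neg_lt (by omega : 1 < residueCard F) hs
    have hx : ‖((residueCard F : ℂ) ^ (-s)) ^ (2 * e)‖ < 1 := by
      rw [norm_pow]
      exact pow_lt_one₀ (norm_nonneg _)
        (hn.trans (inv_lt_one_of_one_lt₀ (by exact_mod_cast hq))) (by omega)
    h s _ (hasSum_cells (Q := (residueCard F : ℝ) ^ e) hX hx
      (fun n => by
        rw [← pow_mul, ← zpow_natCast]
        push_cast
        rfl)
      (norm_mul_pow_lt_one (by omega) he hn) j c ρ)
  exact ⟨fun s hs => (key s hs).1, exists_value_of_cells hq hv he hj fun s hs => (key s hs).2⟩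

end Value

/-- The constant comparing the two periods is a power of the residue cardinality. -/
theorem exists_norm_div_max_pow_eq_zpow {F : Type*} [NontriviallyNormedField F]
    [IsUltrametricDist F] [LocallyCompactSpace F] (hF : NormIsNormalised F) {x y : F} (hx : x ≠ 0)
    (hy : y ≠ 0) (n : ℕ) :
    ∃ k : ℤ, (‖x‖ / max 1 ‖y‖ ^ 2) ^ n = (residueCard F : ℝ) ^ k := by
  have hq : (1 : ℝ) < residueCard F := by exact_mod_cast two_le_residueCard (F := F)
  obtain ⟨a, ha⟩ := exists_norm_eq_zpow hF hx
  obtain ⟨b, hb⟩ := exists_norm_eq_zpow hF hy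
  obtain ⟨c, hc⟩ : ∃ c : ℤ, max 1 ‖y‖ = (residueCard F : ℝ) ^ c := by
    rcases max_choice 1 ‖y‖ with h | h
    · exact ⟨0, by rw [h, zpow_zero]⟩
    · exact ⟨b, by rw [h, hb]⟩
  refine ⟨(a - c * 2) * n, ?_⟩
  rw [ha, hc, zpow_mul, zpow_sub₀ (by positivity), zpow_mul, zpow_natCast]
  rfl

end LocalPeriod

end

open LocalPeriod in
theorem mainTheorem6
    {F E D : Type*}
    -- a non-archimedean local field of characteristic different from 2
    [NontriviallyNormedField F] [IsUltrametricDist F] [LocallyCompactSpace F]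
    (hF : NormIsNormalised F) (h2 : (2 : F) ≠ 0)
    -- a quadratic extension
    [Field E] [Algebra F E] (hE : Module.finrank F E = 2)
    -- a central division algebra of odd index
    [DivisionRing D] [Algebra F D] [Algebra.IsCentral F D]
    (d : ℕ) (hd : Odd d) (hD : Module.finrank F D = d ^ 2)
    -- the topologies of finite-dimensional vector spaces over F
    [TopologicalSpace D] [IsModuleTopology F D]
    [TopologicalSpace (D ⊗[F] E)] [IsModuleTopology F (D ⊗[F] E)]
    (lam : E) (hlam : lam ∉ Set.range (algebraMap F E))
    (hlam2 : lam ^ 2 ∈ Set.range (algebraMap F E))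
    (r : ℕ) (hr : 1 ≤ r)
    (u : GLn (2 * r) (D ⊗[F] E))
    (hu : u = u0 F E D (2 * r) lam (two_mul_ne_zero_of_notMem h2 hlam))
    (u₂ : GLn 2 (D ⊗[F] E))
    (hu₂ : u₂ = u0 F E D 2 lam (two_mul_ne_zero_of_notMem h2 hlam))
    -- invariant measures for m = 2r and for m = 2
    [MeasurableSpace (Orbit F E D (2 * r) u)] [BorelSpace (Orbit F E D (2 * r) u)]
    (μ : MeasureTheory.Measure (Orbit F E D (2 * r) u)) [μ.Regular]
    [MeasureTheory.SMulInvariantMeasure (GLn (2 * r) D) (Orbit F E D (2 * r) u) μ] (hμ : μ ≠ 0)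
    [MeasurableSpace (Orbit F E D 2 u₂)] [BorelSpace (Orbit F E D 2 u₂)]
    (μ₂ : MeasureTheory.Measure (Orbit F E D 2 u₂)) [μ₂.Regular]
    [MeasureTheory.SMulInvariantMeasure (GLn 2 D) (Orbit F E D 2 u₂) μ₂] (hμ₂ : μ₂ ≠ 0)
    (κ : ℝ)
    (hκ : κ = (‖Algebra.norm F (2 * lam)‖ / (max 1 ‖Algebra.norm F lam‖) ^ 2) ^
      (d ^ 2 * (r ^ 2 - 1))) :
    IsOpen (doubleCoset F E D (2 * r) (middleParabolic (D ⊗[F] E) r) u) ∧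
    -- the integral over the open orbit is H-invariant wherever it converges
    (∀ (s : ℂ) (Ψ : GLn (2 * r) (D ⊗[F] E) → ℂ),
      MemInd (minParabolic (D ⊗[F] E) (2 * r)) (fun p => (borelModulus F p : ℂ) ^ s) Ψ →
      MeasureTheory.Integrable (orbitFun F E D (2 * r) u Ψ) μ →
      ∀ h : GLn (2 * r) D,
        MeasureTheory.Integrable
          (orbitFun F E D (2 * r) u (fun g => Ψ (g * embH F E D (2 * r) h))) μ ∧
        period F E D (2 * r) u μ (fun g => Ψ (g * embH F E D (2 * r) h)) =
          period F E D (2 * r) u μ Ψ) ∧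
    ∃ f : GLn (2 * r) (D ⊗[F] E) → ℂ,
      MemInd (middleParabolic (D ⊗[F] E) r) (fun _ => 1) f ∧
      (∀ g, f g ≠ 0 → g ∈ doubleCoset F E D (2 * r) (middleParabolic (D ⊗[F] E) r) u) ∧
      (∃ σ : ℝ, ∀ s : ℂ, σ < s.re →
        MeasureTheory.Integrable (orbitFun F E D (2 * r) u (fun g => f g * phi F s g)) μ ∧
        MeasureTheory.Integrable (orbitFun F E D 2 u₂ (phi F s)) μ₂ ∧
        period F E D (2 * r) u μ (fun g => f g * phi F s g) =
          (κ : ℂ) ^ s * period F E D 2 u₂ μ₂ (phi F s)) ∧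
      ∃ z : ℂ, z ≠ 0 ∧
        HasValueAtZero (residueCard F)
          (fun s => period F E D (2 * r) u μ (fun g => f g * phi F s g)) z ∧
        HasValueAtZero (residueCard F) (fun s => period F E D 2 u₂ μ₂ (phi F s)) z := by
  obtain ⟨τ, hτ⟩ := exists_conj hE hlam hlam2
  have : FiniteDimensional F E := FiniteDimensional.of_finrank_pos (by rw [hE]; norm_num)
  have : FiniteDimensional F D :=
    FiniteDimensional.of_finrank_pos (by rw [hD]; exact pow_pos hd.pos 2)
  have : NoZeroDivisors (D ⊗[F] E) := noZeroDivisors_tensor hE hd hD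
  have : IsDomain (D ⊗[F] E) := NoZeroDivisors.to_isDomain _
  have := isTopologicalGroup_GLn F (D := D) (2 * r)
  subst hu hu₂
  refine ⟨?_, ?_, ?_⟩
  -- The double coset is the case `J = ⊤` of the openness of `P u₀ J`.
  · have h := isOpen_middleParabolic_mul (D := D) (r := r)
      (h0 := two_mul_ne_zero_of_notMem h2 hlam) h2 hE hlam hτ ⊤ isOpen_univ
    simpa [doubleCoset] using h
  · intro s Ψ hΨ hi h
    refine integrable_and_period_translate μ (fun t ht g => ?_) hi h
    rw [hΨ.equivariant _ (mem_stab.1 ht), borelModulus_stab hτ ht, Complex.ofReal_one,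
      Complex.one_cpow, one_mul]
  · obtain ⟨f, hf, hsupp, hper⟩ := exists_test_function (D := D) hF h2 hE hlam hlam2 hτ hr μ hμ μ₂
      hμ₂ (κ := κ) (by rw [hκ, hD]; rfl)
    obtain ⟨hint, z, hz, hval⟩ := exists_period_two_value hF hE hlam hlam2 hτ μ₂ hμ₂
    have hlam0 := two_mul_ne_zero_of_notMem h2 hlam
    obtain ⟨k, hk⟩ := exists_norm_div_max_pow_eq_zpow hF
      (Algebra.norm_ne_zero_iff.2 hlam0 : Algebra.norm F (2 * lam) ≠ 0)
      (Algebra.norm_ne_zero_iff.2 (right_ne_zero_of_mul hlam0) : Algebra.norm F lam ≠ 0)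
      (d ^ 2 * (r ^ 2 - 1))
    have hq : 0 < residueCard F := two_pos.trans_le two_le_residueCard
    refine ⟨f, hf, hsupp, ⟨1, fun s hs => ?_⟩, z, hz, ?_, hval⟩
    · exact ⟨(hper s (hint s hs)).1, hint s hs, (hper s (hint s hs)).2⟩
    -- Since `κ = q ^ k`, the factor `κ ^ s` is `X ^ (-k)`, so rationality is kept and the value at
    -- `s = 0` is unchanged.
    · refine hval.zpow_mul hq (-k) (σ := 1) fun s hs => ?_
      rw [(hper s (hint s hs)).2, hκ, hk, ofReal_zpow_cpow hq]
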